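/- \textbf{Conventions.} $Ladder_n$ is the $2\times n$ grid graph: its nodes are $level(i)[1]$, $level(i)[2]$ for $1\le i\le n$; $level(i)[r]$ is adjacent to $level(i\pm1)[r]$, and $level(i)[1]$ to $level(i)[2]$. $Ladder_\infty$ is the same with $i\in\mathbb Z$. A \emph{correct embedding} of a graph $S$ into a graph $G$ is an injective map $V(S)\to V(G)$ that sends adjacent vertices to adjacent vertices. A map from $V(G)$ to a ladder is \emph{quasi-correct} if it sends adjacent vertices to adjacent nodes and at most three vertices to each level. Let $T$ be a finite tree. A vertex of degree three is \emph{single} if it has no neighbour of degree three. A \emph{support node} is a single vertex or a vertex lying on the path between two other vertices of degree three. The \emph{trunk core} of $T$ is the path whose ends are support nodes and which contains all support nodes (empty if there are none), enumerated from one end as $c[1],\dots,c[k]$. The components of $T$ minus the trunk core are called \emph{simple-graphs}; the edge from a simple-graph to the trunk core joins its \emph{head} to its \emph{foot} $c[i]$. It is \emph{inner} if $1<i<k$ and an \emph{exit-graph} if $i\in\{1,k\}$. Its \emph{hands} are the components left after deleting its head; it is zero-, one- or two-handed according to their number, and a hand $h$ is a line-graph enumerated $h[1],h[2],\dots$ from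 its vertex adjacent to the head. \textbf{Strategy.} A map $\tilde\varphi:V(T)\to V(Ladder_\infty)$ is \emph{produced by the strategy} from $c$ if the following holds. \emph{Case $k\le 1$}, according to the number of vertices of degree three (if there are more than three, or if $T$ is not of the form described, no map is produced). \begin{itemize} \item None: $T$ is a path $l$ and $\tilde\varphi(l[j])=level(j)[1]$. \item One: $T$ consists of two paths $l_1,l_2$ and an edge $(l_1[i],l_2[1])$; $\tilde\varphi(l_1[j])=level(j)[1]$, $\tilde\varphi(l_2[j])=level(i+j-1)[2]$. \item Two: $T$ consists of two paths $l_1,l_2$ and an edge $(l_1[i],l_2[j])$; $\tilde\varphi(l_1[m])=level(m)[1]$, $\tilde\varphi(l_2[m])=level(i+m-j)[2]$. \item Three: they are $a,b,c$ with edges $(a,b),(b,c)$; the third neighbour $d$ of $b$ is a leaf, and two paths $l_a^1,l_a^2$ hang at $a$ and two paths $l_c^1,l_c^2$ at $c$; $\tilde\varphi$ maps $b,d,a,c$ to $level(2)[1],level(2)[2],level(1)[1],level(3)[1]$, and $l_a^1[j],l_a^2[j],l_c^1[j],l_c^2[j]$ to $level(1-j)[1],level(2-j)[2],level(3+j)[1],level(2+j)[2]$.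 \end{itemize} \emph{Case $k\ge2$.} \begin{enumerate} \item $\tilde\varphi(c[i])=level(i)[1]$ for $1\le i\le k$. \item The head of an inner simple-graph with foot $c[i]$ goes to $level(i)[2]$. The nodes used by these heads, together with $level(1)[2]$ and $level(k)[2]$, are called \emph{reserved}. \item Let $l$ be an inner simple-graph with foot $c[i]$. To \emph{run} a hand $h$ of $l$ in direction $s\in\{1,-1\}$ means to put $h[j]$ on $level(i+sj)[2]$ for all $j$; the direction is \emph{free} for $h$ if no such node is reserved. \begin{itemize} \item If $l$ is two-handed, its hands run in opposite directions, chosen so that both are free. \item If $l$ is one-handed with hand $h$, and for some $s\in\{1,-1\}$ the node $c[i+s]$ is an inner node of the trunk core and the foot of a zero- or one-handed simple-graph $l_2$, and $-s$ is not free for $h$, then $h$ runs in direction $s$ and the hand of $l_2$ (if any) runs in direction $-s$. \item A one-handed $l$ to which the previous rule applies neither as $l$ nor as $l_2$ has its hand run in a free direction. \end{itemize} \item Let $(e,s)=(k,1)$ or $(e,s)=(1,-1)$. The two exit-graphs with foot $c[e]$ are named $l_1,l_2$ so that $l_1$ has at most one hand (and $l_2$ at most two). The head of $l_1$ goes to $level(e+s)[1]$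 and the $j$-th vertex of its hand, if any, to $level(e+s+sj)[1]$. The head of $l_2$ goes to $level(e)[2]$ and the $j$-th vertex of each of its hands to $level(e+sj)[2]$. \end{enumerate} \textbf{Lemma.} Let $T$ be a finite tree that has a correct embedding into $Ladder_n$. Then the trunk core of $T$ exists, and for each of its enumerations $c$ the strategy produces at least one map $\tilde\varphi$. Every map $\tilde\varphi$ produced by the strategy is quasi-correct, and after a translation of the levels it is a quasi-correct embedding of $T$ into $Ladder_{2n}$. -/

import Mathlib

namespace LadderTree

/-- The ladder whose levels are indexed by `L`: the point `(i, r)` is the node in row `r` of level `i`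
(rows `0` and `1` are the first and the second node of a level). `ladder (Fin n)` is the `2 × n` grid
`Ladder_n`, and `ladder ℤ` is the ladder that is infinite in both directions. -/
def ladder (L : Type*) [Preorder L] : SimpleGraph (L × Fin 2) :=
  (SimpleGraph.hasse L).boxProd (⊤ : SimpleGraph (Fin 2))

/-- A correct embedding of the graph `S` into the graph `G`. -/
def IsCorrectEmbedding {V W : Type*} (S : SimpleGraph V) (G : SimpleGraph W) (φ : V → W) : Prop :=
  Function.Injective φ ∧ ∀ u v, S.Adj u v → G.Adj (φ u) (φ v)

/-- A quasi-correct embedding of `G` into a ladder: images of adjacent vertices are adjacent, and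
every level receives at most three vertices. -/
def IsQuasiCorrect {V L : Type*} [Preorder L] (G : SimpleGraph V) (φ : V → L × Fin 2) : Prop :=
  (∀ u v, G.Adj u v → (ladder L).Adj (φ u) (φ v)) ∧ ∀ i : L, {v | (φ v).1 = i}.encard ≤ 3

section TrunkCore

variable {V : Type*}

def Deg3 (T : SimpleGraph V) (v : V) : Prop := (T.neighborSet v).encard = 3

/-- A node of degree three without neighbours of degree three. -/
def IsSingle (T : SimpleGraph V) (v : V) : Prop := Deg3 T v ∧ ∀ u, T.Adj v u → ¬ Deg3 T u

/-- Support nodes: single nodes, and the nodes on a path between two other nodes of degree three. -/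
def IsSupportNode (T : SimpleGraph V) (v : V) : Prop :=
  IsSingle T v ∨
    ∃ u w : V, u ≠ v ∧ w ≠ v ∧ Deg3 T u ∧ Deg3 T w ∧ ∃ p : T.Walk u w, p.IsPath ∧ v ∈ p.support

/-- The list `l` enumerates a path (a line-graph) of `T`, possibly empty. -/
def IsLine (T : SimpleGraph V) (l : List V) : Prop := l.IsChain T.Adj ∧ l.Nodup

/-- `c` enumerates the trunk core of `T`: the path that joins support nodes and passes through all
support nodes. It is the empty list if there are no support nodes. -/
def IsTrunkCore (T : SimpleGraph V) (c : List V) : Prop :=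
  IsLine T c ∧ (∀ v, IsSupportNode T v → v ∈ c) ∧
    (∀ v, c.head? = some v → IsSupportNode T v) ∧ (∀ v, c.getLast? = some v → IsSupportNode T v)

/-- The nodes of `l` are put in row `r`, the first one on level `a`, each next one `s` levels on. -/
def PlacedAlong (f : V → ℤ × Fin 2) (l : List V) (a s : ℤ) (r : Fin 2) : Prop :=
  ∀ (j : ℕ) (v : V), l[j]? = some v → f v = (a + s * j, r)

end TrunkCore

section SmallCore

variable {V : Type*}

/-! Trees with at most one trunk core node, by the number of nodes of degree three.
List positions are counted from `0`, levels from `1`. -/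

def SmallZero (T : SimpleGraph V) (f : V → ℤ × Fin 2) : Prop :=
  ∃ l : List V, IsLine T l ∧ (∀ v, v ∈ l) ∧ PlacedAlong f l 1 1 0

/-- `T` is the union of two lines and one more edge from `l₁[i]` to `l₂[j]`. -/
def IsTwoLines (T : SimpleGraph V) (l₁ l₂ : List V) (i j : ℕ) : Prop :=
  IsLine T l₁ ∧ IsLine T l₂ ∧ (l₁ ++ l₂).Nodup ∧ (∀ v, v ∈ l₁ ++ l₂) ∧
    ∃ u w, l₁[i]? = some u ∧ l₂[j]? = some w ∧ T.Adj u w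

def SmallOne (T : SimpleGraph V) (f : V → ℤ × Fin 2) : Prop :=
  ∃ (l₁ l₂ : List V) (i : ℕ), IsTwoLines T l₁ l₂ i 0 ∧
    PlacedAlong f l₁ 1 1 0 ∧ PlacedAlong f l₂ (i + 1) 1 1

def SmallTwo (T : SimpleGraph V) (f : V → ℤ × Fin 2) : Prop :=
  ∃ (l₁ l₂ : List V) (i j : ℕ), IsTwoLines T l₁ l₂ i j ∧
    PlacedAlong f l₁ 1 1 0 ∧ PlacedAlong f l₂ (i - j + 1) 1 1

def SmallThree (T : SimpleGraph V) (f : V → ℤ × Fin 2) : Prop :=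
  ∃ (a b c d : V) (la₁ la₂ lc₁ lc₂ : List V),
    Deg3 T a ∧ Deg3 T b ∧ Deg3 T c ∧ T.Adj a b ∧ T.Adj b c ∧ T.Adj b d ∧
    ([a, b, c, d] ++ la₁ ++ la₂ ++ lc₁ ++ lc₂).Nodup ∧
    (∀ v, v ∈ [a, b, c, d] ++ la₁ ++ la₂ ++ lc₁ ++ lc₂) ∧
    IsLine T (a :: la₁) ∧ IsLine T (a :: la₂) ∧ IsLine T (c :: lc₁) ∧ IsLine T (c :: lc₂) ∧
    f b = (2, 0) ∧ f d = (2, 1) ∧ f a = (1, 0) ∧ f c = (3, 0) ∧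
    PlacedAlong f la₁ 0 (-1) 0 ∧ PlacedAlong f la₂ 1 (-1) 1 ∧
    PlacedAlong f lc₁ 4 1 0 ∧ PlacedAlong f lc₂ 3 1 1

def SmallStrategy (T : SimpleGraph V) (f : V → ℤ × Fin 2) : Prop :=
  ({v | Deg3 T v}.encard = 0 ∧ SmallZero T f) ∨
  ({v | Deg3 T v}.encard = 1 ∧ SmallOne T f) ∨
  ({v | Deg3 T v}.encard = 2 ∧ SmallTwo T f) ∨
  ({v | Deg3 T v}.encard = 3 ∧ SmallThree T f)

end SmallCore

section LargeCore

variable {V : Type*}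

/-- The vertex sets of the connected components of the subgraph of `T` induced on `A`. -/
def components (T : SimpleGraph V) (A : Set V) : Set (Set V) :=
  {S | ∃ K : (T.induce A).ConnectedComponent, S = Subtype.val '' K.supp}

/-- `S` is a simple-graph, i.e. a component of `T` without the trunk core `c`; its leg joins its
foot `c[i]` to its head `x`. -/
def IsSimpleGraphAt (T : SimpleGraph V) (c : List V) (S : Set V) (i : ℕ) (x : V) : Prop :=
  S ∈ components T {v | v ∉ c} ∧ x ∈ S ∧ ∃ u, (c)[i]? = some u ∧ T.Adj u x

/-- The hands of the simple-graph `S` with head `x`. It is zero-, one- or two-handed according to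
their number. -/
def hands (T : SimpleGraph V) (S : Set V) (x : V) : Set (Set V) := components T (S \ {x})

/-- `i` is the position of an inner node of the trunk core `c`. -/
def IsInner (c : List V) (i : ℕ) : Prop := 0 < i ∧ i + 1 < c.length

/-- The hand `h` of a simple-graph with head `x` is a line-graph, enumerated from its node adjacent to
`x`, and with `x` thought of on level `a`, its `j`-th node (`j ≥ 1`) is put on level `a + s * j`,
row `r`. -/
def HandAlong (T : SimpleGraph V) (f : V → ℤ × Fin 2) (x : V) (h : Set V) (a s : ℤ)
    (r : Fin 2) : Prop :=
  ∃ l : List V, IsLine T (x :: l) ∧ (∀ v, v ∈ l ↔ v ∈ h) ∧ PlacedAlong f l (a + s) s r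

/-- The levels whose node in row `1` is used in the second step: heads of the inner simple-graphs, and
the two phantom nodes next to the ends of the trunk core. -/
def stepTwoLevels (T : SimpleGraph V) (c : List V) : Set ℤ :=
  {m | m = 1 ∨ m = c.length ∨
    ∃ (S : Set V) (i : ℕ) (x : V), IsInner c i ∧ IsSimpleGraphAt T c S i x ∧ m = i + 1}

/-- Running the hand `h` from the head on level `a` in direction `s` would map some node of `h` to a
place used in the second step. -/
def Hits (T : SimpleGraph V) (c : List V) (h : Set V) (a s : ℤ) : Prop :=
  ∃ j : ℕ, 1 ≤ j ∧ j ≤ h.ncard ∧ a + s * j ∈ stepTwoLevels T c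

/-- The two constrained cases for a one-handed inner simple-graph `S` with hand `h` (`s = 1` is
the first one, `s = -1` the symmetric one): the trunk core node after the foot of `S` in direction `s`
is inner and is the foot of a one-handed or zero-handed `S'`, and running `h` in direction `-s` would
hit a place used in the second step. -/
def IsPairCase (T : SimpleGraph V) (c : List V) (s : ℤ) (S : Set V) (i : ℕ) (x : V) (h : Set V)
    (S' : Set V) (i' : ℕ) (x' : V) : Prop :=
  IsInner c i ∧ IsSimpleGraphAt T c S i x ∧ hands T S x = {h} ∧
    IsInner c i' ∧ (i' : ℤ) = i + s ∧ IsSimpleGraphAt T c S' i' x' ∧ (hands T S' x').Subsingleton ∧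
    Hits T c h (i + 1) (-s)

/-- The simple-graph `S` takes part in some constrained case (in either role). -/
def IsPaired (T : SimpleGraph V) (c : List V) (S : Set V) : Prop :=
  ∃ (s : ℤ) (S₁ : Set V) (i₁ : ℕ) (x₁ : V) (h₁ : Set V) (S₂ : Set V) (i₂ : ℕ) (x₂ : V),
    (s = 1 ∨ s = -1) ∧ IsPairCase T c s S₁ i₁ x₁ h₁ S₂ i₂ x₂ ∧ (S = S₁ ∨ S = S₂)

/-- Step 1: the trunk core occupies the first row. -/
def StepOne (c : List V) (f : V → ℤ × Fin 2) : Prop := PlacedAlong f c 1 1 0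

/-- Step 2: the head of an inner simple-graph is put opposite to its foot. -/
def StepTwo (T : SimpleGraph V) (c : List V) (f : V → ℤ × Fin 2) : Prop :=
  ∀ (S : Set V) (i : ℕ) (x : V), IsInner c i → IsSimpleGraphAt T c S i x → f x = ((i : ℤ) + 1, 1)

/-- Step 3 for the two-handed inner simple-graphs. -/
def StepThreeTwoHanded (T : SimpleGraph V) (c : List V) (f : V → ℤ × Fin 2) : Prop :=
  ∀ (S : Set V) (i : ℕ) (x : V) (h₁ h₂ : Set V), IsInner c i → IsSimpleGraphAt T c S i x →
    h₁ ≠ h₂ → hands T S x = {h₁, h₂} →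
    ∃ s : ℤ, (s = 1 ∨ s = -1) ∧ ¬ Hits T c h₁ (i + 1) s ∧ ¬ Hits T c h₂ (i + 1) (-s) ∧
      HandAlong T f x h₁ (i + 1) s 1 ∧ HandAlong T f x h₂ (i + 1) (-s) 1

/-- Step 3 for the one-handed inner simple-graphs in the two constrained cases: the hands of `S` and
`S'` are defined together and run towards each other's foot. -/
def StepThreePair (T : SimpleGraph V) (c : List V) (f : V → ℤ × Fin 2) : Prop :=
  ∀ (s : ℤ) (S : Set V) (i : ℕ) (x : V) (h : Set V) (S' : Set V) (i' : ℕ) (x' : V),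
    (s = 1 ∨ s = -1) → IsPairCase T c s S i x h S' i' x' →
    HandAlong T f x h (i + 1) s 1 ∧
      ∀ h' ∈ hands T S' x', HandAlong T f x' h' (i' + 1) (-s) 1

/-- Step 3 for the remaining one-handed inner simple-graphs. -/
def StepThreeOneHanded (T : SimpleGraph V) (c : List V) (f : V → ℤ × Fin 2) : Prop :=
  ∀ (S : Set V) (i : ℕ) (x : V) (h : Set V), IsInner c i → IsSimpleGraphAt T c S i x →
    hands T S x = {h} → ¬ IsPaired T c S →
    ∃ s : ℤ, (s = 1 ∨ s = -1) ∧ ¬ Hits T c h (i + 1) s ∧ HandAlong T f x h (i + 1) s 1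

/-- Step 4 at the end `c[e]` of the trunk core, `s` being the outward direction: there are exactly two
exit-graphs, one of them, `S₁`, has at most one hand and continues the first row; the head of the other,
`S₂`, is opposite to the end of the trunk core and all its hands (one or two) run outwards in the
second row. -/
def StepFour (T : SimpleGraph V) (c : List V) (f : V → ℤ × Fin 2) (e : ℕ) (s : ℤ) : Prop :=
  ∃ (S₁ S₂ : Set V) (x₁ x₂ : V), S₁ ≠ S₂ ∧
    IsSimpleGraphAt T c S₁ e x₁ ∧ IsSimpleGraphAt T c S₂ e x₂ ∧
    (∀ (S : Set V) (x : V), IsSimpleGraphAt T c S e x → S = S₁ ∨ S = S₂) ∧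
    (hands T S₁ x₁).Subsingleton ∧ (hands T S₂ x₂).encard ≤ 2 ∧
    f x₁ = ((e : ℤ) + 1 + s, 0) ∧ (∀ h ∈ hands T S₁ x₁, HandAlong T f x₁ h (e + 1 + s) s 0) ∧
    f x₂ = ((e : ℤ) + 1, 1) ∧ (∀ h ∈ hands T S₂ x₂, HandAlong T f x₂ h (e + 1) s 1)

def LargeStrategy (T : SimpleGraph V) (c : List V) (f : V → ℤ × Fin 2) : Prop :=
  StepOne c f ∧ StepTwo T c f ∧ StepThreeTwoHanded T c f ∧ StepThreePair T c f ∧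
    StepThreeOneHanded T c f ∧ StepFour T c f (c.length - 1) 1 ∧ StepFour T c f 0 (-1)

/-- `f` is a result of the embedding strategy for the tree `T` with trunk core `c`. -/
def IsStrategyEmbedding (T : SimpleGraph V) (c : List V) (f : V → ℤ × Fin 2) : Prop :=
  (c.length ≤ 1 ∧ SmallStrategy T f) ∨ (2 ≤ c.length ∧ LargeStrategy T c f)

end LargeCore

end LadderTree

/-!
A correct embedding into a ladder gives every vertex a level and a row, and almost everything is read
off from these coordinates (`GridCoords`). A vertex of degree three is adjacent to *all* vertices
on the three neighbouring nodes (`GridCoords.adj_of_deg3`). Hence the basic obstruction: where a path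
of the tree makes a U-turn, its two arms run side by side, and since the tree has no cycle, no vertex
of either arm has degree three as long as both arms last (`GridCoords.not_deg3_of_uturn`). In
particular a path between two vertices of degree three makes no U-turn.

*The trunk core exists* (`exists_isTrunkCore`). A longest path between support nodes contains all
of them: otherwise some vertex has three branches, each with a vertex of degree three behind its head,
and one of the resulting paths makes a U-turn.

*A large trunk core.* Its ends have degree three, and outside it only heads can have degree three, so
hands are lines, and the reserved levels are those of core nodes of degree three. Consider an inner
simple-graph with foot `c[i]`. If the given embedding keeps the core in one row next to the foot, then
each hand forms a U-turn with one half of the core and therefore has a free direction; two hands use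
different halves (`IsTrunkCore.straight`). If the core goes within one level from `c[i]` to
`c[i + s]`, then it continues beyond that node next to the simple-graph, so there is at most one hand,
and among the nodes that this hand would use in direction `s`, only the one opposite to `c[i + s]` can
be reserved (`IsTrunkCore.corner`). Constrained cases occur only at such vertical steps
(`IsPairCase.coreVert`); a vertex has at most one vertical neighbour, so different constrained cases
do not interfere, and in the remaining cases a free direction is left (`IsTrunkCore.exists_free`). This
proves that a map is produced.

*Produced maps are quasi-correct* (`LargeStrategy.isQuasiCorrect`). A tree is a minimal connected
graph, so a map respects all edges as soon as the respected edges connect all vertices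
(`adj_map_of_reachable`). The first row receives at most one vertex on each level. In the second row
between the ends of the core, two hands running in the same direction never meet (`Runs.eq`), and
a head cannot be hit from both sides, since its foot would have two vertical neighbours
(`Runs.false_of_both`); so of the three possible kinds of vertices (head, hand running up, hand running
down) at most two are present. Beyond the ends there are at most the two hands of one exit-graph.

With at most one core node there are at most three vertices of degree three, in one of the four listed
configurations. Finally the image of a connected graph occupies an interval of levels, which are at most
as many as there are vertices, hence at most `2 * n` (`IsQuasiCorrect.exists_fin`).
-/

namespace LadderTree

/-! ### Branches and lines of a tree -/

section Branches

variable {V : Type*} {T : SimpleGraph V}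

/-- The branch of `T` at `u` through `x` (a neighbour of `u` in all uses): the vertices that can be
reached from `x` by a walk avoiding `u`. -/
def Branch (T : SimpleGraph V) (u x : V) : Set V := {v | ∃ p : T.Walk x v, u ∉ p.support}

theorem head_mem_branch {u x : V} (h : T.Adj u x) : x ∈ Branch T u x :=
  ⟨.nil, by simpa using h.ne⟩

theorem not_mem_branch {u x : V} : u ∉ Branch T u x := by
  rintro ⟨p, hp⟩; exact hp p.end_mem_support

theorem Branch.of_walk {u x v w : V} (hv : v ∈ Branch T u x) (p : T.Walk v w)
    (hp : u ∉ p.support) : w ∈ Branch T u x := by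
  obtain ⟨q, hq⟩ := hv
  exact ⟨q.append p, by rw [SimpleGraph.Walk.mem_support_append_iff]; tauto⟩

theorem Branch.extend {u x v w : V} (hv : v ∈ Branch T u x) (h : T.Adj v w) (hw : w ≠ u) :
    w ∈ Branch T u x := by
  refine Branch.of_walk hv h.toWalk ?_
  have : u ≠ v := by rintro rfl; exact not_mem_branch hv
  simp [this, hw.symm]

theorem Branch.exists_path {u x v : V} (hv : v ∈ Branch T u x) :
    ∃ p : T.Walk x v, p.IsPath ∧ u ∉ p.support := by
  classical
  obtain ⟨q, hq⟩ := hv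
  exact ⟨q.bypass, q.bypass_isPath, fun h => hq (q.support_bypass_subset_support h)⟩

/-- In an acyclic graph, a branch can be entered only through its head. -/
theorem Branch.mem_support_of_walk (hT : T.IsAcyclic) {u x v : V} (h : T.Adj u x)
    (hv : v ∈ Branch T u x) (p : T.Walk u v) : x ∈ p.support := by
  classical
  obtain ⟨q, hq, hu⟩ := Branch.exists_path hv
  have := (hT.subsingleton_path _ _).elim ⟨_, p.bypass_isPath⟩ ⟨_, hq.cons (h := h) hu⟩
  have := congrArg (fun r : T.Path u v => (r : T.Walk u v).support) this
  apply p.support_bypass_subset_support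
  simp only at this
  rw [this]; simp

theorem Branch.head_unique (hT : T.IsAcyclic) {u x x' v : V} (h : T.Adj u x) (h' : T.Adj u x')
    (hv : v ∈ Branch T u x) (hv' : v ∈ Branch T u x') : x = x' := by
  classical
  obtain ⟨q, hq, hu⟩ := Branch.exists_path hv
  obtain ⟨q', hq', hu'⟩ := Branch.exists_path hv'
  have := (hT.subsingleton_path _ _).elim ⟨_, hq.cons (h := h) hu⟩ ⟨_, hq'.cons (h := h') hu'⟩
  have := congrArg (fun r : T.Path u v => (r : T.Walk u v).snd) this
  simpa using this

/-- In an acyclic graph, every walk leaving a branch passes through its head `x` and through `u`. -/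
theorem Branch.mem_support_of_exit (hT : T.IsAcyclic) {u x v w : V} (h : T.Adj u x)
    (hv : v ∈ Branch T u x) (hw : w ∉ Branch T u x) (p : T.Walk v w) :
    x ∈ p.support ∧ u ∈ p.support := by
  classical
  have hu : u ∈ p.support := by
    by_contra hp; exact hw (Branch.of_walk hv p hp)
  refine ⟨?_, hu⟩
  have := Branch.mem_support_of_walk hT h hv (p.takeUntil u hu).reverse
  rw [SimpleGraph.Walk.support_reverse, List.mem_reverse] at this
  exact p.support_takeUntil_subset_support hu this

theorem Branch.not_mem_swap (hT : T.IsAcyclic) {u x v : V} (h : T.Adj u x)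
    (hv : v ∈ Branch T u x) : v ∉ Branch T x u := by
  rintro ⟨p, hp⟩
  exact hp (Branch.mem_support_of_walk hT h hv p)

theorem exists_mem_branch (hT : T.Connected) {u v : V} (h : v ≠ u) :
    ∃ x, T.Adj u x ∧ v ∈ Branch T u x := by
  obtain ⟨p, hp⟩ := hT.exists_isPath u v
  cases p with
  | nil => exact absurd rfl h
  | cons h' q =>
    rw [SimpleGraph.Walk.cons_isPath_iff] at hp
    exact ⟨_, h', q, hp.2⟩

theorem Branch.adj (hT : T.IsAcyclic) {u x v w : V} (h : T.Adj u x)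
    (hv : v ∈ Branch T u x) (hvw : T.Adj v w) : w ∈ Branch T u x ∨ (w = u ∧ v = x) := by
  by_cases hw : w = u
  · subst hw
    exact Or.inr ⟨rfl, (Branch.head_unique hT h hvw.symm hv (head_mem_branch hvw.symm)).symm⟩
  · exact Or.inl (Branch.extend hv hvw hw)

theorem branch_subset (hT : T.IsAcyclic) {u x y : V} (h : T.Adj u x) (hy : T.Adj x y)
    (hyu : y ≠ u) : Branch T x y ⊆ Branch T u x := by
  classical
  rintro v ⟨p, hp⟩
  refine Branch.of_walk (Branch.extend (head_mem_branch h) hy hyu) p fun hu => hyu ?_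
  have h1 : u ∈ Branch T x y :=
    ⟨p.takeUntil u hu, fun hx => hp (p.support_takeUntil_subset_support hu hx)⟩
  exact Branch.head_unique hT hy h.symm h1 (head_mem_branch h.symm)

/-- A vertex of a branch other than its head lies in exactly one deeper branch. -/
theorem Branch.exists_sub (hT : T.IsTree) {u x v : V} (h : T.Adj u x) (hv : v ∈ Branch T u x)
    (hvx : v ≠ x) : ∃ y, T.Adj x y ∧ y ≠ u ∧ v ∈ Branch T x y := by
  obtain ⟨y, hy, hvy⟩ := exists_mem_branch hT.1 hvx
  refine ⟨y, hy, ?_, hvy⟩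
  rintro rfl
  exact Branch.not_mem_swap hT.2 h hv hvy

/-- In an acyclic graph two vertices have at most one common neighbour. -/
theorem eq_of_adj_of_adj (hT : T.IsAcyclic) {u v x y : V} (hux : T.Adj u x) (huy : T.Adj u y)
    (hvx : T.Adj v x) (hvy : T.Adj v y) (huv : u ≠ v) : x = y := by
  have h1 := Branch.extend (head_mem_branch hux) hvx.symm huv.symm
  have h2 := Branch.extend (head_mem_branch huy) hvy.symm huv.symm
  exact Branch.head_unique hT hux huy h1 h2

theorem IsLine.of_cons {a : V} {l : List V} (h : IsLine T (a :: l)) : IsLine T l :=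
  ⟨h.1.of_cons, h.2.of_cons⟩

theorem IsLine.reverse {l : List V} (h : IsLine T l) : IsLine T l.reverse := by
  refine ⟨?_, List.nodup_reverse.2 h.2⟩
  rw [List.isChain_reverse]
  exact h.1.imp fun _ _ h => h.symm

theorem isLine_append {l₁ l₂ : List V} (h₁ : IsLine T l₁) (h₂ : IsLine T l₂)
    (hd : ∀ v ∈ l₁, v ∉ l₂) (ha : ∀ x ∈ l₁.getLast?, ∀ y ∈ l₂.head?, T.Adj x y) :
    IsLine T (l₁ ++ l₂) := by
  refine ⟨List.isChain_append.2 ⟨h₁.1, h₂.1, ha⟩, List.nodup_append.2 ⟨h₁.2, h₂.2, ?_⟩⟩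
  rintro a ha b hb rfl
  exact hd a ha hb

theorem IsLine.left {l₁ l₂ : List V} (h : IsLine T (l₁ ++ l₂)) : IsLine T l₁ :=
  ⟨h.1.left_of_append, h.2.of_append_left⟩

theorem IsLine.right {l₁ l₂ : List V} (h : IsLine T (l₁ ++ l₂)) : IsLine T l₂ :=
  ⟨h.1.right_of_append, h.2.of_append_right⟩

theorem IsLine.adj_succ {l : List V} (h : IsLine T l) {i : ℕ} (hi : i + 1 < l.length) :
    T.Adj l[i] l[i + 1] := h.1.getElem _ _

theorem isLine_support {u v : V} {p : T.Walk u v} (hp : p.IsPath) : IsLine T p.support :=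
  ⟨p.isChain_adj_support, hp.support_nodup⟩

theorem exists_walk_of_isChain {w : V} : ∀ {a : V} {l : List V}, (a :: l).IsChain T.Adj →
    w ∈ a :: l → ∃ p : T.Walk a w, ∀ z ∈ p.support, z ∈ a :: l
  | a, [], _, hw => by
    obtain rfl : w = a := by simpa using hw
    exact ⟨.nil, by simp⟩
  | a, b :: l, h, hw => by
    rcases List.mem_cons.1 hw with rfl | hw
    · exact ⟨.nil, by simp⟩
    · rw [List.isChain_cons_cons] at h
      obtain ⟨p, hp⟩ := exists_walk_of_isChain h.2 hw
      refine ⟨.cons h.1 p, fun z hz => ?_⟩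
      rw [SimpleGraph.Walk.support_cons, List.mem_cons] at hz
      rcases hz with rfl | hz
      · simp
      · exact List.mem_cons_of_mem _ (hp z hz)

theorem IsLine.mem_branch {a b w : V} {l : List V} (h : IsLine T (a :: b :: l))
    (hw : w ∈ b :: l) : w ∈ Branch T a b := by
  obtain ⟨p, hp⟩ := exists_walk_of_isChain h.1.of_cons hw
  exact ⟨p, fun ha => (List.nodup_cons.1 h.2).1 (hp a ha)⟩

theorem IsLine.eq_of_adj (hT : T.IsAcyclic) {a b w : V} {l : List V} (h : IsLine T (a :: b :: l))
    (hw : w ∈ b :: l) (haw : T.Adj a w) : w = b :=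
  Branch.head_unique hT haw (List.isChain_cons_cons.1 h.1).1 (head_mem_branch haw) (h.mem_branch hw)

/-- In an acyclic graph only consecutive vertices of a line are adjacent. -/
theorem IsLine.eq_succ_of_adj (hT : T.IsAcyclic) {l : List V} (h : IsLine T l) {i j : ℕ}
    (hij : i < j) (hj : j < l.length) (ha : T.Adj l[i] l[j]) : j = i + 1 := by
  have h1 : IsLine T (l.drop i) := by
    rw [← List.take_append_drop i l] at h; exact h.right
  rw [List.drop_eq_getElem_cons (by omega), List.drop_eq_getElem_cons (by omega)] at h1
  have h2 : l[j] ∈ l.drop (i + 1) := by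
    rw [List.mem_iff_getElem]
    exact ⟨j - (i + 1), by simp; omega, by simp; congr; omega⟩
  rw [List.drop_eq_getElem_cons (by omega)] at h2
  have := h1.eq_of_adj hT h2 ha
  exact (h.2.getElem_inj_iff).1 this

theorem IsLine.adj_iff (hT : T.IsAcyclic) {l : List V} (h : IsLine T l) {i j : ℕ}
    (hi : i < l.length) (hj : j < l.length) : T.Adj l[i] l[j] ↔ j = i + 1 ∨ i = j + 1 := by
  constructor
  · intro ha
    rcases lt_trichotomy i j with hij | rfl | hij
    · exact Or.inl (h.eq_succ_of_adj hT hij hj ha)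
    · exact absurd rfl ha.ne
    · exact Or.inr (h.eq_succ_of_adj hT hij hi ha.symm)
  · rintro (rfl | rfl)
    · exact h.adj_succ hj
    · exact (h.adj_succ hi).symm

/-- A branch without vertices of degree at least three is a line. -/
theorem exists_line_of_branch [Finite V] (hT : T.IsTree) {u x : V} (h : T.Adj u x)
    (hdeg : ∀ v ∈ Branch T u x, ∀ a b c, T.Adj v a → T.Adj v b → T.Adj v c →
      a ≠ b → a ≠ c → b ≠ c → False) :
    ∃ l : List V, IsLine T (u :: x :: l) ∧ ∀ v, v ∈ x :: l ↔ v ∈ Branch T u x := by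
  induction hn : (Branch T u x).ncard using Nat.strong_induction_on generalizing u x with
  | _ n ih =>
    -- the degree bound at `x` makes the deeper branch through `y` all of the branch but `x`
    by_cases hy : ∃ y, T.Adj x y ∧ y ≠ u
    · obtain ⟨y, hxy, hyu⟩ := hy
      have hsub := branch_subset hT.2 h hxy hyu
      have hlt : (Branch T x y).ncard < n := by
        rw [← hn]
        refine Set.ncard_lt_ncard ⟨hsub, fun hs => ?_⟩ (Set.toFinite _)
        exact not_mem_branch (hs (head_mem_branch h))
      obtain ⟨l, hl, hm⟩ := ih _ hlt hxy (fun v hv => hdeg v (hsub hv)) rfl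
      refine ⟨y :: l, ⟨List.isChain_cons_cons.2 ⟨h, hl.1⟩, List.nodup_cons.2 ⟨?_, hl.2⟩⟩, ?_⟩
      · rw [List.mem_cons, hm]
        rintro (hux | hu)
        · exact h.ne hux
        · exact not_mem_branch (hsub hu)
      · intro v
        rw [List.mem_cons, hm]
        constructor
        · rintro (rfl | hv)
          · exact head_mem_branch h
          · exact hsub hv
        · intro hv
          by_cases hvx : v = x
          · exact Or.inl hvx
          · obtain ⟨z, hz, hzu, hvz⟩ := Branch.exists_sub hT h hv hvx
            by_cases hzy : z = y
            · exact Or.inr (hzy ▸ hvz)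
            · exact (hdeg x (head_mem_branch h) u y z h.symm hxy hz hyu.symm hzu.symm
                (Ne.symm hzy)).elim
    · push Not at hy
      refine ⟨[], ⟨by simpa using h, by simpa using h.ne⟩, fun v => ?_⟩
      simp only [List.mem_singleton]
      constructor
      · rintro rfl; exact head_mem_branch h
      · intro hv
        by_contra hvx
        obtain ⟨z, hz, hzu, -⟩ := Branch.exists_sub hT h hv hvx
        exact hzu (hy z hz)

/-- A line with a given end and a given second vertex, leading to a given vertex of the branch. -/
theorem Branch.exists_isLine {u x v : V} (h : T.Adj u x) (hv : v ∈ Branch T u x) :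
    ∃ l : List V, IsLine T (u :: x :: l) ∧ (x :: l).getLast? = some v ∧
      ∀ w ∈ x :: l, w ∈ Branch T u x := by
  obtain ⟨p, hp, hu⟩ := Branch.exists_path hv
  have hl := isLine_support (hp.cons (h := h) hu)
  rw [SimpleGraph.Walk.support_cons] at hl
  have hs : p.support = x :: p.support.tail := (p.cons_tail_support).symm
  refine ⟨p.support.tail, hs ▸ hl, ?_, fun w hw => ?_⟩
  · rw [← hs, List.getLast?_eq_some_getLast p.support_ne_nil, p.getLast_support]
  · rw [hs] at hl
    exact hl.mem_branch hw

end Branches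

section Cores

variable {V : Type*} {T : SimpleGraph V}

/-! ### Components and support nodes -/

/-- The components of the subgraph induced on `A`, described by walks of `T` that stay in `A`. -/
theorem mem_components_iff {A S : Set V} :
    S ∈ components T A ↔ ∃ a ∈ A, S = {v | ∃ p : T.Walk a v, ∀ w ∈ p.support, w ∈ A} := by
  have key : ∀ a (ha : a ∈ A), Subtype.val '' ((T.induce A).connectedComponentMk ⟨a, ha⟩).supp =
      {v | ∃ p : T.Walk a v, ∀ w ∈ p.support, w ∈ A} := by
    intro a ha
    ext v
    simp only [Set.mem_image, SimpleGraph.ConnectedComponent.mem_supp_iff,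
      SimpleGraph.ConnectedComponent.eq, Set.mem_ofPred_eq]
    constructor
    · rintro ⟨⟨w, hw⟩, ⟨p⟩, rfl⟩
      refine ⟨(p.reverse.map (SimpleGraph.Embedding.induce A).toHom), fun z hz => ?_⟩
      have hz' := (SimpleGraph.Walk.support_map (SimpleGraph.Embedding.induce A).toHom p.reverse) ▸ hz
      rw [List.mem_map] at hz'
      obtain ⟨y, -, rfl⟩ := hz'
      exact y.2
    · rintro ⟨p, hp⟩
      exact ⟨⟨v, hp v p.end_mem_support⟩, ⟨(p.induce A hp).reverse⟩, rfl⟩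
  constructor
  · rintro ⟨K, rfl⟩
    induction K using SimpleGraph.ConnectedComponent.ind with
    | _ a => exact ⟨a.1, a.2, key a.1 a.2⟩
  · rintro ⟨a, ha, rfl⟩
    exact ⟨_, (key a ha).symm⟩

theorem Branch.of_mem_support {u x v : V} {p : T.Walk x v} (hp : u ∉ p.support) {z : V}
    (hz : z ∈ p.support) : z ∈ Branch T u x := by
  classical
  exact ⟨p.takeUntil z hz, fun h => hp (p.support_takeUntil_subset_support hz h)⟩

theorem IsLine.exists_walk {l : List V} (h : IsLine T l) {a b : V} (ha : a ∈ l) (hb : b ∈ l) :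
    ∃ p : T.Walk a b, ∀ z ∈ p.support, z ∈ l := by
  cases l with
  | nil => simp at ha
  | cons c l =>
    obtain ⟨p, hp⟩ := exists_walk_of_isChain h.1 ha
    obtain ⟨q, hq⟩ := exists_walk_of_isChain h.1 hb
    refine ⟨p.reverse.append q, fun z hz => ?_⟩
    rw [SimpleGraph.Walk.mem_support_append_iff, SimpleGraph.Walk.support_reverse,
      List.mem_reverse] at hz
    exact hz.elim (hp z) (hq z)

/-- A branch leaving a line contains no vertex of that line. -/
theorem IsLine.not_mem_branch (hT : T.IsAcyclic) {c : List V} (hc : IsLine T c) {u x w : V}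
    (hu : u ∈ c) (hx : x ∉ c) (h : T.Adj u x) (hw : w ∈ c) : w ∉ Branch T u x := by
  intro hb
  obtain ⟨p, hp⟩ := hc.exists_walk hu hw
  exact hx (hp x (Branch.mem_support_of_walk hT h hb p))

/-- The simple-graphs are the branches that leave the trunk core; this replaces components by
branches from here on. -/
theorem isSimpleGraphAt_iff (hT : T.IsAcyclic) {c : List V} (hc : IsLine T c) {S : Set V} {i : ℕ}
    {x : V} : IsSimpleGraphAt T c S i x ↔
      ∃ u, (c)[i]? = some u ∧ T.Adj u x ∧ x ∉ c ∧ S = Branch T u x := by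
  constructor
  · rintro ⟨hS, hx, u, hu, hux⟩
    obtain ⟨a, ha, rfl⟩ := mem_components_iff.1 hS
    have huc : u ∈ c := List.mem_of_getElem? hu
    obtain ⟨q, hq⟩ := hx
    have hxc : x ∉ c := hq x q.end_mem_support
    refine ⟨u, hu, hux, hxc, ?_⟩
    ext v
    constructor
    · rintro ⟨p, hp⟩
      refine ⟨q.reverse.append p, fun h => ?_⟩
      rw [SimpleGraph.Walk.mem_support_append_iff, SimpleGraph.Walk.support_reverse,
        List.mem_reverse] at h
      exact h.elim (fun h => hq u h huc) (fun h => hp u h huc)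
    · rintro ⟨p, hp⟩
      refine ⟨q.append p, fun w hw => ?_⟩
      rw [SimpleGraph.Walk.mem_support_append_iff] at hw
      rcases hw with hw | hw
      · exact hq w hw
      · exact fun hwc => hc.not_mem_branch hT huc hxc hux hwc (Branch.of_mem_support hp hw)
  · rintro ⟨u, hu, hux, hxc, rfl⟩
    have huc : u ∈ c := List.mem_of_getElem? hu
    refine ⟨mem_components_iff.2 ⟨x, hxc, ?_⟩, head_mem_branch hux, u, hu, hux⟩
    ext v
    constructor
    · rintro ⟨p, hp⟩
      exact ⟨p, fun w hw hwc => hc.not_mem_branch hT huc hxc hux hwc (Branch.of_mem_support hp hw)⟩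
    · rintro ⟨p, hp⟩
      exact ⟨p, fun h => hp u h huc⟩

/-- The hands of a simple-graph are the deeper branches at its head. -/
theorem hands_branch (hT : T.IsTree) {u x : V} (h : T.Adj u x) :
    hands T (Branch T u x) x = {H | ∃ y, T.Adj x y ∧ y ≠ u ∧ H = Branch T x y} := by
  have key : ∀ y, T.Adj x y → y ≠ u →
      {v | ∃ p : T.Walk y v, ∀ w ∈ p.support, w ∈ Branch T u x \ {x}} = Branch T x y := by
    intro y hy hyu
    ext v
    constructor
    · rintro ⟨p, hp⟩
      exact ⟨p, fun hx => (hp x hx).2 rfl⟩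
    · rintro ⟨p, hp⟩
      refine ⟨p, fun w hw => ⟨branch_subset hT.2 h hy hyu (Branch.of_mem_support hp hw), ?_⟩⟩
      rintro rfl
      exact hp hw
  ext H
  constructor
  · intro hH
    obtain ⟨a, ha, rfl⟩ := mem_components_iff.1 hH
    obtain ⟨y, hy, hyu, hay⟩ := Branch.exists_sub hT h ha.1 ha.2
    refine ⟨y, hy, hyu, ?_⟩
    rw [← key y hy hyu] at hay ⊢
    obtain ⟨q, hq⟩ := hay
    ext v
    constructor
    · rintro ⟨p, hp⟩
      refine ⟨q.append p, fun w hw => ?_⟩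
      rw [SimpleGraph.Walk.mem_support_append_iff] at hw
      exact hw.elim (hq w) (hp w)
    · rintro ⟨p, hp⟩
      refine ⟨q.reverse.append p, fun w hw => ?_⟩
      rw [SimpleGraph.Walk.mem_support_append_iff, SimpleGraph.Walk.support_reverse,
        List.mem_reverse] at hw
      exact hw.elim (hq w) (hp w)
  · rintro ⟨y, hy, hyu, rfl⟩
    refine mem_components_iff.2 ⟨y, ⟨?_, hy.ne'⟩, (key y hy hyu).symm⟩
    exact Branch.extend (head_mem_branch h) hy hyu

theorem branch_injective (hT : T.IsAcyclic) {x y y' : V} (h : T.Adj x y) (h' : T.Adj x y')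
    (e : Branch T x y = Branch T x y') : y = y' :=
  Branch.head_unique hT h h' (head_mem_branch h) (e ▸ head_mem_branch h)

theorem Deg3.exists_neighbors {v : V} (h : Deg3 T v) :
    ∃ a b c, a ≠ b ∧ a ≠ c ∧ b ≠ c ∧ ∀ w, T.Adj v w ↔ w = a ∨ w = b ∨ w = c := by
  obtain ⟨a, b, c, h1, h2, h3, h4⟩ := Set.encard_eq_three.1 h
  refine ⟨a, b, c, h1, h2, h3, fun w => ?_⟩
  rw [← SimpleGraph.mem_neighborSet, h4]; simp

/-- A vertex separating two other vertices of degree three is a support node. -/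
theorem isSupportNode_of_separates (hT : T.Connected) {a b v : V} (ha : Deg3 T a) (hb : Deg3 T b)
    (hav : a ≠ v) (hbv : b ≠ v) (hs : ∀ p : T.Walk a b, v ∈ p.support) : IsSupportNode T v := by
  obtain ⟨p, hp⟩ := hT.exists_isPath a b
  exact Or.inr ⟨a, b, hav, hbv, ha, hb, p, hp, hs p⟩

/-- Seen from any vertex `v`, there is a vertex of degree three at or behind a support node. -/
theorem IsSupportNode.exists_deg3_behind (hT : T.IsAcyclic) {s : V} (hs : IsSupportNode T s)
    (v : V) :
    ∃ w, Deg3 T w ∧ (∀ p : T.Walk v w, s ∈ p.support) ∧ (w ≠ s ∨ IsSingle T s) := by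
  classical
  rcases hs with hs | ⟨a, b, ha, hb, hda, hdb, p, hp, hsp⟩
  · exact ⟨s, hs.1, fun p => p.end_mem_support, Or.inr hs⟩
  · by_cases h1 : ∀ q : T.Walk v a, s ∈ q.support
    · exact ⟨a, hda, h1, Or.inl ha⟩
    · refine ⟨b, hdb, fun r => ?_, Or.inl hb⟩
      push Not at h1
      obtain ⟨q, hq⟩ := h1
      -- walks from `v` to `a` and to `b` that both avoid `s` would give a path from `a` to `b`
      -- that avoids `s`
      have h2 := (hT.subsingleton_path a b).elim ⟨_, (q.reverse.append r).bypass_isPath⟩ ⟨p, hp⟩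
      have h3 : (q.reverse.append r).bypass = p := congrArg Subtype.val h2
      have h4 : s ∈ (q.reverse.append r).support :=
        (q.reverse.append r).support_bypass_subset_support (h3 ▸ hsp)
      rw [SimpleGraph.Walk.mem_support_append_iff, SimpleGraph.Walk.support_reverse,
        List.mem_reverse] at h4
      tauto

/-- In a connected graph, every vertex outside `c` lies in a branch leaving `c`. -/
theorem exists_branch_of_not_mem {c : List V} (hT : T.Connected) (hc : c ≠ []) {v : V}
    (hv : v ∉ c) : ∃ u ∈ c, ∃ x, x ∉ c ∧ T.Adj u x ∧ v ∈ Branch T u x := by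
  have key : ∀ {v e : V} (_ : T.Walk v e), e ∈ c → v ∉ c →
      ∃ u ∈ c, ∃ x, x ∉ c ∧ T.Adj u x ∧ v ∈ Branch T u x := by
    intro v e p he
    induction p with
    | nil => intro hv; exact absurd he hv
    | @cons v w e h q ih =>
      intro hv
      by_cases hw : w ∈ c
      · exact ⟨w, hw, v, hv, h.symm, head_mem_branch h.symm⟩
      · obtain ⟨u, hu, x, hx, hux, hb⟩ := ih he hw
        refine ⟨u, hu, x, hx, hux, Branch.extend hb h.symm ?_⟩
        rintro rfl
        exact hv hu
  obtain ⟨p, -⟩ := hT.exists_isPath v (c.head hc)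
  exact key p (List.head_mem hc) hv

/-- Branches leaving a line at different edges are disjoint. -/
theorem branch_eq_of_mem (hT : T.IsAcyclic) {c : List V} (hc : IsLine T c) {u x u' x' v : V}
    (hu : u ∈ c) (hx : x ∉ c) (h : T.Adj u x) (hu' : u' ∈ c) (hx' : x' ∉ c) (h' : T.Adj u' x')
    (hv : v ∈ Branch T u x) (hv' : v ∈ Branch T u' x') : u = u' ∧ x = x' := by
  have huu : u = u' := by
    by_contra hne
    obtain ⟨p, hp⟩ := hv'
    have h1 := (Branch.mem_support_of_exit hT h hv (hc.not_mem_branch hT hu hx h hu')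
      (p.reverse.concat h'.symm)).2
    rw [SimpleGraph.Walk.support_concat, SimpleGraph.Walk.support_reverse] at h1
    simp only [List.mem_append, List.mem_reverse, List.mem_singleton] at h1
    rcases h1 with h1 | h1
    · exact hc.not_mem_branch hT hu' hx' h' hu (Branch.of_mem_support hp h1)
    · exact hne h1
  subst huu
  exact ⟨rfl, Branch.head_unique hT h h' hv hv'⟩

/-! ### Trunk cores -/

theorem IsTrunkCore.reverse {c : List V} (hc : IsTrunkCore T c) : IsTrunkCore T c.reverse := by
  refine ⟨hc.1.reverse, fun v hv => List.mem_reverse.2 (hc.2.1 v hv), fun v hv => ?_, fun v hv => ?_⟩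
  · rw [List.head?_reverse] at hv; exact hc.2.2.2 v hv
  · rw [List.getLast?_reverse] at hv; exact hc.2.2.1 v hv

/-- Outside a trunk core with at least two nodes, only heads can have degree three: a vertex of
degree three deeper in a branch would make the head of the branch a support node. -/
theorem IsTrunkCore.eq_head_of_deg3 (hT : T.IsTree) {c : List V} (hc : IsTrunkCore T c)
    (h2 : 2 ≤ c.length) {u x v : V} (hu : u ∈ c) (hx : x ∉ c) (h : T.Adj u x)
    (hv : v ∈ Branch T u x) (hd : Deg3 T v) : v = x := by
  have hne : c ≠ [] := by rintro rfl; simp at h2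
  obtain ⟨e, hec, hes, heu⟩ : ∃ e ∈ c, IsSupportNode T e ∧ e ≠ u := by
    by_cases h1 : c.head hne = u
    · refine ⟨c.getLast hne, List.getLast_mem _,
        hc.2.2.2 _ (List.getLast?_eq_some_getLast hne), fun h3 => ?_⟩
      rw [← h1, List.getLast_eq_getElem, List.head_eq_getElem, hc.1.2.getElem_inj_iff] at h3
      omega
    · exact ⟨c.head hne, List.head_mem _, hc.2.2.1 _ (List.head?_eq_some_head hne), h1⟩
  obtain ⟨w, hw, hsep, -⟩ := hes.exists_deg3_behind hT.2 u
  by_contra hvx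
  have heB : e ∉ Branch T u x := hc.1.not_mem_branch hT.2 hu hx h hec
  have hwB : w ∉ Branch T u x := by
    rintro ⟨p, hp⟩
    have h1 := hsep (.cons h p)
    rw [SimpleGraph.Walk.support_cons, List.mem_cons] at h1
    exact h1.elim heu (fun h1 => heB (Branch.of_mem_support hp h1))
  refine hx (hc.2.1 x (isSupportNode_of_separates hT.1 hd hw hvx ?_ fun p =>
    (Branch.mem_support_of_exit hT.2 h hv hwB p).1))
  rintro rfl
  exact hwB (head_mem_branch h)

/-- The first node of a trunk core with at least two nodes has degree three, and if it is not single,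
then it has a neighbour of degree three outside the core. -/
theorem IsTrunkCore.deg3_head (hT : T.IsTree) {e w : V} {t : List V}
    (hc : IsTrunkCore T (e :: w :: t)) :
    Deg3 T e ∧ (IsSingle T e ∨ ∃ x, x ∉ e :: w :: t ∧ T.Adj e x ∧ Deg3 T x) := by
  by_cases hs : IsSingle T e
  · exact ⟨hs.1, Or.inl hs⟩
  obtain ⟨z, hz, hsep, hze⟩ := (hc.2.2.1 e rfl).exists_deg3_behind hT.2 w
  replace hze : z ≠ e := hze.resolve_right hs
  obtain ⟨x, hex, hzx⟩ := exists_mem_branch hT.1 hze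
  have hxw : x ≠ w := by
    rintro rfl
    obtain ⟨p, hp⟩ := hzx
    exact hp (hsep p)
  have hxc : x ∉ e :: w :: t := by
    intro hxc
    rcases List.mem_cons.1 hxc with rfl | hxc
    · exact hex.ne rfl
    · exact hxw (hc.1.eq_of_adj hT.2 hxc hex)
  have hE := fun v => hc.eq_head_of_deg3 (v := v) hT (by simp) List.mem_cons_self hxc hex
  obtain rfl := hE z hzx hz
  refine ⟨?_, Or.inr ⟨z, hxc, hex, hz⟩⟩
  have h1 : ¬ IsSingle T z := fun h => hxc (hc.2.1 z (Or.inl h))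
  obtain ⟨y, hzy, hy⟩ : ∃ y, T.Adj z y ∧ Deg3 T y := by
    by_contra h2
    push Not at h2
    exact h1 ⟨hz, h2⟩
  rcases Branch.adj hT.2 hex hzx hzy with h3 | h3
  · exact absurd (hE y h3 hy) hzy.ne'
  · exact h3.1 ▸ hy

end Cores

/-! ### Geometry of a tree drawn in a ladder -/

section Geometry

variable {V : Type*} {T : SimpleGraph V} {X R : V → ℤ}

/-- `X` (level) and `R` (row, `0` or `1`) are the coordinates of a correct embedding of `T` into
the ladder that is infinite in both directions. -/
structure GridCoords (T : SimpleGraph V) (X R : V → ℤ) : Prop where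
  inj : ∀ v w, X v = X w → R v = R w → v = w
  row : ∀ v, R v = 0 ∨ R v = 1
  adj : ∀ v w, T.Adj v w →
    (R v = R w ∧ (X w = X v + 1 ∨ X v = X w + 1)) ∨ (X v = X w ∧ R v + R w = 1)

theorem GridCoords.level_mem (hG : GridCoords T X R) {v w : V} (h : T.Adj v w) :
    X v - 1 ≤ X w ∧ X w ≤ X v + 1 := by
  have := hG.adj v w h
  omega

theorem GridCoords.row_eq (hG : GridCoords T X R) {v w : V} (h : T.Adj v w) (hX : X w ≠ X v) :
    R w = R v := by
  have := hG.adj v w h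
  omega

theorem GridCoords.row_ne (hG : GridCoords T X R) {v w : V} (h : T.Adj v w) (hX : X w = X v) :
    R w = 1 - R v := by
  have := hG.adj v w h
  omega

/-- The neighbours of a vertex are told apart by their levels. -/
theorem GridCoords.level_ne (hG : GridCoords T X R) {v a b : V} (ha : T.Adj v a) (hb : T.Adj v b)
    (hab : a ≠ b) : X a ≠ X b := by
  intro h
  refine hab (hG.inj _ _ h ?_)
  by_cases h1 : X a = X v
  · rw [hG.row_ne ha h1, hG.row_ne hb (h ▸ h1)]
  · rw [hG.row_eq ha h1, hG.row_eq hb (h ▸ h1)]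

/-- A vertex of degree three has a neighbour on its own level and one on each of the two levels
next to it. -/
theorem GridCoords.exists_adj_of_deg3 (hG : GridCoords T X R) {v : V} (h : Deg3 T v) {x : ℤ}
    (h1 : X v - 1 ≤ x) (h2 : x ≤ X v + 1) : ∃ z, T.Adj v z ∧ X z = x := by
  obtain ⟨a, b, c, hab, hac, hbc, hN⟩ := h.exists_neighbors
  have ha := (hN a).2 (by simp)
  have hb := (hN b).2 (by simp)
  have hc := (hN c).2 (by simp)
  have n1 := hG.level_ne ha hb hab
  have n2 := hG.level_ne ha hc hac
  have n3 := hG.level_ne hb hc hbc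
  have l1 := hG.level_mem ha
  have l2 := hG.level_mem hb
  have l3 := hG.level_mem hc
  have : X a = x ∨ X b = x ∨ X c = x := by omega
  rcases this with h | h | h
  exacts [⟨a, ha, h⟩, ⟨b, hb, h⟩, ⟨c, hc, h⟩]

/-- A vertex of degree three uses all three neighbouring nodes of the ladder, so it is adjacent to
every vertex embedded there. -/
theorem GridCoords.adj_of_deg3 (hG : GridCoords T X R) {v w : V} (h : Deg3 T v)
    (hw : (R w = R v ∧ (X w = X v + 1 ∨ X w = X v - 1)) ∨ (X w = X v ∧ R w = 1 - R v)) :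
    T.Adj v w := by
  obtain ⟨z, hz, hzw⟩ := hG.exists_adj_of_deg3 h (x := X w) (by omega) (by omega)
  rwa [hG.inj w z hzw.symm]
  by_cases h1 : X z = X v
  · rw [hG.row_ne hz h1]; omega
  · rw [hG.row_eq hz h1]; omega

/-- The degree of a vertex is at most three, as its neighbours lie on three levels. -/
theorem GridCoords.adj_of_mem (hG : GridCoords T X R) {v a b c w : V} (ha : T.Adj v a)
    (hb : T.Adj v b) (hc : T.Adj v c) (hab : a ≠ b) (hac : a ≠ c) (hbc : b ≠ c)
    (hw : T.Adj v w) : w = a ∨ w = b ∨ w = c := by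
  by_contra hn
  push Not at hn
  have n1 := hG.level_ne ha hb hab
  have n2 := hG.level_ne ha hc hac
  have n3 := hG.level_ne hb hc hbc
  have n4 := hG.level_ne hw ha hn.1
  have n5 := hG.level_ne hw hb hn.2.1
  have n6 := hG.level_ne hw hc hn.2.2
  have l1 := hG.level_mem ha
  have l2 := hG.level_mem hb
  have l3 := hG.level_mem hc
  have l4 := hG.level_mem hw
  omega

theorem GridCoords.deg3_of_adj (hG : GridCoords T X R) {v a b c : V} (ha : T.Adj v a)
    (hb : T.Adj v b) (hc : T.Adj v c) (hab : a ≠ b) (hac : a ≠ c) (hbc : b ≠ c) : Deg3 T v := by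
  refine Set.encard_eq_three.2 ⟨a, b, c, hab, hac, hbc, ?_⟩
  ext w
  simp only [SimpleGraph.mem_neighborSet, Set.mem_insert_iff, Set.mem_singleton_iff]
  constructor
  · exact hG.adj_of_mem ha hb hc hab hac hbc
  · rintro (rfl | rfl | rfl) <;> assumption

/-- If a line makes a U-turn, its two arms run side by side and block each other: as long as both
arms last, they occupy the same levels, and none of their nodes after the turn has degree three. -/
theorem GridCoords.not_deg3_of_uturn (hG : GridCoords T X R) (hT : T.IsAcyclic) {A B : List V}
    (hL : IsLine T (A.reverse ++ B)) (hA : 1 < A.length) (hB : 1 < B.length)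
    (h0 : X A[0] = X B[0]) (h1 : X A[1] = X B[1]) (j : ℕ) (hj : 1 ≤ j) (hjA : j < A.length)
    (hjB : j < B.length) : ¬ Deg3 T A[j] ∧ ¬ Deg3 T B[j] := by
  have lA : IsLine T A := by simpa using hL.left.reverse
  have lB : IsLine T B := hL.right
  have hd : ∀ i (hi : i < A.length) k (hk : k < B.length), A[i] ≠ B[k] := by
    intro i hi k hk h
    exact (List.nodup_append.1 hL.2).2.2 A[i] (by simp) B[k] (by simp) h
  -- the two arms are joined only at the turn
  have hna : ∀ i (hi : i < A.length) k (hk : k < B.length), 1 ≤ i → ¬ T.Adj A[i] B[k] := by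
    intro i hi k hk h1i h
    have e1 : (A.reverse ++ B)[A.length - 1 - i]'(by simp; omega) = A[i] := by
      rw [List.getElem_append_left (by simp; omega), List.getElem_reverse]
      congr 1; omega
    have e2 : (A.reverse ++ B)[A.length + k]'(by simp; omega) = B[k] := by
      rw [List.getElem_append_right (by simp)]
      simp
    rw [← e1, ← e2, hL.adj_iff hT] at h
    omega
  have hr : T.Adj A[0] B[0] := by
    have := (List.isChain_append.1 hL.1).2.2
    refine this _ ?_ _ ?_
    · simp [List.head?_eq_getElem?]
    · simp [List.head?_eq_getElem?]
  -- behind the turn both arms keep their rows and their common direction: neither can turn back,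
  -- nor change to the row taken by the other
  have key : ∀ j (hjA : j + 1 < A.length) (hjB : j + 1 < B.length),
      X A[j] = X B[j] ∧ R B[j] = 1 - R A[j] ∧ X A[j + 1] = X B[j + 1] ∧
        X A[j + 1] ≠ X A[j] ∧ R A[j + 1] = R A[j] ∧ R B[j + 1] = R B[j] := by
    intro j
    induction j with
    | zero =>
      intro hjA hjB
      have a2 := lA.adj_succ hjA
      have a3 := lB.adj_succ hjB
      have h2 : X A[0 + 1] ≠ X A[0] := by
        rw [h0]
        exact hG.level_ne a2 hr (hd _ _ _ _)
      exact ⟨h0, hG.row_ne hr h0.symm, h1, h2, hG.row_eq a2 h2, hG.row_eq a3 (by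
        rw [← h0]; exact h1 ▸ h2)⟩
    | succ j ih =>
      intro hjA hjB
      obtain ⟨i1, i2, i3, i4, i5, i6⟩ := ih (by omega) (by omega)
      have b1 := lA.adj_succ (i := j) (by omega)
      have b2 := lB.adj_succ (i := j) (by omega)
      have a2 := lA.adj_succ hjA
      have a3 := lB.adj_succ hjB
      have n1 : X A[j + 1 + 1] ≠ X A[j + 1] := fun h => by
        have := hG.row_ne a2 h
        exact hd (j + 1 + 1) hjA (j + 1) (by omega) (hG.inj _ _ (by omega) (by omega))
      have n2 : X B[j + 1 + 1] ≠ X B[j + 1] := fun h => by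
        have := hG.row_ne a3 h
        exact hd (j + 1) (by omega) (j + 1 + 1) hjB (hG.inj _ _ (by omega) (by omega))
      have n3 := hG.level_ne a2 b1.symm fun h => by
        have := lA.2.getElem_inj_iff.1 h; omega
      have n4 := hG.level_ne a3 b2.symm fun h => by
        have := lB.2.getElem_inj_iff.1 h; omega
      have l1 := hG.level_mem a2
      have l2 := hG.level_mem a3
      have l3 := hG.level_mem b1
      have l4 := hG.level_mem b2
      have := hG.row_eq a2 n1
      have := hG.row_eq a3 n2
      refine ⟨i3, ?_, ?_, n1, by assumption, by assumption⟩ <;> omega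
  obtain ⟨j, rfl⟩ : ∃ i, j = i + 1 := ⟨j - 1, by omega⟩
  obtain ⟨i1, i2, i3, i4, i5, i6⟩ := key j hjA hjB
  -- a vertex of degree three on one arm would be adjacent to the vertex opposite to it
  refine ⟨fun h => hna _ hjA _ hjB (by omega) (hG.adj_of_deg3 h (by omega)), fun h =>
    hna _ hjA _ hjB (by omega) (hG.adj_of_deg3 h (by omega)).symm⟩

/-- A line whose ends have degree three makes no U-turn. -/
theorem GridCoords.no_uturn (hG : GridCoords T X R) (hT : T.IsAcyclic) {A B : List V}
    (hL : IsLine T (A.reverse ++ B)) (hA : 1 < A.length) (hB : 1 < B.length)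
    (h0 : X A[0] = X B[0]) (h1 : X A[1] = X B[1])
    (dA : ∀ v, A.getLast? = some v → Deg3 T v) (dB : ∀ v, B.getLast? = some v → Deg3 T v) :
    False := by
  have key := hG.not_deg3_of_uturn hT hL hA hB h0 h1
  rcases le_total A.length B.length with h | h
  · exact (key (A.length - 1) (by omega) (by omega) (by omega)).1 (dA _ (by
      rw [List.getLast?_eq_getElem?, List.getElem?_eq_getElem]))
  · exact (key (B.length - 1) (by omega) (by omega) (by omega)).2 (dB _ (by
      rw [List.getLast?_eq_getElem?, List.getElem?_eq_getElem]))

/-- Two neighbours of degree three of a vertex lie on its two sides: one opposite to it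
and one beside it would both claim the fourth corner of a square. -/
theorem GridCoords.level_ne_of_deg3 (hG : GridCoords T X R) (hT : T.IsAcyclic) {v a b : V}
    (ha : T.Adj v a) (hb : T.Adj v b) (hab : a ≠ b) (da : Deg3 T a) (db : Deg3 T b) :
    X a ≠ X v := by
  intro h
  have n := hG.level_ne ha hb hab
  have l := hG.level_mem hb
  -- `z` is at the fourth corner of the square with `v`, `a` and `b`, so it is adjacent to `b`, too
  obtain ⟨z, hz, hzb⟩ := hG.exists_adj_of_deg3 da (x := X b) (by omega) (by omega)
  have r1 := hG.row_ne ha h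
  have r2 := hG.row_eq hb (by omega)
  have r3 := hG.row_eq hz (by omega)
  have := eq_of_adj_of_adj hT ha.symm hz hb.symm (hG.adj_of_deg3 (w := z) db (by omega)) hab
  subst this
  omega

/-- If two of three neighbours of a vertex have degree three, the third one is a leaf. -/
theorem GridCoords.leaf_of_deg3 (hG : GridCoords T X R) (hT : T.IsAcyclic) {v a b d z : V}
    (ha : T.Adj v a) (hb : T.Adj v b) (hd : T.Adj v d) (hab : a ≠ b) (had : a ≠ d) (hbd : b ≠ d)
    (da : Deg3 T a) (db : Deg3 T b) (hz : T.Adj d z) : z = v := by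
  by_contra hzv
  -- `a` and `b` are beside `v` and `d` is opposite to `v`; so `z` is opposite to `a` or to `b` and
  -- closes a square
  have h1 := hG.level_ne_of_deg3 hT ha hb hab da db
  have h2 := hG.level_ne_of_deg3 hT hb ha hab.symm db da
  have n1 := hG.level_ne ha hb hab
  have n2 := hG.level_ne ha hd had
  have n3 := hG.level_ne hb hd hbd
  have n4 := hG.level_ne hz hd.symm hzv
  have l1 := hG.level_mem ha
  have l2 := hG.level_mem hb
  have l3 := hG.level_mem hd
  have l4 := hG.level_mem hz
  have r1 := hG.row_eq ha h1
  have r2 := hG.row_eq hb h2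
  have r3 := hG.row_ne hd (by omega)
  have r4 := hG.row_eq hz (by omega)
  by_cases h3 : X a = X z
  · exact hzv (eq_of_adj_of_adj hT ha.symm (hG.adj_of_deg3 (w := z) da (by omega)) hd.symm hz
      had).symm
  · exact hzv (eq_of_adj_of_adj hT hb.symm (hG.adj_of_deg3 (w := z) db (by omega)) hd.symm hz
      hbd).symm

/-- The case that the head `v` is opposite to `u`: the branch through `v` goes on behind `v` next
to one of the two other branches, and the path joining their vertices of degree three makes a
U-turn. -/
theorem GridCoords.false_of_three_branches_of_level (hG : GridCoords T X R) (hT : T.IsAcyclic)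
    {u a b v d e f : V} (ha : T.Adj u a) (hb : T.Adj u b) (hv : T.Adj u v) (hab : a ≠ b)
    (hav : a ≠ v) (hbv : b ≠ v) (hd : d ∈ Branch T u a) (he : e ∈ Branch T u b)
    (hf : f ∈ Branch T u v) (hfv : f ≠ v) (dd : Deg3 T d) (de : Deg3 T e) (df : Deg3 T f)
    (hX : X v = X u) : False := by
  obtain ⟨l, hl, hlast, hlB⟩ := Branch.exists_isLine hv hf
  cases l with
  | nil => simp at hlast; exact hfv hlast.symm
  | cons q l =>
    have hvq : T.Adj v q := hl.adj_succ (i := 1) (by simp)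
    have huq : u ≠ q := fun h => (List.nodup_cons.1 hl.2).1 (by simp [h])
    -- the path from `z` over `u` and `v` to `f` makes a U-turn if `y` and `q` have the same level
    have key : ∀ y z, T.Adj u y → y ≠ v → z ∈ Branch T u y → Deg3 T z → X y = X q → False := by
      intro y z hy hyv hz hdz hXy
      obtain ⟨k, hk, hkl, hkB⟩ := Branch.exists_isLine hy hz
      refine hG.no_uturn hT (A := u :: y :: k) (B := v :: q :: l) ?_ (by simp) (by simp)
        (by simpa using hX.symm) (by simpa using hXy) ?_ ?_
      · refine isLine_append hk.reverse hl.of_cons ?_ ?_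
        · intro w hw hw'
          rw [List.mem_reverse, List.mem_cons] at hw
          rcases hw with rfl | hw
          · exact not_mem_branch (hlB _ hw')
          · exact hyv (Branch.head_unique hT hy hv (hkB w hw) (hlB w hw'))
        · simp [hv]
      · intro w hw
        rw [List.getLast?_cons_cons, hkl] at hw
        exact Option.some.inj hw ▸ hdz
      · intro w hw
        rw [hlast] at hw
        exact Option.some.inj hw ▸ df
    have := hG.level_mem ha
    have := hG.level_mem hb
    have := hG.level_mem hvq
    have := hG.level_ne ha hb hab
    have := hG.level_ne ha hv hav
    have := hG.level_ne hb hv hbv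
    have := hG.level_ne hv.symm hvq huq
    by_cases h : X a = X q
    · exact key a d ha hav hd dd h
    · exact key b e hb hbv he de (by omega)

/-- No vertex has three branches each of which has a vertex of degree three behind its head: the
branch on the other row would have to make a U-turn with one of the other two. -/
theorem GridCoords.false_of_three_branches (hG : GridCoords T X R) (hT : T.IsAcyclic)
    {u a b c d e f : V} (ha : T.Adj u a) (hb : T.Adj u b) (hc : T.Adj u c) (hab : a ≠ b)
    (hac : a ≠ c) (hbc : b ≠ c) (hd : d ∈ Branch T u a) (he : e ∈ Branch T u b)
    (hf : f ∈ Branch T u c) (hda : d ≠ a) (heb : e ≠ b) (hfc : f ≠ c)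
    (dd : Deg3 T d) (de : Deg3 T e) (df : Deg3 T f) : False := by
  have := hG.level_mem ha
  have := hG.level_mem hb
  have := hG.level_mem hc
  have := hG.level_ne ha hb hab
  have := hG.level_ne ha hc hac
  have := hG.level_ne hb hc hbc
  by_cases h1 : X a = X u
  · exact hG.false_of_three_branches_of_level hT hb hc ha hbc hab.symm hac.symm he hf hd hda de df
      dd h1
  by_cases h2 : X b = X u
  · exact hG.false_of_three_branches_of_level hT ha hc hb hac hab hbc.symm hd hf he heb dd df
      de h2
  · exact hG.false_of_three_branches_of_level hT ha hb hc hab hac hbc hd he hf hfc dd de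
      df (by omega)

/-- A corner of the trunk core: if the core goes from `u` to `p` within one level, then the core goes
on behind `p` next to the simple-graph with foot `u` and head `x`, which has at most one hand;
as long as both last, the core nodes behind `p` do not have degree three. -/
theorem GridCoords.corner (hG : GridCoords T X R) (hT : T.IsAcyclic) {u p q x : V}
    {P Q l : List V} (hPQ : IsLine T ((q :: Q).reverse ++ u :: p :: P))
    (hx : IsLine T ((x :: l).reverse ++ u :: p :: P)) (hxq : x ≠ q) (du : Deg3 T u)
    (dP : ∀ v, (p :: P).getLast? = some v → Deg3 T v)
    (dQ : ∀ v, (q :: Q).getLast? = some v → Deg3 T v)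
    (hend : P = [] → IsSingle T p ∨ ∃ y, y ≠ u ∧ T.Adj p y ∧ Deg3 T y)
    (hX : X p = X u) :
    P ≠ [] ∧ ¬ Deg3 T x ∧ ∀ j v, 1 ≤ j → j ≤ l.length + 1 → (p :: P)[j]? = some v →
      ¬ Deg3 T v := by
  have hup : T.Adj u p := hPQ.right.adj_succ (i := 0) (by simp)
  have huq : T.Adj u q := by
    have := hPQ.1
    rw [List.reverse_cons, List.append_assoc] at this
    have := this.right_of_append
    rw [List.singleton_append, List.isChain_cons_cons] at this
    exact this.1.symm
  have hux : T.Adj u x := by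
    have := hx.1
    rw [List.reverse_cons, List.append_assoc] at this
    have := this.right_of_append
    rw [List.singleton_append, List.isChain_cons_cons] at this
    exact this.1.symm
  have hpq : p ≠ q := by
    rintro rfl
    exact (List.nodup_append.1 hPQ.2).2.2 p (by simp) p (by simp) rfl
  have hpx : p ≠ x := by
    rintro rfl
    exact (List.nodup_append.1 hx.2).2.2 p (by simp) p (by simp) rfl
  have a2 := hG.level_mem huq
  have a3 := hG.level_mem hux
  have n1 := hG.level_ne hup huq hpq
  have n2 := hG.level_ne hup hux hpx
  have n3 := hG.level_ne hux huq hxq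
  have r2 := hG.row_ne hup hX
  have r3 := hG.row_eq huq (by omega)
  have r4 := hG.row_eq hux (by omega)
  -- if the core ended in `p`, then `p` would have a neighbour `y` of degree three outside the
  -- core; `y` is opposite to `x` or to `q` and would close a square
  have hP : P ≠ [] := by
    rintro rfl
    have dp : Deg3 T p := dP p rfl
    rcases hend rfl with h | ⟨y, hyu, hpy, dy⟩
    · exact h.2 u hup.symm du
    · have a4 := hG.level_mem hpy
      have n4 := hG.level_ne hpy hup.symm hyu
      have r5 := hG.row_eq hpy (by omega)
      by_cases h : X y = X x
      · exact hpx (eq_of_adj_of_adj hT hup hux hpy.symm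
          (hG.adj_of_deg3 (w := x) dy (by omega)) hyu.symm)
      · exact hpq (eq_of_adj_of_adj hT hup huq hpy.symm
          (hG.adj_of_deg3 (w := q) dy (by omega)) hyu.symm)
  refine ⟨hP, ?_⟩
  obtain ⟨p', P, rfl⟩ := List.exists_cons_of_ne_nil hP
  have hpp : T.Adj p p' := hPQ.right.adj_succ (i := 1) (by simp)
  have hup' : u ≠ p' := fun h => by
    have := (List.nodup_cons.1 hPQ.right.2).1
    simp [h] at this
  have a4 := hG.level_mem hpp
  have n4 := hG.level_ne hup.symm hpp hup'
  -- the core, being a path between vertices of degree three, makes no U-turn at the step from `u`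
  -- to `p`, so the continuation `p'` of the core is not opposite to `q` but to `x`
  have hXx : X x = X p' := by
    by_contra hne
    refine hG.no_uturn hT (A := u :: q :: Q) (B := p :: p' :: P) (by simpa using hPQ) (by simp)
      (by simp) (by simpa using hX.symm) (by simp; omega) ?_ dP
    intro v hv
    exact dQ v (by rwa [List.getLast?_cons_cons] at hv)
  have key := hG.not_deg3_of_uturn hT (A := u :: x :: l) (B := p :: p' :: P) (by simpa using hx)
    (by simp) (by simp) (by simpa using hX.symm) (by simpa using hXx)
  refine ⟨(key 1 le_rfl (by simp) (by simp)).1, fun j v h1 h2 hv => ?_⟩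
  rw [List.getElem?_eq_some_iff] at hv
  obtain ⟨hj, rfl⟩ := hv
  exact (key j h1 (by simp; omega) hj).2

/-- If the head `x` is opposite to its foot `u` and its hand `h :: l` runs in the direction in which
the trunk core goes on to `p`, then no core node next to the hand has degree three. -/
theorem GridCoords.not_deg3_of_straight (hG : GridCoords T X R) (hT : T.IsAcyclic) {u p x h : V}
    {P l : List V} (hx : IsLine T ((x :: h :: l).reverse ++ u :: p :: P))
    (h0 : X x = X u) (h1 : X h = X p) :
    ∀ j v, j ≤ l.length → (p :: P)[j]? = some v → ¬ Deg3 T v := by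
  intro j v hj hv
  rw [List.getElem?_eq_some_iff] at hv
  obtain ⟨hj', rfl⟩ := hv
  exact (hG.not_deg3_of_uturn hT (A := x :: h :: l) (B := u :: p :: P) hx (by simp) (by simp)
    (by simpa using h0) (by simpa using h1) (j + 1) (by omega) (by simp; omega)
    (by simpa using hj')).2

end Geometry

/-! ### The simple-graphs along a trunk core -/

section Core

variable {V : Type*} {T : SimpleGraph V} {X R : V → ℤ} {c : List V}

/-- `v` is the node of `c` at the position `z`; positions are integers, so that those reached in
either direction from a given one can be written uniformly. -/
def CoreAt (c : List V) (z : ℤ) (v : V) : Prop := ∃ m : ℕ, (m : ℤ) = z ∧ (c)[m]? = some v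

/-- The node of `c` at the position `z` exists and has degree three. -/
def CoreDeg3 (T : SimpleGraph V) (c : List V) (z : ℤ) : Prop := ∃ v, CoreAt c z v ∧ Deg3 T v

/-- The nodes of `c` at the positions `z` and `w` exist and have the same level. -/
def CoreVert (X : V → ℤ) (c : List V) (z w : ℤ) : Prop :=
  ∃ v v', CoreAt c z v ∧ CoreAt c w v' ∧ X v = X v'

theorem CoreAt.unique {z : ℤ} {v w : V} (h : CoreAt c z v) (h' : CoreAt c z w) : v = w := by
  obtain ⟨m, rfl, hv⟩ := h
  obtain ⟨m', hm, hw⟩ := h'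
  obtain rfl : m' = m := by omega
  rw [hv] at hw
  exact Option.some.inj hw

theorem CoreAt.mem {z : ℤ} {v : V} (h : CoreAt c z v) : v ∈ c := by
  obtain ⟨m, -, hv⟩ := h
  exact List.mem_of_getElem? hv

theorem CoreAt.bounds {z : ℤ} {v : V} (h : CoreAt c z v) : 0 ≤ z ∧ z < c.length := by
  obtain ⟨m, rfl, hv⟩ := h
  have := (List.getElem?_eq_some_iff.1 hv).1
  omega

theorem coreAt_nat {i : ℕ} {v : V} : CoreAt c i v ↔ (c)[i]? = some v := by
  constructor
  · rintro ⟨m, hm, hv⟩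
    obtain rfl : m = i := by omega
    exact hv
  · intro h; exact ⟨i, rfl, h⟩

theorem exists_coreAt {z : ℤ} (h0 : 0 ≤ z) (h1 : z < c.length) : ∃ v, CoreAt c z v := by
  obtain ⟨m, rfl⟩ := Int.eq_ofNat_of_zero_le h0
  exact ⟨(c)[m]'(by omega), coreAt_nat.2 (List.getElem?_eq_getElem _)⟩

/-- Reversing the core exchanges the two directions, so it suffices to treat one of them. -/
theorem coreAt_reverse {z : ℤ} {v : V} : CoreAt c.reverse z v ↔ CoreAt c (c.length - 1 - z) v := by
  have key : ∀ (d : List V) (z : ℤ), CoreAt d z v → CoreAt d.reverse (d.length - 1 - z) v := by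
    rintro d z ⟨m, rfl, hv⟩
    have hm := (List.getElem?_eq_some_iff.1 hv).1
    refine ⟨d.length - 1 - m, by omega, ?_⟩
    rw [List.getElem?_reverse (by omega), ← hv]
    congr 1; omega
  constructor
  · intro h; simpa using key _ _ h
  · intro h
    have := key _ _ h
    rwa [show (c.length : ℤ) - 1 - (c.length - 1 - z) = z by ring] at this

theorem coreDeg3_reverse {z : ℤ} : CoreDeg3 T c.reverse z ↔ CoreDeg3 T c (c.length - 1 - z) := by
  simp only [CoreDeg3, coreAt_reverse]

theorem coreVert_reverse {z w : ℤ} :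
    CoreVert X c.reverse z w ↔ CoreVert X c (c.length - 1 - z) (c.length - 1 - w) := by
  simp only [CoreVert, coreAt_reverse]

theorem CoreVert.symm {z w : ℤ} (h : CoreVert X c z w) : CoreVert X c w z := by
  obtain ⟨v, v', h1, h2, h3⟩ := h
  exact ⟨v', v, h2, h1, h3.symm⟩

theorem coreAt_adj_iff (hT : T.IsAcyclic) (hc : IsLine T c) {z w : ℤ} {u v : V}
    (hu : CoreAt c z u) (hv : CoreAt c w v) : T.Adj u v ↔ w = z + 1 ∨ z = w + 1 := by
  obtain ⟨m, rfl, hu⟩ := hu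
  obtain ⟨n, rfl, hv⟩ := hv
  obtain ⟨hm, rfl⟩ := List.getElem?_eq_some_iff.1 hu
  obtain ⟨hn, rfl⟩ := List.getElem?_eq_some_iff.1 hv
  rw [hc.adj_iff hT]
  omega

theorem coreAt_inj (hc : IsLine T c) {z w : ℤ} {u : V} (hu : CoreAt c z u) (hv : CoreAt c w u) :
    z = w := by
  obtain ⟨m, rfl, hu⟩ := hu
  obtain ⟨n, rfl, hv⟩ := hv
  obtain ⟨hm, h1⟩ := List.getElem?_eq_some_iff.1 hu
  obtain ⟨hn, h2⟩ := List.getElem?_eq_some_iff.1 hv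
  rw [← h2, hc.2.getElem_inj_iff] at h1
  omega

theorem IsTrunkCore.deg3_of_head? (hT : T.IsTree) (hc : IsTrunkCore T c) (h2 : 2 ≤ c.length)
    {e : V} (he : c.head? = some e) :
    Deg3 T e ∧ (IsSingle T e ∨ ∃ x, x ∉ c ∧ T.Adj e x ∧ Deg3 T x) := by
  match c, h2 with
  | a :: w :: t, _ =>
    obtain rfl : a = e := by simpa using he
    exact hc.deg3_head hT

theorem IsTrunkCore.deg3_of_getLast? (hT : T.IsTree) (hc : IsTrunkCore T c) (h2 : 2 ≤ c.length)
    {e : V} (he : c.getLast? = some e) :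
    Deg3 T e ∧ (IsSingle T e ∨ ∃ x, x ∉ c ∧ T.Adj e x ∧ Deg3 T x) := by
  have := hc.reverse.deg3_of_head? hT (by simpa using h2) (by simpa using he)
  simpa using this

theorem IsTrunkCore.coreDeg3_zero (hT : T.IsTree) (hc : IsTrunkCore T c) (h2 : 2 ≤ c.length) :
    CoreDeg3 T c 0 := by
  obtain ⟨v, hv⟩ := exists_coreAt (c := c) (z := 0) le_rfl (by omega)
  refine ⟨v, hv, (hc.deg3_of_head? hT h2 ?_).1⟩
  rw [List.head?_eq_getElem?]
  exact coreAt_nat.1 hv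

theorem IsTrunkCore.coreDeg3_last (hT : T.IsTree) (hc : IsTrunkCore T c) (h2 : 2 ≤ c.length) :
    CoreDeg3 T c (c.length - 1) := by
  have := hc.reverse.coreDeg3_zero hT (by simpa using h2)
  rw [coreDeg3_reverse] at this
  simpa using this

theorem isInner_iff {i : ℕ} : IsInner c i ↔ (0 : ℤ) < i ∧ (i : ℤ) + 1 < c.length := by
  unfold IsInner; omega

/-- An inner foot has degree three: its neighbours are the head and two core nodes. -/
theorem IsInner.deg3 (hG : GridCoords T X R) (hT : T.IsAcyclic) (hc : IsLine T c) {i : ℕ}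
    (hi : IsInner c i) {u x : V} (hu : (c)[i]? = some u) (hx : x ∉ c) (h : T.Adj u x) :
    Deg3 T u := by
  rw [isInner_iff] at hi
  obtain ⟨p, hp⟩ := exists_coreAt (c := c) (z := i + 1) (by omega) (by omega)
  obtain ⟨q, hq⟩ := exists_coreAt (c := c) (z := i - 1) (by omega) (by omega)
  rw [← coreAt_nat] at hu
  refine hG.deg3_of_adj ((coreAt_adj_iff hT hc hu hp).2 (by omega))
    ((coreAt_adj_iff hT hc hu hq).2 (by omega)) h ?_ ?_ ?_
  · rintro rfl
    have := coreAt_inj hc hp hq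
    omega
  · rintro rfl; exact hx hp.mem
  · rintro rfl; exact hx hq.mem

theorem IsInner.head_unique (hG : GridCoords T X R) (hT : T.IsAcyclic) (hc : IsLine T c) {i : ℕ}
    (hi : IsInner c i) {u x y : V} (hu : (c)[i]? = some u) (hx : x ∉ c) (h : T.Adj u x)
    (hy : y ∉ c) (h' : T.Adj u y) : x = y := by
  rw [isInner_iff] at hi
  obtain ⟨p, hp⟩ := exists_coreAt (c := c) (z := i + 1) (by omega) (by omega)
  obtain ⟨q, hq⟩ := exists_coreAt (c := c) (z := i - 1) (by omega) (by omega)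
  rw [← coreAt_nat] at hu
  by_contra hxy
  rcases hG.adj_of_mem ((coreAt_adj_iff hT hc hu hp).2 (by omega)) h h' (w := q)
    (by rintro rfl; exact hx hp.mem) (by rintro rfl; exact hy hp.mem) hxy
    ((coreAt_adj_iff hT hc hu hq).2 (by omega)) with rfl | rfl | rfl
  · have := coreAt_inj hc hp hq
    omega
  · exact hx hq.mem
  · exact hy hq.mem

/-- A core node has at most two neighbours in the core, so one of degree three is a foot. -/
theorem IsInner.exists_head (hT : T.IsAcyclic) (hc : IsLine T c) {i : ℕ} {u : V}
    (hu : (c)[i]? = some u) (du : Deg3 T u) : ∃ x, x ∉ c ∧ T.Adj u x := by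
  obtain ⟨a, b, d, hab, had, hbd, hN⟩ := du.exists_neighbors
  rw [← coreAt_nat] at hu
  by_contra hn
  push Not at hn
  have key : ∀ x, T.Adj u x → CoreAt c (i + 1) x ∨ CoreAt c (i - 1) x := by
    intro x hx
    have hxc : x ∈ c := by
      by_contra hxc
      exact hn x hxc hx
    obtain ⟨m, hm⟩ := List.getElem?_of_mem hxc
    rw [← coreAt_nat] at hm
    rcases (coreAt_adj_iff hT hc hu hm).1 hx with h | h
    · rw [h] at hm; exact Or.inl hm
    · rw [show (m : ℤ) = i - 1 by omega] at hm; exact Or.inr hm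
  rcases key a ((hN a).2 (by simp)) with h1 | h1 <;> rcases key b ((hN b).2 (by simp)) with h2 | h2 <;>
    rcases key d ((hN d).2 (by simp)) with h3 | h3 <;>
    first
    | exact hab (h1.unique h2)
    | exact had (h1.unique h3)
    | exact hbd (h2.unique h3)

/-- The reserved levels are those of the core nodes of degree three; the phantom nodes fit in, as
the ends of the core have degree three. -/
theorem mem_stepTwoLevels_iff (hG : GridCoords T X R) (hT : T.IsTree) (hc : IsTrunkCore T c)
    (h2 : 2 ≤ c.length) {m : ℤ} : m ∈ stepTwoLevels T c ↔ CoreDeg3 T c (m - 1) := by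
  constructor
  · rintro (rfl | rfl | ⟨S, i, x, hi, hS, rfl⟩)
    · exact hc.coreDeg3_zero hT h2
    · exact hc.coreDeg3_last hT h2
    · obtain ⟨u, hu, hux, hxc, -⟩ := (isSimpleGraphAt_iff hT.2 hc.1).1 hS
      exact ⟨u, by simpa [coreAt_nat] using hu, hi.deg3 hG hT.2 hc.1 hu hxc hux⟩
  · rintro ⟨u, hu, du⟩
    have hb := hu.bounds
    by_cases h0 : m = 1
    · exact Or.inl h0
    by_cases h1 : m = c.length
    · exact Or.inr (Or.inl h1)
    obtain ⟨i, hi, hu⟩ := hu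
    obtain ⟨x, hxc, hux⟩ := IsInner.exists_head hT.2 hc.1 hu du
    exact Or.inr (Or.inr ⟨Branch T u x, i, x, isInner_iff.2 (by omega),
      (isSimpleGraphAt_iff hT.2 hc.1).2 ⟨u, hu, hux, hxc, rfl⟩, by omega⟩)

theorem hits_iff (hG : GridCoords T X R) (hT : T.IsTree) (hc : IsTrunkCore T c)
    (h2 : 2 ≤ c.length) {h : Set V} {i : ℕ} {s : ℤ} : Hits T c h (i + 1) s ↔
      ∃ j : ℕ, 1 ≤ j ∧ j ≤ h.ncard ∧ CoreDeg3 T c (i + s * j) := by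
  unfold Hits
  simp only [mem_stepTwoLevels_iff hG hT hc h2]
  refine exists_congr fun j => ?_
  rw [show (i : ℤ) + 1 + s * j - 1 = i + s * j by ring]

theorem IsInner.exists_split {i : ℕ} (hi : IsInner c i) :
    ∃ (Q P : List V) (q u p : V), c = (q :: Q).reverse ++ u :: p :: P ∧ Q.length + 1 = i := by
  obtain ⟨h0, h1⟩ := hi
  have e : c = c.take i ++ c.drop i := (List.take_append_drop i c).symm
  have hq : (c.take i).reverse ≠ [] := by
    intro h
    have := congrArg List.length h
    rw [List.length_reverse, List.length_take, List.length_nil] at this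
    omega
  obtain ⟨q, Q, hQ⟩ := List.exists_cons_of_ne_nil hq
  refine ⟨Q, c.drop (i + 1 + 1), q, (c)[i], (c)[i + 1], ?_, ?_⟩
  · rw [← hQ, List.reverse_reverse, ← List.drop_eq_getElem_cons, ← List.drop_eq_getElem_cons, ← e]
  · have := congrArg List.length hQ
    simp at this; omega

/-- A line in a branch leaving a line, joined to the part of that line on one side. -/
theorem isLine_reverse_append_of_branch (hT : T.IsAcyclic) {A P l : List V} {u x : V}
    (hc : IsLine T (A ++ u :: P)) (hx : x ∉ A ++ u :: P) (h : T.Adj u x)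
    (hl : IsLine T (u :: x :: l)) : IsLine T ((x :: l).reverse ++ u :: P) := by
  refine isLine_append hl.of_cons.reverse hc.right ?_ (by simp [h.symm])
  intro v hv hv'
  exact hc.not_mem_branch hT (by simp) hx h (List.mem_append_right _ hv')
    (hl.mem_branch (List.mem_reverse.1 hv))

/-- The case `s = 1` of `IsTrunkCore.corner`. -/
theorem IsTrunkCore.corner_aux (hG : GridCoords T X R) (hT : T.IsTree) (hc : IsTrunkCore T c)
    {i : ℕ} (hi : IsInner c i) {u x : V} {l : List V} (hu : CoreAt c i u) (hx : x ∉ c)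
    (h : T.Adj u x) (hl : IsLine T (u :: x :: l)) (hv : CoreVert X c i (i + 1)) :
    (i : ℤ) + 1 + 1 < c.length ∧ ¬ Deg3 T x ∧
      ∀ j : ℤ, 2 ≤ j → j ≤ l.length + 2 → ¬ CoreDeg3 T c (i + j) := by
  have h2 : 2 ≤ c.length := by have := hi.1; have := hi.2; omega
  have du := hi.deg3 hG hT.2 hc.1 (coreAt_nat.1 hu) hx h
  obtain ⟨Q, P, q, u', p, rfl, rfl⟩ := hi.exists_split
  have hat : ∀ j : ℕ, ∀ v, CoreAt ((q :: Q).reverse ++ u' :: p :: P) ((Q.length + 1 : ℕ) + j) v ↔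
      (u' :: p :: P)[j]? = some v := by
    intro j v
    rw [← Nat.cast_add, coreAt_nat, List.getElem?_append_right (by simp)]
    simp
  obtain rfl : u' = u := by simpa using (hat 0 u).1 (by simpa using hu)
  obtain ⟨v, v', hv1, hv2, hX⟩ := hv
  obtain rfl := hv1.unique hu
  obtain rfl : p = v' := by simpa using (hat 1 v').1 (by simpa using hv2)
  have hP : ∀ w, (p :: P).getLast? = some w → Deg3 T w ∧ (IsSingle T w ∨ ∃ x,
      x ∉ ((q :: Q).reverse ++ v :: p :: P) ∧ T.Adj w x ∧ Deg3 T x) := by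
    intro w hw
    refine hc.deg3_of_getLast? hT h2 ?_
    simpa using hw
  obtain ⟨k1, k2, k3⟩ := hG.corner hT.2 hc.1
    (isLine_reverse_append_of_branch hT.2 hc.1 hx h hl) (by rintro rfl; exact hx (by simp)) du
    (fun w hw => (hP w hw).1) (fun w hw => (hc.deg3_of_head? hT h2 (by
      rw [List.head?_append, List.head?_reverse, hw]; rfl)).1)
    (fun hP' => by
      subst hP'
      refine (hP p rfl).2.imp_right ?_
      rintro ⟨y, hy, hpy, dy⟩
      exact ⟨y, by rintro rfl; exact hy (by simp), hpy, dy⟩) hX.symm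
  refine ⟨?_, k2, ?_⟩
  · have := List.length_pos_iff.2 k1
    simp; omega
  · rintro j hj1 hj2 ⟨w, hw, dw⟩
    obtain ⟨j, rfl⟩ : ∃ n : ℕ, j = (n + 1 : ℕ) := ⟨(j - 1).toNat, by omega⟩
    rw [hat] at hw
    exact k3 j w (by omega) (by omega) (by simpa using hw) dw

theorem isInner_reverse {i : ℕ} (hi : IsInner c i) : IsInner c.reverse (c.length - 1 - i) := by
  unfold IsInner at *
  simp; omega

/-- At an inner foot `u` whose head is `x`, let the core go within one level from `u` to the next
node in direction `s`. Then this node is inner, the head has degree less than three, and the core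
nodes from the second one on in direction `s` have degree less than three at least until the
hand next to them has ended. -/
theorem IsTrunkCore.corner (hG : GridCoords T X R) (hT : T.IsTree) (hc : IsTrunkCore T c)
    {i : ℕ} (hi : IsInner c i) {u x : V} {l : List V} {s : ℤ} (hs : s = 1 ∨ s = -1)
    (hu : CoreAt c i u) (hx : x ∉ c)
    (h : T.Adj u x) (hl : IsLine T (u :: x :: l)) (hv : CoreVert X c i (i + s)) :
    (0 < i + s ∧ i + s + 1 < c.length) ∧ ¬ Deg3 T x ∧
      ∀ j : ℤ, 2 ≤ j → j ≤ l.length + 2 → ¬ CoreDeg3 T c (i + s * j) := by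
  have hi' := isInner_iff.1 hi
  rcases hs with rfl | rfl
  · obtain ⟨h1, h2, h3⟩ := hc.corner_aux hG hT hi hu hx h hl hv
    exact ⟨⟨by omega, h1⟩, h2, by simpa using h3⟩
  · have e : ((c.length - 1 - i : ℕ) : ℤ) = c.length - 1 - i := by omega
    obtain ⟨h1, h2, h3⟩ := hc.reverse.corner_aux (X := X) hG hT (isInner_reverse hi)
      (by rw [e, coreAt_reverse]; simpa using hu) (by simpa using hx) h hl
      (by
        rw [e, coreVert_reverse]
        convert hv using 1 <;> ring)
    refine ⟨⟨?_, by omega⟩, h2, fun j hj1 hj2 hd => h3 j hj1 hj2 ?_⟩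
    · rw [List.length_reverse] at h1; omega
    · rw [e, coreDeg3_reverse]
      convert hd using 1; ring

/-- The case `s = 1` of `IsTrunkCore.straight`. -/
theorem IsTrunkCore.straight_aux (hG : GridCoords T X R) (hT : T.IsTree) (hc : IsTrunkCore T c)
    {i : ℕ} (hi : IsInner c i) {u x y p : V} {l : List V} (hu : CoreAt c i u) (hx : x ∉ c)
    (h : T.Adj u x) (hl : IsLine T (u :: x :: y :: l)) (hp : CoreAt c (i + 1) p)
    (hX : X x = X u) (hy : X y = X p) :
    ∀ j : ℤ, 1 ≤ j → j ≤ l.length + 1 → ¬ CoreDeg3 T c (i + j) := by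
  obtain ⟨Q, P, q, u', p', rfl, rfl⟩ := hi.exists_split
  have hat : ∀ j : ℕ, ∀ v, CoreAt ((q :: Q).reverse ++ u' :: p' :: P) ((Q.length + 1 : ℕ) + j) v ↔
      (u' :: p' :: P)[j]? = some v := by
    intro j v
    rw [← Nat.cast_add, coreAt_nat, List.getElem?_append_right (by simp)]
    simp
  obtain rfl : u' = u := by simpa using (hat 0 u).1 (by simpa using hu)
  obtain rfl : p' = p := by simpa using (hat 1 p).1 (by simpa using hp)
  rintro j hj1 hj2 ⟨w, hw, dw⟩
  obtain ⟨j, rfl⟩ : ∃ n : ℕ, j = (n + 1 : ℕ) := ⟨(j - 1).toNat, by omega⟩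
  rw [hat] at hw
  exact hG.not_deg3_of_straight hT.2 (isLine_reverse_append_of_branch hT.2 hc.1 hx h hl) hX hy j w
    (by omega) (by simpa using hw) dw

/-- At an inner foot `u` next to which the core stays in its row, a hand `y :: l` of the simple-graph
with head `x` runs along the core in the direction of one of the two core neighbours of `u`, and
no core node next to the hand has degree three. -/
theorem IsTrunkCore.straight (hG : GridCoords T X R) (hT : T.IsTree) (hc : IsTrunkCore T c)
    {i : ℕ} (hi : IsInner c i) {u x y : V} {l : List V} (hu : CoreAt c i u) (hx : x ∉ c)
    (h : T.Adj u x) (hl : IsLine T (u :: x :: y :: l)) (hv : ¬ CoreVert X c i (i + 1))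
    (hv' : ¬ CoreVert X c i (i - 1)) :
    ∃ s : ℤ, (s = 1 ∨ s = -1) ∧ (∃ p, CoreAt c (i + s) p ∧ X y = X p) ∧
      ∀ j : ℤ, 1 ≤ j → j ≤ l.length + 1 → ¬ CoreDeg3 T c (i + s * j) := by
  have hi' := isInner_iff.1 hi
  obtain ⟨p, hp⟩ := exists_coreAt (c := c) (z := i + 1) (by omega) (by omega)
  obtain ⟨q, hq⟩ := exists_coreAt (c := c) (z := i - 1) (by omega) (by omega)
  have hup : T.Adj u p := (coreAt_adj_iff hT.2 hc.1 hu hp).2 (by omega)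
  have huq : T.Adj u q := (coreAt_adj_iff hT.2 hc.1 hu hq).2 (by omega)
  have hxy : T.Adj x y := hl.adj_succ (i := 1) (by simp)
  have huy : u ≠ y := fun e => by
    have := (List.nodup_cons.1 hl.2).1
    simp [e] at this
  have hpq : p ≠ q := by
    rintro rfl
    have := coreAt_inj hc.1 hp hq
    omega
  have hpx : p ≠ x := by rintro rfl; exact hx hp.mem
  have hqx : q ≠ x := by rintro rfl; exact hx hq.mem
  have n1 := hG.level_ne hup huq hpq
  have n2 := hG.level_ne hup h hpx
  have n3 := hG.level_ne huq h hqx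
  have n4 : X u ≠ X p := fun e => hv ⟨u, p, hu, hp, e⟩
  have n5 : X u ≠ X q := fun e => hv' ⟨u, q, hu, hq, e⟩
  have n6 := hG.level_ne h.symm hxy huy
  have l1 := hG.level_mem hup
  have l2 := hG.level_mem huq
  have l3 := hG.level_mem h
  have l4 := hG.level_mem hxy
  -- the two core neighbours are beside `u`, so the head is opposite to `u`, and the hand turns to
  -- the level of one of the core neighbours
  have hX : X x = X u := by omega
  by_cases hyp : X y = X p
  · refine ⟨1, Or.inl rfl, ⟨p, hp, hyp⟩, ?_⟩
    simpa using hc.straight_aux hG hT hi hu hx h hl hp hX hyp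
  · refine ⟨-1, Or.inr rfl, ⟨q, hq, by omega⟩, fun j h1 h2 hd => ?_⟩
    have e : ((c.length - 1 - i : ℕ) : ℤ) = c.length - 1 - i := by omega
    refine hc.reverse.straight_aux (X := X) (p := q) hG hT (isInner_reverse hi)
      (by rw [e, coreAt_reverse]; simpa using hu) (by simpa using hx) h hl
      (by
        rw [e, coreAt_reverse]
        convert hq using 1; ring) hX (by omega) j h1 h2 ?_
    rw [e, coreDeg3_reverse]
    convert hd using 1; ring

end Core

/-! ### Maps into the ladder -/

section Respect

variable {V : Type*} {T : SimpleGraph V}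

theorem ladder_int_adj {a b : ℤ × Fin 2} : (ladder ℤ).Adj a b ↔
    (a.2 = b.2 ∧ (b.1 = a.1 + 1 ∨ a.1 = b.1 + 1)) ∨ (a.1 = b.1 ∧ a.2 ≠ b.2) := by
  simp only [ladder, SimpleGraph.boxProd_adj, SimpleGraph.hasse_adj, SimpleGraph.top_adj,
    Order.covBy_iff_add_one_eq]
  grind

theorem ladder_fin_adj {n : ℕ} {a b : Fin n × Fin 2} : (ladder (Fin n)).Adj a b ↔
    (a.2 = b.2 ∧ ((b.1 : ℤ) = a.1 + 1 ∨ (a.1 : ℤ) = b.1 + 1)) ∨ (a.1 = b.1 ∧ a.2 ≠ b.2) := by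
  simp only [ladder, SimpleGraph.boxProd_adj, SimpleGraph.hasse_adj, SimpleGraph.top_adj,
    Fin.covBy_iff, Order.covBy_iff_add_one_eq]
  grind

theorem gridCoords_of_embedding {n : ℕ} {φ : V → Fin n × Fin 2}
    (hφ : IsCorrectEmbedding T (ladder (Fin n)) φ) :
    GridCoords T (fun v => ((φ v).1 : ℤ)) (fun v => ((φ v).2 : ℤ)) where
  inj v w h1 h2 := hφ.1 (Prod.ext (by ext; simpa using h1) (by ext; simpa using h2))
  row v := by have := (φ v).2.isLt; omega
  adj v w h := by
    have := ladder_fin_adj.1 (hφ.2 v w h)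
    have := (φ v).2.isLt
    have := (φ w).2.isLt
    simp only [Fin.ext_iff] at *
    omega

/-- The edges of `T` whose ends are mapped to adjacent nodes of the ladder. -/
def respected (T : SimpleGraph V) (f : V → ℤ × Fin 2) : SimpleGraph V where
  Adj a b := T.Adj a b ∧ (ladder ℤ).Adj (f a) (f b)
  symm := ⟨fun _ _ h => ⟨h.1.symm, h.2.symm⟩⟩
  loopless := ⟨fun _ h => h.1.ne rfl⟩

/-- A tree is a minimal connected graph, so a map respects all its edges as soon as the respected
edges connect all vertices. -/
theorem adj_map_of_reachable (hT : T.IsTree) {f : V → ℤ × Fin 2} (r : V)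
    (h : ∀ v, (respected T f).Reachable r v) (u v : V) (huv : T.Adj u v) :
    (ladder ℤ).Adj (f u) (f v) := by
  have hm := (SimpleGraph.isTree_iff_minimal_connected.1 hT).2 (y := respected T f)
    (by
      have : Nonempty V := ⟨r⟩
      exact ⟨fun a b => (h a).symm.trans (h b)⟩) (fun _ _ h => h.1)
  exact (hm huv).2

theorem PlacedAlong.isLine {f : V → ℤ × Fin 2} {l : List V} {a s : ℤ} {r : Fin 2}
    (hp : PlacedAlong f l a s r) (hl : IsLine T l) (hs : s = 1 ∨ s = -1) :
    IsLine (respected T f) l := by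
  refine ⟨List.isChain_iff_getElem.2 fun i hi => ⟨hl.adj_succ hi, ?_⟩, hl.2⟩
  rw [ladder_int_adj, hp i _ (List.getElem?_eq_getElem (by omega)),
    hp (i + 1) _ (List.getElem?_eq_getElem hi)]
  rcases hs with rfl | rfl <;> push_cast <;> exact Or.inl ⟨rfl, by omega⟩

theorem PlacedAlong.reachable {f : V → ℤ × Fin 2} {l : List V} {a s : ℤ} {r : Fin 2}
    (hp : PlacedAlong f l a s r) (hl : IsLine T l) (hs : s = 1 ∨ s = -1) {u v : V} (hu : u ∈ l)
    (hv : v ∈ l) : (respected T f).Reachable u v :=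
  ((hp.isLine hl hs).exists_walk hu hv).elim fun p _ => ⟨p⟩

theorem PlacedAlong.injOn {f : V → ℤ × Fin 2} {l : List V} {a s : ℤ} {r : Fin 2}
    (hp : PlacedAlong f l a s r) (hs : s = 1 ∨ s = -1) {u v : V} (hu : u ∈ l)
    (hv : v ∈ l) (h : (f u).1 = (f v).1) : u = v := by
  obtain ⟨i, hi⟩ := List.getElem?_of_mem hu
  obtain ⟨j, hj⟩ := List.getElem?_of_mem hv
  rw [hp i u hi, hp j v hj] at h
  have : i = j := by rcases hs with rfl | rfl <;> dsimp only at h <;> omega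
  subst this
  rw [hi] at hj
  exact Option.some.inj hj

theorem PlacedAlong.cons {f : V → ℤ × Fin 2} {l : List V} {a s : ℤ} {r : Fin 2} {x : V}
    (hp : PlacedAlong f l (a + s) s r) (hx : f x = (a, r)) : PlacedAlong f (x :: l) a s r := by
  intro j v hv
  cases j with
  | zero =>
    obtain rfl : x = v := by simpa using hv
    simp [hx]
  | succ j =>
    rw [hp j v (by simpa using hv)]
    push_cast
    congr 1; ring

/-- An enumeration of a hand that is given as the branch at the head `x` through `y` starts in `y`, so
the length of the hand and the places of its nodes can be read off. -/
theorem HandAlong.exists_line (hT : T.IsAcyclic) {f : V → ℤ × Fin 2} {x y : V} {a s : ℤ}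
    {r : Fin 2} (h : HandAlong T f x (Branch T x y) a s r) (hxy : T.Adj x y) :
    ∃ l : List V, IsLine T (x :: y :: l) ∧ (∀ v, v ∈ y :: l ↔ v ∈ Branch T x y) ∧
      (Branch T x y).ncard = l.length + 1 ∧ PlacedAlong f (y :: l) (a + s) s r := by
  classical
  obtain ⟨l, hl, hm, hp⟩ := h
  cases l with
  | nil => exact absurd ((hm y).2 (head_mem_branch hxy)) (by simp)
  | cons z l =>
    have hxz : T.Adj x z := hl.adj_succ (i := 0) (by simp)
    obtain rfl := Branch.head_unique hT hxz hxy (head_mem_branch hxz) ((hm z).1 (by simp))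
    refine ⟨l, hl, hm, ?_, hp⟩
    have : Branch T x z = ((z :: l).toFinset : Set V) := by
      ext v; rw [← hm]; simp
    rw [this, Set.ncard_coe_finset, List.toFinset_card_of_nodup hl.of_cons.2, List.length_cons]

theorem HandAlong.head_pos (hT : T.IsAcyclic) {f : V → ℤ × Fin 2} {x y : V} {a s : ℤ}
    {r : Fin 2} (h : HandAlong T f x (Branch T x y) a s r) (hxy : T.Adj x y) :
    f y = (a + s, r) := by
  obtain ⟨l, -, -, -, hp⟩ := h.exists_line hT hxy
  simpa using hp 0 y (by simp)

theorem HandAlong.pos (hT : T.IsAcyclic) {f : V → ℤ × Fin 2} {x y v : V} {a s : ℤ}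
    {r : Fin 2} (h : HandAlong T f x (Branch T x y) a s r) (hxy : T.Adj x y)
    (hv : v ∈ Branch T x y) :
    ∃ j : ℕ, 1 ≤ j ∧ j ≤ (Branch T x y).ncard ∧ f v = (a + s * j, r) := by
  obtain ⟨l, -, hm, hn, hp⟩ := h.exists_line hT hxy
  obtain ⟨j, hj⟩ := List.getElem?_of_mem ((hm v).2 hv)
  refine ⟨j + 1, by omega, ?_, ?_⟩
  · have := (List.getElem?_eq_some_iff.1 hj).1
    simp at this; omega
  · rw [hp j v hj]
    push_cast
    congr 1; ring

theorem HandAlong.injOn {f : V → ℤ × Fin 2} {x : V} {h : Set V} {a s : ℤ}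
    {r : Fin 2} (hh : HandAlong T f x h a s r) (hs : s = 1 ∨ s = -1) {u v : V} (hu : u ∈ h)
    (hv : v ∈ h) (e : (f u).1 = (f v).1) : u = v := by
  obtain ⟨l, -, hm, hp⟩ := hh
  exact hp.injOn hs ((hm u).2 hu) ((hm v).2 hv) e

theorem HandAlong.reachable {f : V → ℤ × Fin 2} {x v : V} {h : Set V} {a s : ℤ}
    {r : Fin 2} (hh : HandAlong T f x h a s r) (hs : s = 1 ∨ s = -1) (hx : f x = (a, r))
    (hv : v ∈ h) : (respected T f).Reachable x v := by
  obtain ⟨l, hl, hm, hp⟩ := hh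
  exact (hp.cons hx).reachable hl hs (by simp) (List.mem_cons_of_mem _ ((hm v).2 hv))

end Respect

section Sound

variable {V : Type*} {T : SimpleGraph V} {X R : V → ℤ} {c : List V} {f : V → ℤ × Fin 2}

/-! ### Pairs of one-handed simple-graphs -/

theorem IsSimpleGraphAt.unique (hT : T.IsAcyclic) (hc : IsLine T c) {S : Set V} {i i' : ℕ}
    {x x' : V} (h : IsSimpleGraphAt T c S i x) (h' : IsSimpleGraphAt T c S i' x') :
    i = i' ∧ x = x' := by
  obtain ⟨u, hu, hux, hx, rfl⟩ := (isSimpleGraphAt_iff hT hc).1 h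
  obtain ⟨u', hu', hux', hx', e⟩ := (isSimpleGraphAt_iff hT hc).1 h'
  obtain ⟨rfl, rfl⟩ := branch_eq_of_mem hT hc (List.mem_of_getElem? hu) hx hux
    (List.mem_of_getElem? hu') hx' hux' (head_mem_branch hux) (e ▸ head_mem_branch hux)
  have := coreAt_inj hc (coreAt_nat.2 hu) (coreAt_nat.2 hu')
  exact ⟨by omega, rfl⟩

theorem ncard_eq_of_line {l : List V} {h : Set V} (hl : l.Nodup) (hm : ∀ v, v ∈ l ↔ v ∈ h) :
    h.ncard = l.length := by
  classical
  have : h = (l.toFinset : Set V) := by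
    ext v; rw [← hm]; simp
  rw [this, Set.ncard_coe_finset, List.toFinset_card_of_nodup hl]

/-- A hand of a simple-graph is a line. -/
theorem IsTrunkCore.exists_hand_line [Finite V] (hG : GridCoords T X R) (hT : T.IsTree)
    (hc : IsTrunkCore T c) (h2 : 2 ≤ c.length) {u x y : V} (hu : u ∈ c) (hx : x ∉ c)
    (hux : T.Adj u x) (hxy : T.Adj x y) (hyu : y ≠ u) :
    ∃ l : List V, IsLine T (u :: x :: y :: l) ∧ (∀ v, v ∈ y :: l ↔ v ∈ Branch T x y) ∧
      (Branch T x y).ncard = l.length + 1 := by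
  have hsub := branch_subset hT.2 hux hxy hyu
  obtain ⟨l, hl, hm⟩ := exists_line_of_branch hT hxy (by
    intro v hv a b d ha hb hd hab had hbd
    have := hc.eq_head_of_deg3 hT h2 hu hx hux (hsub hv) (hG.deg3_of_adj ha hb hd hab had hbd)
    subst this
    exact not_mem_branch hv)
  refine ⟨l, ⟨List.isChain_cons_cons.2 ⟨hux, hl.1⟩, List.nodup_cons.2 ⟨?_, hl.2⟩⟩, hm, ?_⟩
  · rw [List.mem_cons, hm]
    rintro (rfl | h)
    · exact hx hu
    · exact not_mem_branch (hsub h)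
  · rw [ncard_eq_of_line hl.of_cons.2 hm, List.length_cons]

/-- In the constrained case for a one-handed simple-graph the core runs within one level between the
two feet. -/
theorem IsPairCase.coreVert [Finite V] (hG : GridCoords T X R) (hT : T.IsTree)
    (hc : IsTrunkCore T c) (h2 : 2 ≤ c.length) {s : ℤ} (hs : s = 1 ∨ s = -1) {S S' h : Set V}
    {i i' : ℕ} {x x' : V} (hp : IsPairCase T c s S i x h S' i' x') : CoreVert X c i (i + s) := by
  obtain ⟨hi, hS, hh, hi', hii', hS', -, hhit⟩ := hp
  obtain ⟨u, hu, hux, hxc, rfl⟩ := (isSimpleGraphAt_iff hT.2 hc.1).1 hS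
  obtain ⟨u', hu', hux', hxc', rfl⟩ := (isSimpleGraphAt_iff hT.2 hc.1).1 hS'
  have hhm : h ∈ hands T (Branch T u x) x := by rw [hh]; rfl
  rw [hands_branch hT hux] at hhm
  obtain ⟨y, hxy, hyu, rfl⟩ := hhm
  have du' := hi'.deg3 hG hT.2 hc.1 hu' hxc' hux'
  have hd : CoreDeg3 T c (i + s) := ⟨u', hii' ▸ coreAt_nat.2 hu', du'⟩
  obtain ⟨l, hl, -, hn⟩ := hc.exists_hand_line hG hT h2 (List.mem_of_getElem? hu) hxc hux hxy hyu
  rw [hits_iff hG hT hc h2] at hhit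
  obtain ⟨j, hj1, hj2, hj3⟩ := hhit
  -- otherwise the core either goes within one level in the direction `-s`, or it stays in its row
  by_contra hv
  by_cases hv' : CoreVert X c i (i + -s)
  · obtain ⟨⟨h3, h4⟩, -, h5⟩ := hc.corner hG hT hi (s := -s) (by omega) (coreAt_nat.2 hu) hxc hux hl
      hv'
    -- only the next core node can block the hand; that node `w` is then a foot, too, and the
    -- corner, seen from `w`, excludes a core node of degree three at the position `i + s`
    have hj : j = 1 := by
      by_contra hj
      exact h5 j (by omega) (by simp; omega) hj3
    subst hj
    obtain ⟨w, hw, dw⟩ := hj3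
    rw [Nat.cast_one, mul_one] at hw
    obtain ⟨m, hm, hw'⟩ := hw
    obtain ⟨z, hz, hwz⟩ := IsInner.exists_head hT.2 hc.1 hw' dw
    have hmi : IsInner c m := isInner_iff.2 (by omega)
    have h6 := (hc.corner (l := []) hG hT hmi (s := s) hs (coreAt_nat.2 hw') hz hwz
      ⟨by simpa using hwz, by simpa using hwz.ne⟩
      (by rw [hm]; simpa using hv'.symm)).2.2 2 le_rfl (by simp)
    apply h6
    rw [hm]
    convert hd using 1; ring
  · obtain ⟨t, ht, -, h3⟩ := hc.straight hG hT hi (coreAt_nat.2 hu) hxc hux hl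
      (by rcases hs with rfl | rfl
          · exact hv
          · simpa using hv')
      (by rcases hs with rfl | rfl
          · exact hv'
          · exact hv)
    -- the hand is free in direction `t`, while both directions are blocked: `s` by the foot of
    -- `S'`, and `-s` by assumption
    rcases (by omega : t = s ∨ t = -s) with rfl | rfl
    · exact h3 1 le_rfl (by omega) (by simpa using hd)
    · exact h3 j (by omega) (by omega) hj3

/-! ### The maps produced for a large trunk core are quasi-correct -/

/-- The hand of the inner simple-graph with foot `u` (at position `i`) and head `x` that starts in `y`
runs in direction `s`; either this direction is free, or the core goes within one level from the foot
in direction `s`, and the hands at the next foot run in the opposite direction. -/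
structure Runs (T : SimpleGraph V) (X : V → ℤ) (c : List V) (f : V → ℤ × Fin 2) (i : ℕ) (u x y : V)
    (s : ℤ) : Prop where
  inner : IsInner c i
  foot : (c)[i]? = some u
  head : x ∉ c
  adj_head : T.Adj u x
  adj_hand : T.Adj x y
  ne_foot : y ≠ u
  dir : s = 1 ∨ s = -1
  along : HandAlong T f x (Branch T x y) (i + 1) s 1
  free : (∀ j : ℕ, 1 ≤ j → j ≤ (Branch T x y).ncard → ¬ CoreDeg3 T c (i + s * j)) ∨
    (CoreVert X c i (i + s) ∧ ∀ (i' : ℕ) (u' x' y' : V), (i' : ℤ) = i + s → (c)[i']? = some u' →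
      x' ∉ c → T.Adj u' x' → T.Adj x' y' → y' ≠ u' →
      HandAlong T f x' (Branch T x' y') (i' + 1) (-s) 1)

/-- Whatever rule of the third step applies to a hand of an inner simple-graph, the hand `Runs` in
some direction. -/
theorem LargeStrategy.exists_runs [Finite V] (hG : GridCoords T X R) (hT : T.IsTree)
    (hc : IsTrunkCore T c) (h2 : 2 ≤ c.length) (hf : LargeStrategy T c f) {i : ℕ} {u x y : V}
    (hi : IsInner c i) (hu : (c)[i]? = some u) (hx : x ∉ c) (hux : T.Adj u x) (hxy : T.Adj x y)
    (hyu : y ≠ u) : ∃ s, Runs T X c f i u x y s := by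
  obtain ⟨-, -, h3, h4, h5, -, -⟩ := hf
  have hS : IsSimpleGraphAt T c (Branch T u x) i x :=
    (isSimpleGraphAt_iff hT.2 hc.1).2 ⟨u, hu, hux, hx, rfl⟩
  by_cases hy' : ∃ y', T.Adj x y' ∧ y' ≠ u ∧ y' ≠ y
  -- the two-handed case
  · obtain ⟨y', hxy', hyu', hyy'⟩ := hy'
    obtain ⟨s, hs, n1, -, a1, -⟩ := h3 (Branch T u x) i x (Branch T x y) (Branch T x y') hi hS
      (fun e => hyy' (branch_injective hT.2 hxy hxy' e).symm) (by
        rw [hands_branch hT hux]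
        ext H
        simp only [Set.mem_ofPred_eq, Set.mem_insert_iff, Set.mem_singleton_iff]
        constructor
        · rintro ⟨z, hz, hzu, rfl⟩
          rcases hG.adj_of_mem hux.symm hxy hxy' hyu.symm hyu'.symm hyy'.symm hz with e | e | e
          · exact absurd e hzu
          · exact Or.inl (e ▸ rfl)
          · exact Or.inr (e ▸ rfl)
        · rintro (rfl | rfl)
          exacts [⟨y, hxy, hyu, rfl⟩, ⟨y', hxy', hyu', rfl⟩])
    refine ⟨s, hi, hu, hx, hux, hxy, hyu, hs, a1, Or.inl fun j hj1 hj2 hd => ?_⟩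
    exact n1 ((hits_iff hG hT hc h2).2 ⟨j, hj1, hj2, hd⟩)
  · push Not at hy'
    have hh : hands T (Branch T u x) x = {Branch T x y} := by
      rw [hands_branch hT hux]
      ext H
      simp only [Set.mem_ofPred_eq, Set.mem_singleton_iff]
      constructor
      · rintro ⟨z, hz, hzu, rfl⟩
        rw [hy' z hz hzu]
      · rintro rfl
        exact ⟨y, hxy, hyu, rfl⟩
    -- the one-handed case: the simple-graph is the first or the second of a pair, or in no pair
    by_cases hp : IsPaired T c (Branch T u x)
    · obtain ⟨s, S₁, i₁, x₁, h₁, S₂, i₂, x₂, hs, hp, hor⟩ := hp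
      have hv := hp.coreVert hG hT hc h2 hs
      obtain ⟨a1, a2⟩ := h4 s S₁ i₁ x₁ h₁ S₂ i₂ x₂ hs hp
      obtain ⟨hi₁, hS₁, hh₁, hi₂, hii, hS₂, -, -⟩ := hp
      obtain ⟨u₁, hu₁, hux₁, hx₁, hB₁⟩ := (isSimpleGraphAt_iff hT.2 hc.1).1 hS₁
      obtain ⟨u₂, hu₂, hux₂, hx₂, hB₂⟩ := (isSimpleGraphAt_iff hT.2 hc.1).1 hS₂
      have a1' : ∀ y', T.Adj x₁ y' → y' ≠ u₁ → HandAlong T f x₁ (Branch T x₁ y') (i₁ + 1) s 1 := by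
        intro y' hy1 hy2
        have : Branch T x₁ y' ∈ hands T S₁ x₁ := by
          rw [hB₁, hands_branch hT hux₁]; exact ⟨y', hy1, hy2, rfl⟩
        rw [hh₁] at this
        rwa [Set.mem_singleton_iff.1 this]
      have a2' : ∀ y', T.Adj x₂ y' → y' ≠ u₂ →
          HandAlong T f x₂ (Branch T x₂ y') (i₂ + 1) (-s) 1 := by
        intro y' hy1 hy2
        refine a2 _ ?_
        rw [hB₂, hands_branch hT hux₂]; exact ⟨y', hy1, hy2, rfl⟩
      rcases hor with rfl | rfl
      · obtain ⟨rfl, rfl⟩ := hS.unique hT.2 hc.1 hS₁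
        obtain rfl : u = u₁ := by rw [hu] at hu₁; exact Option.some.inj hu₁
        refine ⟨s, hi, hu, hx, hux, hxy, hyu, hs, a1' y hxy hyu, Or.inr ⟨hv, ?_⟩⟩
        intro i' u' x' y' e hu' hx' hux' hxy' hyu'
        obtain rfl : i' = i₂ := by omega
        obtain rfl : u' = u₂ := by rw [hu'] at hu₂; exact Option.some.inj hu₂
        obtain rfl := hi₂.head_unique hG hT.2 hc.1 hu' hx' hux' hx₂ hux₂
        exact a2' y' hxy' hyu'
      · obtain ⟨rfl, rfl⟩ := hS.unique hT.2 hc.1 hS₂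
        obtain rfl : u = u₂ := by rw [hu] at hu₂; exact Option.some.inj hu₂
        have ei : (i : ℤ) + -s = i₁ := by omega
        refine ⟨-s, hi, hu, hx, hux, hxy, hyu, by omega, a2' y hxy hyu, Or.inr ⟨?_, ?_⟩⟩
        · rw [ei, hii]; exact hv.symm
        intro i' u' x' y' e hu' hx' hux' hxy' hyu'
        obtain rfl : i' = i₁ := by omega
        obtain rfl : u' = u₁ := by rw [hu'] at hu₁; exact Option.some.inj hu₁
        obtain rfl := hi₁.head_unique hG hT.2 hc.1 hu' hx' hux' hx₁ hux₁
        rw [neg_neg]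
        exact a1' y' hxy' hyu'
    · obtain ⟨s, hs, n1, a1⟩ := h5 (Branch T u x) i x (Branch T x y) hi hS hh hp
      refine ⟨s, hi, hu, hx, hux, hxy, hyu, hs, a1, Or.inl fun j hj1 hj2 hd => ?_⟩
      exact n1 ((hits_iff hG hT hc h2).2 ⟨j, hj1, hj2, hd⟩)

/-- Different hands of one inner simple-graph run in different directions. -/
theorem LargeStrategy.hand_unique (hG : GridCoords T X R) (hT : T.IsTree)
    (hc : IsTrunkCore T c) (hf : LargeStrategy T c f) {i : ℕ} {u x y y' : V} {s : ℤ}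
    (h : Runs T X c f i u x y s) (h' : Runs T X c f i u x y' s) : y = y' := by
  by_contra hyy'
  obtain ⟨-, -, h3, -, -, -, -⟩ := hf
  have hS : IsSimpleGraphAt T c (Branch T u x) i x :=
    (isSimpleGraphAt_iff hT.2 hc.1).2 ⟨u, h.foot, h.adj_head, h.head, rfl⟩
  obtain ⟨t, ht, -, -, a1, a2⟩ := h3 (Branch T u x) i x (Branch T x y) (Branch T x y') h.inner hS
    (fun e => hyy' (branch_injective hT.2 h.adj_hand h'.adj_hand e)) (by
      rw [hands_branch hT h.adj_head]
      ext H
      simp only [Set.mem_ofPred_eq, Set.mem_insert_iff, Set.mem_singleton_iff]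
      constructor
      · rintro ⟨z, hz, hzu, rfl⟩
        rcases hG.adj_of_mem h.adj_head.symm h.adj_hand h'.adj_hand h.ne_foot.symm h'.ne_foot.symm
          hyy' hz with e | e | e
        · exact absurd e hzu
        · exact Or.inl (e ▸ rfl)
        · exact Or.inr (e ▸ rfl)
      · rintro (rfl | rfl)
        exacts [⟨y, h.adj_hand, h.ne_foot, rfl⟩, ⟨y', h'.adj_hand, h'.ne_foot, rfl⟩])
  have e1 := h.along.head_pos hT.2 h.adj_hand
  have e2 := h'.along.head_pos hT.2 h'.adj_hand
  rw [a1.head_pos hT.2 h.adj_hand] at e1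
  rw [a2.head_pos hT.2 h'.adj_hand] at e2
  have e1 := congrArg Prod.fst e1
  have e2 := congrArg Prod.fst e2
  dsimp only at e1 e2
  omega

/-- A reserved node that a hand runs into belongs to the next foot, to which the core
goes within one level. -/
theorem Runs.blocked [Finite V] (hG : GridCoords T X R) (hT : T.IsTree) (hc : IsTrunkCore T c)
    (h2 : 2 ≤ c.length) {i : ℕ} {u x y : V} {s : ℤ} (h : Runs T X c f i u x y s) {d : ℕ}
    (h1 : 1 ≤ d) (hd : d ≤ (Branch T x y).ncard) (hD : CoreDeg3 T c (i + s * d)) :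
    d = 1 ∧ CoreVert X c i (i + s) ∧ (0 < i + s ∧ i + s + 1 < c.length) ∧
    ∀ (i' : ℕ) (u' x' y' : V), (i' : ℤ) = i + s → (c)[i']? = some u' →
      x' ∉ c → T.Adj u' x' → T.Adj x' y' → y' ≠ u' →
      HandAlong T f x' (Branch T x' y') (i' + 1) (-s) 1 := by
  rcases h.free with hfree | ⟨hv, hopp⟩
  · exact absurd hD (hfree d h1 hd)
  · obtain ⟨l, hl, -, hn⟩ := hc.exists_hand_line hG hT h2 (List.mem_of_getElem? h.foot) h.head
      h.adj_head h.adj_hand h.ne_foot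
    obtain ⟨h3, -, h5⟩ := hc.corner hG hT h.inner h.dir (coreAt_nat.2 h.foot) h.head h.adj_head hl hv
    refine ⟨?_, hv, h3, hopp⟩
    by_contra hd1
    exact h5 d (by omega) (by simp; omega) hD

theorem Runs.coreDeg3 (hG : GridCoords T X R) (hT : T.IsTree) (hc : IsTrunkCore T c)
    {i : ℕ} {u x y : V} {s : ℤ} (h : Runs T X c f i u x y s) : CoreDeg3 T c i :=
  ⟨u, coreAt_nat.2 h.foot, h.inner.deg3 hG hT.2 hc.1 h.foot h.head h.adj_head⟩

/-- Hands running in the same direction from feet at a distance `d` do not meet: the head next to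
the second foot blocks the first hand unless the two feet form a pair, whose hands run in opposite
directions. -/
theorem Runs.eq_of_le [Finite V] (hG : GridCoords T X R) (hT : T.IsTree) (hc : IsTrunkCore T c)
    (h2 : 2 ≤ c.length) (hf : LargeStrategy T c f) {i i' : ℕ} {u x y u' x' y' v v' : V} {s : ℤ}
    (h : Runs T X c f i u x y s) (h' : Runs T X c f i' u' x' y' s) (hv : v ∈ Branch T x y)
    (hv' : v' ∈ Branch T x' y') (e : f v = f v') {d : ℕ} (hd : (i' : ℤ) = i + s * d) : v = v' := by
  obtain ⟨j, hj1, hj2, hj⟩ := h.along.pos hT.2 h.adj_hand hv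
  obtain ⟨j', hj1', hj2', hj'⟩ := h'.along.pos hT.2 h'.adj_hand hv'
  have e1 : (i : ℤ) + 1 + s * j = i' + 1 + s * j' := by
    have := congrArg Prod.fst e
    rwa [hj, hj'] at this
  -- so the first hand passes the level of the second head
  have hjd : j = d + j' := by
    rcases h.dir with rfl | rfl <;> omega
  rcases Nat.eq_zero_or_pos d with rfl | hpos
  · obtain rfl : i' = i := by simpa using hd
    obtain rfl : u = u' := by
      have := h.foot
      rw [h'.foot] at this
      exact (Option.some.inj this).symm
    obtain rfl := h.inner.head_unique hG hT.2 hc.1 h.foot h.head h.adj_head h'.head h'.adj_head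
    obtain rfl := hf.hand_unique hG hT hc h h'
    exact h.along.injOn h.dir hv hv' (congrArg Prod.fst e)
  · obtain ⟨rfl, -, -, hopp⟩ := h.blocked hG hT hc h2 hpos (by omega)
      (hd ▸ h'.coreDeg3 hG hT hc)
    have a := hopp i' u' x' y' (by simpa using hd) h'.foot h'.head h'.adj_head h'.adj_hand h'.ne_foot
    have e2 := a.head_pos hT.2 h'.adj_hand
    rw [h'.along.head_pos hT.2 h'.adj_hand] at e2
    have e2 := congrArg Prod.fst e2
    have := h.dir
    dsimp only at e2
    omega

/-- Hands running in the same direction do not meet. -/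
theorem Runs.eq [Finite V] (hG : GridCoords T X R) (hT : T.IsTree) (hc : IsTrunkCore T c)
    (h2 : 2 ≤ c.length) (hf : LargeStrategy T c f) {i i' : ℕ} {u x y u' x' y' v v' : V} {s : ℤ}
    (h : Runs T X c f i u x y s) (h' : Runs T X c f i' u' x' y' s) (hv : v ∈ Branch T x y)
    (hv' : v' ∈ Branch T x' y') (e : f v = f v') : v = v' := by
  have : (∃ d : ℕ, (i' : ℤ) = i + s * d) ∨ ∃ d : ℕ, (i : ℤ) = i' + s * d := by
    rcases le_total i i' with hle | hle <;> rcases h.dir with rfl | rfl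
    · exact Or.inl ⟨i' - i, by omega⟩
    · exact Or.inr ⟨i' - i, by omega⟩
    · exact Or.inr ⟨i - i', by omega⟩
    · exact Or.inl ⟨i - i', by omega⟩
  rcases this with ⟨d, hd⟩ | ⟨d, hd⟩
  · exact h.eq_of_le hG hT hc h2 hf h' hv hv' e hd
  · exact (h'.eq_of_le hG hT hc h2 hf h hv' hv e.symm hd).symm

/-- The hands of inner simple-graphs stay strictly between the ends of the trunk core. -/
theorem Runs.level_bounds [Finite V] (hG : GridCoords T X R) (hT : T.IsTree)
    (hc : IsTrunkCore T c) (h2 : 2 ≤ c.length) {i : ℕ} {u x y v : V} {s : ℤ}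
    (h : Runs T X c f i u x y s) (hv : v ∈ Branch T x y) :
    1 < (f v).1 ∧ (f v).1 < c.length := by
  obtain ⟨j, hj1, hj2, hj⟩ := h.along.pos hT.2 h.adj_hand hv
  have hi := isInner_iff.1 h.inner
  rw [hj]
  rcases h.dir with rfl | rfl
  · refine ⟨by dsimp only; omega, ?_⟩
    by_contra hc'
    dsimp only at hc'
    obtain ⟨h3, -, h4, -⟩ := h.blocked hG hT hc h2 (d := c.length - 1 - i) (by omega) (by omega) (by
      convert hc.coreDeg3_last hT h2 using 1; omega)
    omega
  · refine ⟨?_, by dsimp only; omega⟩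
    by_contra hc'
    dsimp only at hc'
    obtain ⟨h3, -, h4, -⟩ := h.blocked hG hT hc h2 (d := i) (by omega) (by omega) (by
      convert hc.coreDeg3_zero hT h2 using 1; omega)
    omega

/-- No node opposite to an inner foot is hit by hands from both sides. -/
theorem Runs.false_of_both [Finite V] (hG : GridCoords T X R) (hT : T.IsTree)
    (hc : IsTrunkCore T c) (h2 : 2 ≤ c.length) {i i' : ℕ} {u x y u' x' y' v v' : V}
    (h : Runs T X c f i u x y 1) (h' : Runs T X c f i' u' x' y' (-1)) (hv : v ∈ Branch T x y)
    (hv' : v' ∈ Branch T x' y') {z : ℤ} (e : (f v).1 = z + 1) (e' : (f v').1 = z + 1)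
    (hz : CoreDeg3 T c z) : False := by
  obtain ⟨j, hj1, hj2, hj⟩ := h.along.pos hT.2 h.adj_hand hv
  obtain ⟨j', hj1', hj2', hj'⟩ := h'.along.pos hT.2 h'.adj_hand hv'
  rw [hj] at e
  rw [hj'] at e'
  dsimp only at e e'
  obtain ⟨rfl, ⟨a, b, ha, hb, hab⟩, -, -⟩ := h.blocked hG hT hc h2 hj1 hj2 (by
    convert hz using 1; omega)
  obtain ⟨rfl, ⟨a', b', ha', hb', hab'⟩, -, -⟩ := h'.blocked hG hT hc h2 hj1' hj2' (by
    convert hz using 1; omega)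
  rw [show (i' : ℤ) + -1 = i + 1 by omega] at hb'
  obtain rfl := hb.unique hb'
  -- the foot `b` would have two neighbours on its own level
  refine hG.level_ne (v := b) ((coreAt_adj_iff hT.2 hc.1 hb ha).2 (by omega))
    ((coreAt_adj_iff hT.2 hc.1 hb ha').2 (by omega)) ?_ (hab.trans hab'.symm)
  rintro rfl
  have := coreAt_inj hc.1 ha ha'
  omega

end Sound

section Sound

variable {V : Type*} {T : SimpleGraph V} {X R : V → ℤ} {c : List V} {f : V → ℤ × Fin 2}

/-- The simple-graph with foot `u` and head `x` is put along one row: the head goes to level `a` of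
row `r`, and the hand starting in `y` runs in direction `s y`. -/
structure Placed (T : SimpleGraph V) (f : V → ℤ × Fin 2) (u x : V) (a : ℤ) (s : V → ℤ)
    (r : Fin 2) : Prop where
  head : f x = (a, r)
  dir : ∀ y, T.Adj x y → y ≠ u → s y = 1 ∨ s y = -1
  hand : ∀ y, T.Adj x y → y ≠ u → HandAlong T f x (Branch T x y) a (s y) r

theorem Placed.reachable (hT : T.IsTree) {u x v : V} {a : ℤ} {s : V → ℤ} {r : Fin 2}
    (h : Placed T f u x a s r) (hux : T.Adj u x) (hv : v ∈ Branch T u x) :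
    (respected T f).Reachable x v := by
  by_cases hvx : v = x
  · subst hvx; rfl
  · obtain ⟨y, hxy, hyu, hvy⟩ := Branch.exists_sub hT hux hv hvx
    exact (h.hand y hxy hyu).reachable (h.dir y hxy hyu) h.head hvy

/-- If all hands run in direction `s`, then the level tells the distance from the head. -/
theorem Placed.pos (hT : T.IsTree) {u x v : V} {a s : ℤ} {r : Fin 2}
    (h : Placed T f u x a (fun _ => s) r) (hux : T.Adj u x) (hv : v ∈ Branch T u x) :
    ∃ j : ℕ, f v = (a + s * j, r) ∧ (v = x ↔ j = 0) := by
  by_cases hvx : v = x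
  · subst hvx; exact ⟨0, by simpa using h.head, by simp⟩
  · obtain ⟨y, hxy, hyu, hvy⟩ := Branch.exists_sub hT hux hv hvx
    obtain ⟨j, h1, -, h2⟩ := (h.hand y hxy hyu).pos hT.2 hxy hvy
    exact ⟨j, h2, by simp only [hvx, false_iff]; omega⟩

/-- The fourth step in terms of branches: two exit-graphs at the end `u`, the first one with at
most one hand. -/
theorem StepFour.exists_placed (hT : T.IsTree) (hc : IsLine T c) {e : ℕ} {s : ℤ}
    (hs : s = 1 ∨ s = -1) (hf : StepFour T c f e s) : ∃ u x₁ x₂, (c)[e]? = some u ∧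
      x₁ ∉ c ∧ x₂ ∉ c ∧ T.Adj u x₁ ∧ T.Adj u x₂ ∧ (∀ x, x ∉ c → T.Adj u x → x = x₁ ∨ x = x₂) ∧
      Placed T f u x₁ (e + 1 + s) (fun _ => s) 0 ∧ Placed T f u x₂ (e + 1) (fun _ => s) 1 ∧
      ∀ y y', T.Adj x₁ y → y ≠ u → T.Adj x₁ y' → y' ≠ u → y = y' := by
  obtain ⟨S₁, S₂, x₁, x₂, -, h1, h2, h3, h4, -, p1, a1, p2, a2⟩ := hf
  obtain ⟨u, hu, hux₁, hx₁, rfl⟩ := (isSimpleGraphAt_iff hT.2 hc).1 h1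
  obtain ⟨u', hu', hux₂, hx₂, rfl⟩ := (isSimpleGraphAt_iff hT.2 hc).1 h2
  obtain rfl : u' = u := by rw [hu] at hu'; exact (Option.some.inj hu').symm
  refine ⟨u', x₁, x₂, hu, hx₁, hx₂, hux₁, hux₂, ?_, ⟨p1, fun _ _ _ => hs, ?_⟩,
    ⟨p2, fun _ _ _ => hs, ?_⟩, ?_⟩
  · intro x hx hux
    rcases h3 _ x ((isSimpleGraphAt_iff hT.2 hc).2 ⟨u', hu, hux, hx, rfl⟩) with h | h
    · exact Or.inl (branch_injective hT.2 hux hux₁ h)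
    · exact Or.inr (branch_injective hT.2 hux hux₂ h)
  · intro y hy hyu
    refine a1 _ ?_
    rw [hands_branch hT hux₁]; exact ⟨y, hy, hyu, rfl⟩
  · intro y hy hyu
    refine a2 _ ?_
    rw [hands_branch hT hux₂]; exact ⟨y, hy, hyu, rfl⟩
  · intro y y' hy hyu hy' hyu'
    refine branch_injective hT.2 hy hy' (h4 ?_ ?_) <;> rw [hands_branch hT hux₁]
    exacts [⟨y, hy, hyu, rfl⟩, ⟨y', hy', hyu', rfl⟩]

theorem encard_le_two_of_forall {α : Type*} {s : Set α}
    (h : ∀ a ∈ s, ∀ b ∈ s, ∀ d ∈ s, a = b ∨ a = d ∨ b = d) : s.encard ≤ 2 := by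
  by_contra hc
  push Not at hc
  obtain ⟨t, ht, h3⟩ := Set.exists_subset_encard_eq (k := 3) (Order.add_one_le_of_lt hc)
  obtain ⟨a, b, d, hab, had, hbd, rfl⟩ := Set.encard_eq_three.1 h3
  rcases h a (ht (by simp)) b (ht (by simp)) d (ht (by simp)) with h | h | h
  exacts [hab h, had h, hbd h]

/-- An exit-graph with at most one hand has at most one vertex on each level. -/
theorem Placed.eq_of_level (hT : T.IsTree) {u x v w : V} {a s : ℤ} {r : Fin 2} (hs : s = 1 ∨ s = -1)
    (h : Placed T f u x a (fun _ => s) r) (hux : T.Adj u x)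
    (hone : ∀ y y', T.Adj x y → y ≠ u → T.Adj x y' → y' ≠ u → y = y')
    (hv : v ∈ Branch T u x) (hw : w ∈ Branch T u x) (e : (f v).1 = (f w).1) : v = w := by
  obtain ⟨j, hj, hj0⟩ := h.pos hT hux hv
  obtain ⟨k, hk, hk0⟩ := h.pos hT hux hw
  have hjk : j = k := by
    rw [hj, hk] at e
    rcases hs with rfl | rfl <;> dsimp only at e <;> omega
  by_cases h0 : j = 0
  · rw [hj0.2 h0, hk0.2 (by omega)]
  · obtain ⟨y, hxy, hyu, hvy⟩ := Branch.exists_sub hT hux hv (fun hx => h0 (hj0.1 hx))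
    obtain ⟨z, hxz, hzu, hwz⟩ := Branch.exists_sub hT hux hw (fun hx => h0 (hjk ▸ hk0.1 hx))
    obtain rfl := hone y z hxy hyu hxz hzu
    exact (h.hand y hxy hyu).injOn hs hvy hwz e

/-- An exit-graph whose hands all run in one direction has at most two vertices on each level. -/
theorem Placed.eq_of_level_three (hG : GridCoords T X R) (hT : T.IsTree) {u x v w t : V} {a s : ℤ}
    {r : Fin 2} (hs : s = 1 ∨ s = -1)
    (h : Placed T f u x a (fun _ => s) r) (hux : T.Adj u x) (hv : v ∈ Branch T u x)
    (hw : w ∈ Branch T u x) (ht : t ∈ Branch T u x) (e : (f v).1 = (f w).1)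
    (e' : (f v).1 = (f t).1) : v = w ∨ v = t ∨ w = t := by
  obtain ⟨j, hj, hj0⟩ := h.pos hT hux hv
  obtain ⟨k, hk, hk0⟩ := h.pos hT hux hw
  obtain ⟨m, hm, hm0⟩ := h.pos hT hux ht
  have hjk : j = k := by
    rw [hj, hk] at e
    rcases hs with rfl | rfl <;> dsimp only at e <;> omega
  have hjm : j = m := by
    rw [hj, hm] at e'
    rcases hs with rfl | rfl <;> dsimp only at e' <;> omega
  by_cases h0 : j = 0
  · exact Or.inl (by rw [hj0.2 h0, hk0.2 (by omega)])
  · obtain ⟨y, hxy, hyu, hvy⟩ := Branch.exists_sub hT hux hv (fun hx => h0 (hj0.1 hx))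
    obtain ⟨z, hxz, hzu, hwz⟩ := Branch.exists_sub hT hux hw (fun hx => h0 (hjk ▸ hk0.1 hx))
    obtain ⟨q, hxq, hqu, htq⟩ := Branch.exists_sub hT hux ht (fun hx => h0 (hjm ▸ hm0.1 hx))
    by_cases h1 : y = z
    · subst h1
      exact Or.inl ((h.hand y hxy hyu).injOn hs hvy hwz e)
    by_cases h2 : y = q
    · subst h2
      exact Or.inr (Or.inl ((h.hand y hxy hyu).injOn hs hvy htq e'))
    rcases hG.adj_of_mem hux.symm hxy hxz hyu.symm hzu.symm h1 hxq with h3 | h3 | h3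
    · exact absurd h3 hqu
    · exact absurd h3.symm h2
    · subst h3
      exact Or.inr (Or.inr ((h.hand q hxq hqu).injOn hs hwz htq (e.symm.trans e')))

/-- How a vertex `v` of an inner simple-graph is put at a node in the second row: as a head, or as
part of a hand running up, or as part of a hand running down. -/
def InnerSpot (T : SimpleGraph V) (X : V → ℤ) (c : List V) (f : V → ℤ × Fin 2) (v : V) : Prop :=
  (∃ (i : ℕ) (u : V), IsInner c i ∧ (c)[i]? = some u ∧ v ∉ c ∧ T.Adj u v ∧ f v = ((i : ℤ) + 1, 1)) ∨
  (∃ (i : ℕ) (u x y : V), Runs T X c f i u x y 1 ∧ v ∈ Branch T x y) ∨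
  (∃ (i : ℕ) (u x y : V), Runs T X c f i u x y (-1) ∧ v ∈ Branch T x y)

theorem InnerSpot.bounds [Finite V] (hG : GridCoords T X R) (hT : T.IsTree)
    (hc : IsTrunkCore T c) (h2 : 2 ≤ c.length) {v : V} (h : InnerSpot T X c f v) :
    1 < (f v).1 ∧ (f v).1 < c.length ∧ (f v).2 = 1 := by
  rcases h with ⟨i, u, hi, -, -, -, hv⟩ | ⟨i, u, x, y, h, hv⟩ | ⟨i, u, x, y, h, hv⟩
  · rw [isInner_iff] at hi
    rw [hv]
    exact ⟨by dsimp only; omega, by dsimp only; omega, rfl⟩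
  all_goals
    obtain ⟨h3, h4⟩ := h.level_bounds hG hT hc h2 hv
    obtain ⟨j, -, -, hj⟩ := h.along.pos hT.2 h.adj_hand hv
    exact ⟨h3, h4, by rw [hj]⟩

/-- Inner simple-graphs put at most two vertices on each node: at most one of each of the three
kinds of `InnerSpot`, and not all three kinds at once. -/
theorem InnerSpot.eq_of_level_three [Finite V] (hG : GridCoords T X R) (hT : T.IsTree)
    (hc : IsTrunkCore T c) (h2 : 2 ≤ c.length) (hf : LargeStrategy T c f) {v w t : V}
    (hv : InnerSpot T X c f v) (hw : InnerSpot T X c f w) (ht : InnerSpot T X c f t)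
    (e : f v = f w) (e' : f v = f t) : v = w ∨ v = t ∨ w = t := by
  -- two heads on the same node have the same foot
  have hh : ∀ {v w : V} {i i' : ℕ} {u u' : V}, IsInner c i → (c)[i]? = some u → v ∉ c →
      T.Adj u v → f v = ((i : ℤ) + 1, 1) → (c)[i']? = some u' → w ∉ c → T.Adj u' w →
      f w = ((i' : ℤ) + 1, 1) → f v = f w → v = w := by
    intro v w i i' u u' hi hu hv huv hfv hu' hw huw hfw e
    have : i = i' := by
      rw [hfv, hfw] at e
      have := congrArg Prod.fst e
      dsimp only at this
      omega
    subst this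
    rw [hu] at hu'
    obtain rfl := Option.some.inj hu'
    exact hi.head_unique hG hT.2 hc.1 hu hv huv hw huw
  -- no head is hit by hands from both sides
  have hthree : ∀ {v w t : V} {i j k : ℕ} {u₁ u₂ u₃ x₂ y₂ x₃ y₃ : V}, IsInner c i →
      (c)[i]? = some u₁ → v ∉ c → T.Adj u₁ v → f v = ((i : ℤ) + 1, 1) →
      Runs T X c f j u₂ x₂ y₂ 1 → w ∈ Branch T x₂ y₂ → Runs T X c f k u₃ x₃ y₃ (-1) →
      t ∈ Branch T x₃ y₃ → f w = f v → f t = f v → False := by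
    intro v w t i j k u₁ u₂ u₃ x₂ y₂ x₃ y₃ hi hu hv huv hfv hr hw hl ht e e'
    refine hr.false_of_both hG hT hc h2 hl hw ht (z := i) (by rw [e, hfv]) (by rw [e', hfv]) ?_
    exact ⟨u₁, coreAt_nat.2 hu, hi.deg3 hG hT.2 hc.1 hu hv huv⟩
  rcases hv with ⟨i₁, u₁, a1, a2, a3, a4, a5⟩ | ⟨i₁, u₁, x₁, y₁, a1, a2⟩ | ⟨i₁, u₁, x₁, y₁, a1, a2⟩ <;>
  rcases hw with ⟨i₂, u₂, b1, b2, b3, b4, b5⟩ | ⟨i₂, u₂, x₂, y₂, b1, b2⟩ | ⟨i₂, u₂, x₂, y₂, b1, b2⟩ <;>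
  rcases ht with ⟨i₃, u₃, d1, d2, d3, d4, d5⟩ | ⟨i₃, u₃, x₃, y₃, d1, d2⟩ | ⟨i₃, u₃, x₃, y₃, d1, d2⟩ <;>
  first
  | exact Or.inl (hh a1 a2 a3 a4 a5 b2 b3 b4 b5 e)
  | exact Or.inr (Or.inl (hh a1 a2 a3 a4 a5 d2 d3 d4 d5 e'))
  | exact Or.inr (Or.inr (hh b1 b2 b3 b4 b5 d2 d3 d4 d5 (e.symm.trans e')))
  | exact Or.inl (a1.eq hG hT hc h2 hf b1 a2 b2 e)
  | exact Or.inr (Or.inl (a1.eq hG hT hc h2 hf d1 a2 d2 e'))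
  | exact Or.inr (Or.inr (b1.eq hG hT hc h2 hf d1 b2 d2 (e.symm.trans e')))
  | exact (hthree a1 a2 a3 a4 a5 b1 b2 d1 d2 e.symm e'.symm).elim
  | exact (hthree a1 a2 a3 a4 a5 d1 d2 b1 b2 e'.symm e.symm).elim
  | exact (hthree b1 b2 b3 b4 b5 a1 a2 d1 d2 e (e'.symm.trans e)).elim
  | exact (hthree b1 b2 b3 b4 b5 d1 d2 a1 a2 (e'.symm.trans e) e).elim
  | exact (hthree d1 d2 d3 d4 d5 a1 a2 b1 b2 e' (e.symm.trans e')).elim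
  | exact (hthree d1 d2 d3 d4 d5 b1 b2 a1 a2 (e.symm.trans e') e').elim

theorem LargeStrategy.isQuasiCorrect [Finite V] (hG : GridCoords T X R) (hT : T.IsTree)
    (hc : IsTrunkCore T c) (h2 : 2 ≤ c.length) (hf : LargeStrategy T c f) :
    IsQuasiCorrect T f := by
  have hf' := hf
  obtain ⟨s1, s2, -, -, -, s3, s4⟩ := hf'
  obtain ⟨u, x₁, x₂, hu, hx₁, hx₂, hux₁, hux₂, hx, p₁, p₂, q⟩ :=
    s3.exists_placed hT hc.1 (Or.inl rfl)
  obtain ⟨w, z₁, z₂, hw, hz₁, hz₂, hwz₁, hwz₂, hz, p₁', p₂', q'⟩ :=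
    s4.exists_placed hT hc.1 (Or.inr rfl)
  have hk : ((c.length - 1 : ℕ) : ℤ) = c.length - 1 := by omega
  rw [hk] at p₁ p₂
  have hcore : ∀ v ∈ c, ∃ i : ℕ, (c)[i]? = some v ∧ i < c.length ∧ f v = ((i : ℤ) + 1, 0) := by
    intro v hv
    obtain ⟨i, hi⟩ := List.getElem?_of_mem hv
    exact ⟨i, hi, (List.getElem?_eq_some_iff.1 hi).1, by rw [s1 i v hi]; congr 1; ring⟩
  -- every simple-graph is inner or one of the four exit-graphs
  have hfoot : ∀ {a x : V} {i : ℕ}, (c)[i]? = some a → x ∉ c → T.Adj a x →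
      (IsInner c i) ∨ (a = u ∧ (x = x₁ ∨ x = x₂)) ∨ (a = w ∧ (x = z₁ ∨ x = z₂)) := by
    intro a x i ha hxc hax
    by_cases hi : IsInner c i
    · exact Or.inl hi
    · have hlt := (List.getElem?_eq_some_iff.1 ha).1
      have : i = c.length - 1 ∨ i = 0 := by
        unfold IsInner at hi; omega
      rcases this with rfl | rfl
      · obtain rfl : a = u := by rw [hu] at ha; exact (Option.some.inj ha).symm
        exact Or.inr (Or.inl ⟨rfl, hx x hxc hax⟩)
      · obtain rfl : a = w := by rw [hw] at ha; exact (Option.some.inj ha).symm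
        exact Or.inr (Or.inr ⟨rfl, hz x hxc hax⟩)
  have hne : c ≠ [] := by rintro rfl; simp at h2
  refine ⟨?_, ?_⟩
  -- the respected edges join the core nodes, the heads to their feet, and the hands to their heads
  · refine adj_map_of_reachable hT (c.head hne) fun v => ?_
    have hrc : ∀ v ∈ c, (respected T f).Reachable (c.head hne) v := fun v hv =>
      PlacedAlong.reachable s1 hc.1 (Or.inl rfl) (List.head_mem hne) hv
    by_cases hv : v ∈ c
    · exact hrc v hv
    obtain ⟨a, ha, x, hxc, hax, hvx⟩ := exists_branch_of_not_mem hT.1 hne hv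
    obtain ⟨i, hi, hil, hfa⟩ := hcore a ha
    refine (hrc a ha).trans ?_
    have hstep : (ladder ℤ).Adj (f a) (f x) → (respected T f).Reachable a x := fun h =>
      SimpleGraph.Adj.reachable ⟨hax, h⟩
    rcases hfoot hi hxc hax with hin | ⟨rfl, rfl | rfl⟩ | ⟨rfl, rfl | rfl⟩
    · have hfx := s2 (Branch T a x) i x hin ((isSimpleGraphAt_iff hT.2 hc.1).2 ⟨a, hi, hax, hxc, rfl⟩)
      refine (hstep ?_).trans ?_
      · rw [ladder_int_adj, hfa, hfx]; simp
      · by_cases hvx' : v = x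
        · subst hvx'; rfl
        · obtain ⟨y, hxy, hya, hvy⟩ := Branch.exists_sub hT hax hvx hvx'
          obtain ⟨s, hr⟩ := hf.exists_runs hG hT hc h2 hin hi hxc hax hxy hya
          exact hr.along.reachable hr.dir hfx hvy
    · refine (hstep ?_).trans (p₁.reachable hT hux₁ hvx)
      rw [ladder_int_adj, p₁.head, s1 _ _ hu, hk]; simp
    · refine (hstep ?_).trans (p₂.reachable hT hux₂ hvx)
      rw [ladder_int_adj, p₂.head, s1 _ _ hu, hk]; simp
    · refine (hstep ?_).trans (p₁'.reachable hT hwz₁ hvx)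
      rw [ladder_int_adj, p₁'.head, s1 _ _ hw]; simp
    · refine (hstep ?_).trans (p₂'.reachable hT hwz₂ hvx)
      rw [ladder_int_adj, p₂'.head, s1 _ _ hw]; simp
  · intro m
    -- where the core, the inner simple-graphs, and the four exit-graphs are put
    have hclass : ∀ v, (v ∈ c ∧ (f v).2 = 0 ∧ 1 ≤ (f v).1 ∧ (f v).1 ≤ c.length) ∨
        InnerSpot T X c f v ∨
        (v ∈ Branch T u x₁ ∧ (f v).2 = 0 ∧ c.length < (f v).1) ∨
        (v ∈ Branch T u x₂ ∧ (f v).2 = 1 ∧ c.length ≤ (f v).1) ∨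
        (v ∈ Branch T w z₁ ∧ (f v).2 = 0 ∧ (f v).1 < 1) ∨
        (v ∈ Branch T w z₂ ∧ (f v).2 = 1 ∧ (f v).1 ≤ 1) := by
      intro v
      by_cases hv : v ∈ c
      · obtain ⟨i, hi, hil, hfa⟩ := hcore v hv
        exact Or.inl ⟨hv, by rw [hfa], by rw [hfa]; dsimp only; omega, by rw [hfa]; dsimp only; omega⟩
      obtain ⟨a, ha, x, hxc, hax, hvx⟩ := exists_branch_of_not_mem hT.1 hne hv
      obtain ⟨i, hi, hil, hfa⟩ := hcore a ha
      refine Or.inr ?_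
      rcases hfoot hi hxc hax with hin | ⟨rfl, rfl | rfl⟩ | ⟨rfl, rfl | rfl⟩
      · have hfx := s2 (Branch T a x) i x hin
          ((isSimpleGraphAt_iff hT.2 hc.1).2 ⟨a, hi, hax, hxc, rfl⟩)
        left
        by_cases hvx' : v = x
        · subst hvx'; exact Or.inl ⟨i, a, hin, hi, hxc, hax, hfx⟩
        · obtain ⟨y, hxy, hya, hvy⟩ := Branch.exists_sub hT hax hvx hvx'
          obtain ⟨s, hr⟩ := hf.exists_runs hG hT hc h2 hin hi hxc hax hxy hya
          have hs := hr.dir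
          rcases hs with rfl | rfl
          · exact Or.inr (Or.inl ⟨i, a, x, y, hr, hvy⟩)
          · exact Or.inr (Or.inr ⟨i, a, x, y, hr, hvy⟩)
      · obtain ⟨j, hj, -⟩ := p₁.pos hT hux₁ hvx
        exact Or.inr (Or.inl ⟨hvx, by rw [hj], by rw [hj]; dsimp only; omega⟩)
      · obtain ⟨j, hj, -⟩ := p₂.pos hT hux₂ hvx
        exact Or.inr (Or.inr (Or.inl ⟨hvx, by rw [hj], by rw [hj]; dsimp only; omega⟩))
      · obtain ⟨j, hj, -⟩ := p₁'.pos hT hwz₁ hvx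
        exact Or.inr (Or.inr (Or.inr (Or.inl ⟨hvx, by rw [hj], by rw [hj]; dsimp only; omega⟩)))
      · obtain ⟨j, hj, -⟩ := p₂'.pos hT hwz₂ hvx
        exact Or.inr (Or.inr (Or.inr (Or.inr ⟨hvx, by rw [hj], by rw [hj]; dsimp only; omega⟩)))
    have hsplit : {v | (f v).1 = m} = {v | (f v).1 = m ∧ (f v).2 = 0} ∪
        {v | (f v).1 = m ∧ (f v).2 = 1} := by
      ext v
      simp only [Set.mem_ofPred_eq, Set.mem_union]
      have := Fin.exists_fin_two.1 ⟨(f v).2, rfl⟩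
      grind
    have hrow0 : {v | (f v).1 = m ∧ (f v).2 = 0}.encard ≤ 1 := by
      rw [Set.encard_le_one_iff]
      rintro a b ⟨ha, ha0⟩ ⟨hb, hb0⟩
      have hab := ha.trans hb.symm
      rcases hclass a with ⟨a1, a2, a3, a4⟩ | a1 | ⟨a1, a2, a3⟩ | ⟨a1, a2, a3⟩ | ⟨a1, a2, a3⟩ |
        ⟨a1, a2, a3⟩
      · rcases hclass b with ⟨b1, b2, b3, b4⟩ | b1 | ⟨b1, b2, b3⟩ | ⟨b1, b2, b3⟩ | ⟨b1, b2, b3⟩ |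
          ⟨b1, b2, b3⟩
        · exact PlacedAlong.injOn s1 (Or.inl rfl) a1 b1 hab
        · have := (b1.bounds hG hT hc h2).2.2; simp [hb0] at this
        · omega
        · simp [hb0] at b2
        · omega
        · simp [hb0] at b2
      · have := (a1.bounds hG hT hc h2).2.2; simp [ha0] at this
      · rcases hclass b with ⟨b1, b2, b3, b4⟩ | b1 | ⟨b1, b2, b3⟩ | ⟨b1, b2, b3⟩ | ⟨b1, b2, b3⟩ |
          ⟨b1, b2, b3⟩
        · omega
        · have := (b1.bounds hG hT hc h2).2.2; simp [hb0] at this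
        · exact p₁.eq_of_level hT (Or.inl rfl) hux₁ q a1 b1 hab
        · simp [hb0] at b2
        · omega
        · simp [hb0] at b2
      · simp [ha0] at a2
      · rcases hclass b with ⟨b1, b2, b3, b4⟩ | b1 | ⟨b1, b2, b3⟩ | ⟨b1, b2, b3⟩ | ⟨b1, b2, b3⟩ |
          ⟨b1, b2, b3⟩
        · omega
        · have := (b1.bounds hG hT hc h2).2.2; simp [hb0] at this
        · omega
        · simp [hb0] at b2
        · exact p₁'.eq_of_level hT (Or.inr rfl) hwz₁ q' a1 b1 hab
        · simp [hb0] at b2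
      · simp [ha0] at a2
    have hrow1 : {v | (f v).1 = m ∧ (f v).2 = 1}.encard ≤ 2 := by
      have hcl1 : ∀ v, (f v).1 = m → (f v).2 = 1 →
          (InnerSpot T X c f v ∧ 1 < m ∧ m < c.length) ∨ (v ∈ Branch T u x₂ ∧ c.length ≤ m) ∨
          (v ∈ Branch T w z₂ ∧ m ≤ 1) := by
        intro v hv hv1
        rcases hclass v with ⟨a1, a2, a3, a4⟩ | a1 | ⟨a1, a2, a3⟩ | ⟨a1, a2, a3⟩ | ⟨a1, a2, a3⟩ |
          ⟨a1, a2, a3⟩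
        · simp [hv1] at a2
        · have := a1.bounds hG hT hc h2
          exact Or.inl ⟨a1, by omega, by omega⟩
        · simp [hv1] at a2
        · exact Or.inr (Or.inl ⟨a1, by omega⟩)
        · simp [hv1] at a2
        · exact Or.inr (Or.inr ⟨a1, by omega⟩)
      refine encard_le_two_of_forall ?_
      rintro a ⟨ha, ha1⟩ b ⟨hb, hb1⟩ d ⟨hd, hd1⟩
      have hab : f a = f b := Prod.ext (ha.trans hb.symm) (ha1.trans hb1.symm)
      have had : f a = f d := Prod.ext (ha.trans hd.symm) (ha1.trans hd1.symm)
      rcases hcl1 a ha ha1 with ⟨a1, a2, a3⟩ | ⟨a1, a2⟩ | ⟨a1, a2⟩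
      · rcases hcl1 b hb hb1 with ⟨b1, b2⟩ | ⟨b1, b2⟩ | ⟨b1, b2⟩
        · rcases hcl1 d hd hd1 with ⟨d1, d2⟩ | ⟨d1, d2⟩ | ⟨d1, d2⟩
          · exact a1.eq_of_level_three hG hT hc h2 hf b1 d1 hab had
          all_goals omega
        all_goals omega
      · rcases hcl1 b hb hb1 with ⟨b1, b2, b3⟩ | ⟨b1, b2⟩ | ⟨b1, b2⟩
        · omega
        · rcases hcl1 d hd hd1 with ⟨d1, d2, d3⟩ | ⟨d1, d2⟩ | ⟨d1, d2⟩
          · omega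
          · exact p₂.eq_of_level_three hG hT (Or.inl rfl) hux₂ a1 b1 d1 (congrArg _ hab)
              (congrArg _ had)
          · omega
        · omega
      · rcases hcl1 b hb hb1 with ⟨b1, b2, b3⟩ | ⟨b1, b2⟩ | ⟨b1, b2⟩
        · omega
        · omega
        · rcases hcl1 d hd hd1 with ⟨d1, d2, d3⟩ | ⟨d1, d2⟩ | ⟨d1, d2⟩
          · omega
          · omega
          · exact p₂'.eq_of_level_three hG hT (Or.inr rfl) hwz₂ a1 b1 d1 (congrArg _ hab)
              (congrArg _ had)
    rw [hsplit]
    refine (Set.encard_union_le _ _).trans ((add_le_add hrow0 hrow1).trans ?_)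
    norm_num

end Sound

section Existence

variable {V : Type*} {T : SimpleGraph V} {X R : V → ℤ} {c : List V}

/-! ### The strategy succeeds for a large trunk core -/

/-- The places of the heads, and the directions of the hands, can be prescribed arbitrarily: this
determines the map off the core, because each vertex is a head or lies in exactly one hand. `a x`,
`r x` are the level and the row of the head `x`, and `s x y` is the direction of the hand at `x`
that starts in `y`. -/
theorem IsTrunkCore.exists_placement [Finite V] (hG : GridCoords T X R) (hT : T.IsTree)
    (hc : IsTrunkCore T c) (h2 : 2 ≤ c.length) (a : V → ℤ) (r : V → Fin 2) (s : V → V → ℤ) :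
    ∃ f : V → ℤ × Fin 2, StepOne c f ∧ ∀ u ∈ c, ∀ x, x ∉ c → T.Adj u x → f x = (a x, r x) ∧
      ∀ y, T.Adj x y → y ≠ u → HandAlong T f x (Branch T x y) (a x) (s x y) (r x) := by
  classical
  have hL : ∀ x y, ∃ l : List V, ∀ u ∈ c, x ∉ c → T.Adj u x → T.Adj x y → y ≠ u →
      IsLine T (x :: l) ∧ ∀ v, v ∈ l ↔ v ∈ Branch T x y := by
    intro x y
    by_cases h : ∃ u ∈ c, x ∉ c ∧ T.Adj u x ∧ T.Adj x y ∧ y ≠ u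
    · obtain ⟨u, hu, hx, hux, hxy, hyu⟩ := h
      obtain ⟨l, hl, hm, -⟩ := hc.exists_hand_line hG hT h2 hu hx hux hxy hyu
      exact ⟨y :: l, fun _ _ _ _ _ _ => ⟨hl.of_cons, hm⟩⟩
    · exact ⟨[], fun u hu hx hux hxy hyu => absurd ⟨u, hu, hx, hux, hxy, hyu⟩ h⟩
  choose L hL using hL
  -- `hand v (x, y)`: the vertex `v` lies in the hand at the head `x` that starts in `y`
  let hand : V → V × V → Prop := fun v p => ∃ u ∈ c, p.1 ∉ c ∧ T.Adj u p.1 ∧ T.Adj p.1 p.2 ∧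
    p.2 ≠ u ∧ v ∈ Branch T p.1 p.2
  have hsub : ∀ {v u x y}, u ∈ c → x ∉ c → T.Adj u x → T.Adj x y → y ≠ u → v ∈ Branch T x y →
      v ∈ Branch T u x := fun hu hx hux hxy hyu hv => branch_subset hT.2 hux hxy hyu hv
  have huniq : ∀ v p q, hand v p → hand v q → p = q := by
    rintro v ⟨x, y⟩ ⟨x', y'⟩ ⟨u, hu, hx, hux, hxy, hyu, hv⟩ ⟨u', hu', hx', hux', hxy', hyu', hv'⟩
    obtain ⟨-, h⟩ := branch_eq_of_mem hT.2 hc.1 hu hx hux hu' hx' hux'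
      (hsub hu hx hux hxy hyu hv) (hsub hu' hx' hux' hxy' hyu' hv')
    dsimp only at h hxy hxy' hv hv'
    subst h
    rw [Branch.head_unique hT.2 hxy hxy' hv hv']
  let f : V → ℤ × Fin 2 := fun v =>
    if v ∈ c then ((c.idxOf v : ℤ) + 1, 0)
    else if ∃ u ∈ c, T.Adj u v then (a v, r v)
    else if h : ∃ p, hand v p then
      (a h.choose.1 + s h.choose.1 h.choose.2 * (((L h.choose.1 h.choose.2).idxOf v : ℤ) + 1),
        r h.choose.1)
    else (0, 0)
  refine ⟨f, ?_, ?_⟩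
  · intro j v hv
    have hvc := List.mem_of_getElem? hv
    obtain ⟨hj, rfl⟩ := List.getElem?_eq_some_iff.1 hv
    simp only [f, hvc, if_true, hc.1.2.idxOf_getElem]
    congr 1; ring
  · intro u hu x hx hux
    refine ⟨by simp only [f, hx, if_false]; rw [if_pos ⟨u, hu, hux⟩], fun y hxy hyu => ?_⟩
    obtain ⟨h1, h3⟩ := hL x y u hu hx hux hxy hyu
    refine ⟨L x y, h1, h3, fun j v hv => ?_⟩
    have hvL := List.mem_of_getElem? hv
    have hvB := (h3 v).1 hvL
    have hvU := hsub hu hx hux hxy hyu hvB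
    have hvc : v ∉ c := fun h => hc.1.not_mem_branch hT.2 hu hx hux h hvU
    have hvh : ¬ ∃ u' ∈ c, T.Adj u' v := by
      rintro ⟨u', hu', huv'⟩
      obtain ⟨-, h⟩ := branch_eq_of_mem hT.2 hc.1 hu hx hux hu' hvc huv' hvU (head_mem_branch huv')
      rw [h] at hvB
      exact not_mem_branch hvB
    have hp : hand v (x, y) := ⟨u, hu, hx, hux, hxy, hyu, hvB⟩
    have hex : ∃ p, hand v p := ⟨_, hp⟩
    have hch : hex.choose = (x, y) := huniq v _ _ hex.choose_spec hp
    obtain ⟨hj, rfl⟩ := List.getElem?_eq_some_iff.1 hv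
    simp only [f, hvc, if_false]
    rw [if_neg hvh, dif_pos hex, hch]
    dsimp only
    rw [h1.of_cons.2.idxOf_getElem]
    congr 1; ring

theorem hands_subsingleton (hG : GridCoords T X R) (hT : T.IsTree) {u x : V} (hux : T.Adj u x)
    (hx : ¬ Deg3 T x) : (hands T (Branch T u x) x).Subsingleton := by
  rw [hands_branch hT hux]
  rintro _ ⟨y, hy, hyu, rfl⟩ _ ⟨y', hy', hyu', rfl⟩
  by_contra h
  exact hx (hG.deg3_of_adj hux.symm hy hy' hyu.symm hyu'.symm (fun e => h (e ▸ rfl)))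

theorem encard_hands_le_two (hG : GridCoords T X R) (hT : T.IsTree) {u x : V} (hux : T.Adj u x) :
    (hands T (Branch T u x) x).encard ≤ 2 := by
  rw [hands_branch hT hux]
  refine encard_le_two_of_forall ?_
  rintro _ ⟨y₁, h₁, hu₁, rfl⟩ _ ⟨y₂, h₂, hu₂, rfl⟩ _ ⟨y₃, h₃, hu₃, rfl⟩
  by_contra h
  push Not at h
  rcases hG.adj_of_mem hux.symm h₁ h₂ hu₁.symm hu₂.symm (fun e => h.1 (e ▸ rfl)) h₃ with e | e | e
  · exact hu₃ e
  · exact h.2.1 (e ▸ rfl)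
  · exact h.2.2 (e ▸ rfl)

/-- At the first node of the core there are exactly two exit-graphs, one of which has at most one
hand. The other end is obtained by reversing the core. -/
theorem IsTrunkCore.exists_exits (hG : GridCoords T X R) (hT : T.IsTree) (hc : IsTrunkCore T c)
    (h2 : 2 ≤ c.length) {u : V} (hu : c.head? = some u) :
    ∃ x₁ x₂, x₁ ≠ x₂ ∧ x₁ ∉ c ∧ x₂ ∉ c ∧ T.Adj u x₁ ∧ T.Adj u x₂ ∧
      (∀ x, x ∉ c → T.Adj u x → x = x₁ ∨ x = x₂) ∧ ¬ Deg3 T x₁ := by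
  obtain ⟨du, -⟩ := hc.deg3_of_head? hT h2 hu
  match c, h2 with
  | u' :: w :: t, _ =>
    obtain rfl : u' = u := by simpa using hu
    have huw : T.Adj u' w := hc.1.adj_succ (i := 0) (by simp)
    have hmem : ∀ x, T.Adj u' x → x ≠ w → x ∉ u' :: w :: t := by
      intro x hx hxw hxc
      rcases List.mem_cons.1 hxc with rfl | hxc
      · exact hx.ne rfl
      · exact hxw (hc.1.eq_of_adj hT.2 hxc hx)
    -- the next core node `w` is not a leaf, so the heads of the exit-graphs cannot both have
    -- degree three
    obtain ⟨z, hwz, hzu⟩ : ∃ z, T.Adj w z ∧ z ≠ u' := by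
      cases t with
      | nil =>
        obtain ⟨dw, -⟩ := hc.deg3_of_getLast? hT (by simp) (e := w) (by simp)
        obtain ⟨a, b, d, hab, -, -, hN⟩ := dw.exists_neighbors
        by_cases h : a = u'
        · exact ⟨b, (hN b).2 (by simp), fun e => hab (h.trans e.symm)⟩
        · exact ⟨a, (hN a).2 (by simp), h⟩
      | cons z t =>
        refine ⟨z, hc.1.adj_succ (i := 1) (by simp), ?_⟩
        rintro rfl
        have := (List.nodup_cons.1 hc.1.2).1
        simp at this
    obtain ⟨x₁, x₂, h12, h1w, h2w, hux₁, hux₂⟩ :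
        ∃ x₁ x₂, x₁ ≠ x₂ ∧ x₁ ≠ w ∧ x₂ ≠ w ∧ T.Adj u' x₁ ∧ T.Adj u' x₂ := by
      obtain ⟨a, b, d, hab, had, hbd, hN⟩ := du.exists_neighbors
      rcases (hN w).1 huw with rfl | rfl | rfl
      · exact ⟨b, d, hbd, hab.symm, had.symm, (hN b).2 (by simp), (hN d).2 (by simp)⟩
      · exact ⟨a, d, had, hab, hbd.symm, (hN a).2 (by simp), (hN d).2 (by simp)⟩
      · exact ⟨a, b, hab, had, hbd, (hN a).2 (by simp), (hN b).2 (by simp)⟩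
    have hall : ∀ x, x ∉ u' :: w :: t → T.Adj u' x → x = x₁ ∨ x = x₂ := by
      intro x hx hux
      rcases hG.adj_of_mem hux₁ hux₂ huw h12 h1w h2w hux with h | h | h
      · exact Or.inl h
      · exact Or.inr h
      · exact absurd (by simp [h]) hx
    by_cases d1 : Deg3 T x₁
    · refine ⟨x₂, x₁, h12.symm, hmem _ hux₂ h2w, hmem _ hux₁ h1w, hux₂, hux₁,
        fun x hx hux => (hall x hx hux).symm, fun d2 => hzu ?_⟩
      exact hG.leaf_of_deg3 hT.2 hux₁ hux₂ huw h12 h1w h2w d1 d2 hwz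
    · exact ⟨x₁, x₂, h12, hmem _ hux₁ h1w, hmem _ hux₂ h2w, hux₁, hux₂, hall, d1⟩

/-- The directions `σ y` for the hands (given by their first nodes `y`) of the inner
simple-graph with foot `u`, at position `i`, and head `x` obey the third step of the strategy. -/
structure GoodDirections (T : SimpleGraph V) (c : List V) (i : ℕ) (u x : V) (σ : V → ℤ) : Prop where
  dir : ∀ y, σ y = 1 ∨ σ y = -1
  two : ∀ y y', T.Adj x y → T.Adj x y' → y ≠ u → y' ≠ u → y ≠ y' →
    σ y' = -σ y ∧ ¬ Hits T c (Branch T x y) (i + 1) (σ y)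
  pair : ∀ (s : ℤ) (h S' : Set V) (i' : ℕ) (x' : V), (s = 1 ∨ s = -1) →
    IsPairCase T c s (Branch T u x) i x h S' i' x' → ∀ y, σ y = s
  pair' : ∀ (s : ℤ) (h S' : Set V) (i' : ℕ) (x' : V), (s = 1 ∨ s = -1) →
    IsPairCase T c s S' i' x' h (Branch T u x) i x → ∀ y, σ y = -s
  one : ∀ y, T.Adj x y → y ≠ u → hands T (Branch T u x) x = {Branch T x y} →
    ¬ IsPaired T c (Branch T u x) → ¬ Hits T c (Branch T x y) (i + 1) (σ y)

/-- At most one neighbour of a core node is on its level. -/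
theorem CoreVert.eq_dir (hG : GridCoords T X R) (hT : T.IsTree) (hc : IsTrunkCore T c) {i s t : ℤ}
    (hs : s = 1 ∨ s = -1) (ht : t = 1 ∨ t = -1) (h : CoreVert X c i (i + s))
    (h' : CoreVert X c i (i + t)) : s = t := by
  obtain ⟨u, v, hu, hv, e⟩ := h
  obtain ⟨u', w, hu', hw, e'⟩ := h'
  obtain rfl := hu.unique hu'
  by_contra hst
  refine hG.level_ne (v := u) ((coreAt_adj_iff hT.2 hc.1 hu hv).2 (by omega))
    ((coreAt_adj_iff hT.2 hc.1 hu hw).2 (by omega)) ?_ (e.symm.trans e')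
  rintro rfl
  have := coreAt_inj hc.1 hv hw
  omega

/-- A one-handed inner simple-graph that is in no constrained case has a free direction. -/
theorem IsTrunkCore.exists_free [Finite V] (hG : GridCoords T X R) (hT : T.IsTree)
    (hc : IsTrunkCore T c) (h2 : 2 ≤ c.length) {i : ℕ} {u x y : V} (hi : IsInner c i)
    (hu : (c)[i]? = some u) (hx : x ∉ c) (hux : T.Adj u x) (hxy : T.Adj x y) (hyu : y ≠ u)
    (hh : hands T (Branch T u x) x = {Branch T x y}) (hp : ¬ IsPaired T c (Branch T u x)) :
    ∃ s : ℤ, (s = 1 ∨ s = -1) ∧ ¬ Hits T c (Branch T x y) (i + 1) s := by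
  obtain ⟨l, hl, -, hn⟩ := hc.exists_hand_line hG hT h2 (List.mem_of_getElem? hu) hx hux hxy hyu
  have hS : IsSimpleGraphAt T c (Branch T u x) i x :=
    (isSimpleGraphAt_iff hT.2 hc.1).2 ⟨u, hu, hux, hx, rfl⟩
  by_cases hv : ∃ t : ℤ, (t = 1 ∨ t = -1) ∧ CoreVert X c i (i + t)
  · obtain ⟨t, ht, hv⟩ := hv
    obtain ⟨⟨h3, h4⟩, -, h5⟩ := hc.corner hG hT hi ht (coreAt_nat.2 hu) hx hux hl hv
    -- beside the corner only the next core node can block direction `t`; if it does, then it is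
    -- the foot of a simple-graph with at most one hand, and a hit in direction `-t` would be the
    -- constrained case
    by_cases hd : CoreDeg3 T c (i + t)
    · refine ⟨-t, by omega, fun hhit => hp ?_⟩
      obtain ⟨w, ⟨m, hm, hw⟩, dw⟩ := hd
      obtain ⟨z, hz, hwz⟩ := IsInner.exists_head hT.2 hc.1 hw dw
      have hmi : IsInner c m := isInner_iff.2 (by omega)
      have h6 := (hc.corner (l := []) hG hT hmi (s := -t) (by omega) (coreAt_nat.2 hw) hz hwz
        ⟨by simpa using hwz, by simpa using hwz.ne⟩ (by
          rw [hm, show (i : ℤ) + t + -t = i by ring]; exact hv.symm)).2.1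
      exact ⟨t, _, i, x, _, Branch T w z, m, z, ht, ⟨hi, hS, hh, hmi, hm,
        (isSimpleGraphAt_iff hT.2 hc.1).2 ⟨w, hw, hwz, hz, rfl⟩, hands_subsingleton hG hT hwz h6,
        hhit⟩, Or.inl rfl⟩
    · refine ⟨t, ht, fun hhit => ?_⟩
      obtain ⟨j, hj1, hj2, hj3⟩ := (hits_iff hG hT hc h2).1 hhit
      by_cases hj : j = 1
      · subst hj; exact hd (by simpa using hj3)
      · exact h5 j (by omega) (by simp; omega) hj3
  · push Not at hv
    obtain ⟨s, hs, -, h3⟩ := hc.straight hG hT hi (coreAt_nat.2 hu) hx hux hl (hv 1 (Or.inl rfl))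
      (hv (-1) (Or.inr rfl))
    refine ⟨s, hs, fun hhit => ?_⟩
    obtain ⟨j, hj1, hj2, hj3⟩ := (hits_iff hG hT hc h2).1 hhit
    exact h3 j (by omega) (by omega) hj3

/-- The hands of each inner simple-graph can be given directions that obey the third step. -/
theorem IsTrunkCore.exists_goodDirections [Finite V] (hG : GridCoords T X R) (hT : T.IsTree)
    (hc : IsTrunkCore T c) (h2 : 2 ≤ c.length) {i : ℕ} {u x : V} (hi : IsInner c i)
    (hu : (c)[i]? = some u) (hx : x ∉ c) (hux : T.Adj u x) :
    ∃ σ, GoodDirections T c i u x σ := by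
  have hS : IsSimpleGraphAt T c (Branch T u x) i x :=
    (isSimpleGraphAt_iff hT.2 hc.1).2 ⟨u, hu, hux, hx, rfl⟩
  -- a two-handed simple-graph excludes vertical core steps at its foot, and each hand runs in the
  -- direction that it has in the given embedding; it belongs to no constrained case
  by_cases dx : Deg3 T x
  · have hnv : ∀ t : ℤ, (t = 1 ∨ t = -1) → ¬ CoreVert X c i (i + t) := fun t ht hv =>
      (hc.corner (l := []) hG hT hi ht (coreAt_nat.2 hu) hx hux
        ⟨by simpa using hux, by simpa using hux.ne⟩ hv).2.1 dx
    have hex : ∀ y, ∃ s : ℤ, (s = 1 ∨ s = -1) ∧ (T.Adj x y → y ≠ u →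
        (∃ p, CoreAt c (i + s) p ∧ X y = X p) ∧ ¬ Hits T c (Branch T x y) (i + 1) s) := by
      intro y
      by_cases hy : T.Adj x y ∧ y ≠ u
      · obtain ⟨l, hl, -, hn⟩ := hc.exists_hand_line hG hT h2 (List.mem_of_getElem? hu) hx hux
          hy.1 hy.2
        obtain ⟨s, hs, h3, h4⟩ := hc.straight hG hT hi (coreAt_nat.2 hu) hx hux hl
          (hnv 1 (Or.inl rfl)) (hnv (-1) (Or.inr rfl))
        refine ⟨s, hs, fun _ _ => ⟨h3, fun hhit => ?_⟩⟩
        obtain ⟨j, hj1, hj2, hj3⟩ := (hits_iff hG hT hc h2).1 hhit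
        exact h4 j (by omega) (by omega) hj3
      · exact ⟨1, Or.inl rfl, fun h1 h3 => absurd ⟨h1, h3⟩ hy⟩
    choose σ hσ hσ' using hex
    obtain ⟨y, y', hyy', hxy, hxy', hyu, hyu'⟩ :
        ∃ y y', y ≠ y' ∧ T.Adj x y ∧ T.Adj x y' ∧ y ≠ u ∧ y' ≠ u := by
      obtain ⟨a, b, d, hab, had, hbd, hN⟩ := dx.exists_neighbors
      rcases (hN u).1 hux.symm with rfl | rfl | rfl
      · exact ⟨b, d, hbd, (hN b).2 (by simp), (hN d).2 (by simp), hab.symm, had.symm⟩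
      · exact ⟨a, d, had, (hN a).2 (by simp), (hN d).2 (by simp), hab, hbd.symm⟩
      · exact ⟨a, b, hab, (hN a).2 (by simp), (hN b).2 (by simp), had, hbd⟩
    have hnsub : ¬ (hands T (Branch T u x) x).Subsingleton := by
      intro h
      rw [hands_branch hT hux] at h
      exact hyy' (branch_injective hT.2 hxy hxy' (h ⟨y, hxy, hyu, rfl⟩ ⟨y', hxy', hyu', rfl⟩))
    refine ⟨σ, hσ, ?_, ?_, ?_, ?_⟩
    · intro y y' hxy hxy' hyu hyu' hyy'
      refine ⟨?_, (hσ' y hxy hyu).2⟩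
      obtain ⟨p, hp, e⟩ := (hσ' y hxy hyu).1
      obtain ⟨p', hp', e'⟩ := (hσ' y' hxy' hyu').1
      have h1 := hσ y
      have h3 := hσ y'
      by_contra hne
      have : σ y' = σ y := by omega
      rw [this] at hp'
      obtain rfl := hp.unique hp'
      exact hG.level_ne hxy hxy' hyy' (e.trans e'.symm)
    · rintro s h S' i' x' - ⟨-, -, hh, -⟩
      exact absurd (by rw [hh]; exact Set.subsingleton_singleton) hnsub
    · rintro s h S' i' x' - ⟨-, -, -, -, -, -, hh, -⟩
      exact absurd hh hnsub
    · intro y _ _ hh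
      exact absurd (by rw [hh]; exact Set.subsingleton_singleton) hnsub
  · have hone : ∀ y y', T.Adj x y → T.Adj x y' → y ≠ u → y' ≠ u → y = y' := by
      intro y y' hxy hxy' hyu hyu'
      by_contra h
      exact dx (hG.deg3_of_adj hux.symm hxy hxy' hyu.symm hyu'.symm h)
    have hpv : ∀ (s : ℤ) (h S' : Set V) (i' : ℕ) (x' : V), (s = 1 ∨ s = -1) →
        IsPairCase T c s (Branch T u x) i x h S' i' x' → CoreVert X c i (i + s) :=
      fun s h S' i' x' hs hp => hp.coreVert hG hT hc h2 hs
    have hpv' : ∀ (s : ℤ) (h S' : Set V) (i' : ℕ) (x' : V), (s = 1 ∨ s = -1) →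
        IsPairCase T c s S' i' x' h (Branch T u x) i x → CoreVert X c i (i + -s) := by
      intro s h S' i' x' hs hp
      have hv := hp.coreVert hG hT hc h2 hs
      have e : (i : ℤ) = i' + s := hp.2.2.2.2.1
      rw [show (i : ℤ) + -s = i' by omega, e]
      exact hv.symm
    -- all constrained cases in which the simple-graph takes part prescribe the direction of the
    -- unique vertical core step at its foot
    by_cases hp : IsPaired T c (Branch T u x)
    · obtain ⟨t, ht, hv⟩ : ∃ t : ℤ, (t = 1 ∨ t = -1) ∧ CoreVert X c i (i + t) := by
        obtain ⟨s, S₁, i₁, x₁, h₁, S₂, i₂, x₂, hs, hp, rfl | rfl⟩ := hp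
        · obtain ⟨rfl, rfl⟩ := hS.unique hT.2 hc.1 hp.2.1
          exact ⟨s, hs, hpv s _ _ _ _ hs hp⟩
        · obtain ⟨rfl, rfl⟩ := hS.unique hT.2 hc.1 hp.2.2.2.2.2.1
          exact ⟨-s, by omega, hpv' s _ _ _ _ hs hp⟩
      refine ⟨fun _ => t, fun _ => ht, ?_, ?_, ?_, ?_⟩
      · intro y y' hxy hxy' hyu hyu' hyy'
        exact absurd (hone y y' hxy hxy' hyu hyu') hyy'
      · intro s h S' i' x' hs hp y
        exact hv.eq_dir hG hT hc ht hs (hpv s h S' i' x' hs hp)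
      · intro s h S' i' x' hs hp y
        exact hv.eq_dir hG hT hc ht (by omega) (hpv' s h S' i' x' hs hp)
      · intro y _ _ _ hnp
        exact absurd hp hnp
    · obtain ⟨t, ht, hfree⟩ : ∃ t : ℤ, (t = 1 ∨ t = -1) ∧ ∀ y, T.Adj x y → y ≠ u →
          hands T (Branch T u x) x = {Branch T x y} →
          ¬ Hits T c (Branch T x y) (i + 1) t := by
        by_cases hy : ∃ y, T.Adj x y ∧ y ≠ u ∧ hands T (Branch T u x) x = {Branch T x y}
        · obtain ⟨y, hxy, hyu, hh⟩ := hy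
          obtain ⟨t, ht, hfree⟩ := hc.exists_free hG hT h2 hi hu hx hux hxy hyu hh hp
          refine ⟨t, ht, fun y' hxy' hyu' _ => ?_⟩
          rwa [hone y' y hxy' hxy hyu' hyu]
        · exact ⟨1, Or.inl rfl, fun y h1 h3 h4 => absurd ⟨y, h1, h3, h4⟩ hy⟩
      refine ⟨fun _ => t, fun _ => ht, ?_, ?_, ?_, ?_⟩
      · intro y y' hxy hxy' hyu hyu' hyy'
        exact absurd (hone y y' hxy hxy' hyu hyu') hyy'
      · intro s h S' i' x' hs hp'
        exact absurd ⟨s, _, i, x, h, S', i', x', hs, hp', Or.inl rfl⟩ hp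
      · intro s h S' i' x' hs hp'
        exact absurd ⟨s, S', i', x', h, _, i, x, hs, hp', Or.inr rfl⟩ hp
      · intro y hxy hyu hh _
        exact hfree y hxy hyu hh

theorem IsTrunkCore.exists_largeStrategy [Finite V] (hG : GridCoords T X R) (hT : T.IsTree)
    (hc : IsTrunkCore T c) (h2 : 2 ≤ c.length) : ∃ f, LargeStrategy T c f := by
  classical
  have hk : ((c.length - 1 : ℕ) : ℤ) = c.length - 1 := by omega
  obtain ⟨w, hw⟩ := exists_coreAt (c := c) (z := (0 : ℕ)) (by omega) (by omega)
  obtain ⟨u, hu⟩ := exists_coreAt (c := c) (z := (c.length - 1 : ℕ)) (by omega) (by omega)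
  have huw : u ≠ w := by
    rintro rfl
    have := coreAt_inj hc.1 hu hw
    omega
  rw [coreAt_nat] at hu hw
  obtain ⟨z₁, z₂, hz, hz₁, hz₂, hwz₁, hwz₂, hzall, dz₁⟩ := hc.exists_exits hG hT h2 (u := w)
    (by rw [List.head?_eq_getElem?]; exact hw)
  obtain ⟨x₁, x₂, hx, hx₁, hx₂, hux₁, hux₂, hxall, dx₁⟩ := hc.reverse.exists_exits hG hT
    (by simpa using h2) (u := u)
    (by rw [List.head?_reverse, List.getLast?_eq_getElem?]; exact hu)
  simp only [List.mem_reverse] at hx₁ hx₂ hxall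
  have huc := List.mem_of_getElem? hu
  have hwc := List.mem_of_getElem? hw
  have hfoot : ∀ {a b x : V}, a ∈ c → b ∈ c → x ∉ c → T.Adj a x → T.Adj b x → a = b := by
    intro a b x ha hb hx hax hbx
    exact (branch_eq_of_mem hT.2 hc.1 ha hx hax hb hx hbx (head_mem_branch hax)
      (head_mem_branch hbx)).1
  have hne : ∀ {x z : V}, x ∉ c → T.Adj u x → T.Adj w z → z ≠ x := by
    rintro x z hx hux hwz rfl
    exact huw (hfoot huc hwc hx hux hwz)
  -- `fi x` is the position of the foot of the head `x`, and `σ x` gives the directions of its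
  -- hands
  have hfi : ∀ x, ∃ i : ℤ, ∀ (j : ℕ) (a : V), (c)[j]? = some a → x ∉ c → T.Adj a x → i = j := by
    intro x
    by_cases h : ∃ (j : ℕ) (a : V), (c)[j]? = some a ∧ x ∉ c ∧ T.Adj a x
    · obtain ⟨j, a, ha, hx, hax⟩ := h
      refine ⟨j, fun j' a' ha' _ hax' => ?_⟩
      obtain rfl := hfoot (List.mem_of_getElem? ha) (List.mem_of_getElem? ha') hx hax hax'
      exact coreAt_inj hc.1 (coreAt_nat.2 ha) (coreAt_nat.2 ha')
    · exact ⟨0, fun j a ha hx hax => absurd ⟨j, a, ha, hx, hax⟩ h⟩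
  choose fi hfi using hfi
  have hσ : ∀ x, ∃ σ : V → ℤ, ∀ (i : ℕ) (a : V), IsInner c i → (c)[i]? = some a → x ∉ c →
      T.Adj a x → GoodDirections T c i a x σ := by
    intro x
    by_cases h : ∃ (i : ℕ) (a : V), IsInner c i ∧ (c)[i]? = some a ∧ x ∉ c ∧ T.Adj a x
    · obtain ⟨i, a, hi, ha, hx, hax⟩ := h
      obtain ⟨σ, hσ⟩ := hc.exists_goodDirections hG hT h2 hi ha hx hax
      refine ⟨σ, fun i' a' _ ha' _ hax' => ?_⟩
      obtain rfl := hfoot (List.mem_of_getElem? ha) (List.mem_of_getElem? ha') hx hax hax'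
      have := coreAt_inj hc.1 (coreAt_nat.2 ha) (coreAt_nat.2 ha')
      obtain rfl : i = i' := by omega
      exact hσ
    · exact ⟨fun _ => 0, fun i a hi ha hx hax => absurd ⟨i, a, hi, ha, hx, hax⟩ h⟩
  choose σ hσ using hσ
  obtain ⟨f, hf1, hf⟩ := hc.exists_placement hG hT h2
    (fun x => if x = x₁ then c.length + 1 else if x = x₂ then c.length else
      if x = z₁ then 0 else if x = z₂ then 1 else fi x + 1)
    (fun x => if x = x₁ ∨ x = z₁ then 0 else 1)
    (fun x y => if x = x₁ ∨ x = x₂ then 1 else if x = z₁ ∨ x = z₂ then -1 else σ x y)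
  have hinner : ∀ (i : ℕ) (a x : V), IsInner c i → (c)[i]? = some a → x ∉ c → T.Adj a x →
      f x = ((i : ℤ) + 1, 1) ∧ ∀ y, T.Adj x y → y ≠ a →
        HandAlong T f x (Branch T x y) (i + 1) (σ x y) 1 := by
    intro i a x hi ha hx hax
    have hac := List.mem_of_getElem? ha
    have hi' := isInner_iff.1 hi
    have e1 : ∀ z, T.Adj u z → x ≠ z := by
      rintro z huz rfl
      obtain rfl := hfoot hac huc hx hax huz
      have := coreAt_inj hc.1 (coreAt_nat.2 ha) (coreAt_nat.2 hu)
      omega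
    have e2 : ∀ z, T.Adj w z → x ≠ z := by
      rintro z hwz rfl
      obtain rfl := hfoot hac hwc hx hax hwz
      have := coreAt_inj hc.1 (coreAt_nat.2 ha) (coreAt_nat.2 hw)
      omega
    have := hf a hac x hx hax
    simpa only [e1 x₁ hux₁, e1 x₂ hux₂, e2 z₁ hwz₁, e2 z₂ hwz₂, if_false, or_self,
      hfi x i a ha hx hax] using this
  have hf_x₁ := hf u huc x₁ hx₁ hux₁
  have hf_x₂ := hf u huc x₂ hx₂ hux₂
  have hf_z₁ := hf w hwc z₁ hz₁ hwz₁
  have hf_z₂ := hf w hwc z₂ hz₂ hwz₂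
  simp only [if_true, true_or] at hf_x₁
  simp only [hx.symm, (hne hx₂ hux₂ hwz₁).symm, if_true, if_false, or_true, or_false] at hf_x₂
  simp only [hne hx₁ hux₁ hwz₁, hne hx₂ hux₂ hwz₁, if_true, if_false, or_true, true_or,
    or_false] at hf_z₁
  simp only [hne hx₁ hux₁ hwz₂, hne hx₂ hux₂ hwz₂, hz.symm, if_true, if_false, or_true,
    or_false] at hf_z₂
  refine ⟨f, hf1, ?_, ?_, ?_, ?_, ?_, ?_⟩
  · intro S i x hi hS
    obtain ⟨a, ha, hax, hx, rfl⟩ := (isSimpleGraphAt_iff hT.2 hc.1).1 hS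
    exact (hinner i a x hi ha hx hax).1
  · intro S i x h₁ h₂ hi hS hne hh
    obtain ⟨a, ha, hax, hx, rfl⟩ := (isSimpleGraphAt_iff hT.2 hc.1).1 hS
    have m1 : h₁ ∈ hands T (Branch T a x) x := by rw [hh]; simp
    have m2 : h₂ ∈ hands T (Branch T a x) x := by rw [hh]; simp
    rw [hands_branch hT hax] at m1 m2
    obtain ⟨y, hxy, hya, rfl⟩ := m1
    obtain ⟨y', hxy', hya', rfl⟩ := m2
    have hyy' : y ≠ y' := fun e => hne (e ▸ rfl)
    have hg := hσ x i a hi ha hx hax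
    obtain ⟨-, hfh⟩ := hinner i a x hi ha hx hax
    obtain ⟨t1, t2⟩ := hg.two y y' hxy hxy' hya hya' hyy'
    obtain ⟨-, t3⟩ := hg.two y' y hxy' hxy hya' hya hyy'.symm
    refine ⟨σ x y, hg.dir y, t2, t1 ▸ t3, hfh y hxy hya, ?_⟩
    rw [← t1]
    exact hfh y' hxy' hya'
  · intro s S i x h S' i' x' hs hp
    have hp' := hp
    obtain ⟨hi, hS, hh, hi', -, hS', -, -⟩ := hp'
    obtain ⟨a, ha, hax, hx, rfl⟩ := (isSimpleGraphAt_iff hT.2 hc.1).1 hS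
    obtain ⟨a', ha', hax', hx', rfl⟩ := (isSimpleGraphAt_iff hT.2 hc.1).1 hS'
    refine ⟨?_, fun h' hh' => ?_⟩
    · have m : h ∈ hands T (Branch T a x) x := by rw [hh]; simp
      rw [hands_branch hT hax] at m
      obtain ⟨y, hxy, hya, rfl⟩ := m
      rw [← (hσ x i a hi ha hx hax).pair s _ _ _ _ hs hp y]
      exact (hinner i a x hi ha hx hax).2 y hxy hya
    · rw [hands_branch hT hax'] at hh'
      obtain ⟨y, hxy, hya, rfl⟩ := hh'
      rw [← (hσ x' i' a' hi' ha' hx' hax').pair' s _ _ _ _ hs hp y]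
      exact (hinner i' a' x' hi' ha' hx' hax').2 y hxy hya
  · intro S i x h hi hS hh hnp
    obtain ⟨a, ha, hax, hx, rfl⟩ := (isSimpleGraphAt_iff hT.2 hc.1).1 hS
    have m : h ∈ hands T (Branch T a x) x := by rw [hh]; simp
    rw [hands_branch hT hax] at m
    obtain ⟨y, hxy, hya, rfl⟩ := m
    have hg := hσ x i a hi ha hx hax
    exact ⟨σ x y, hg.dir y, hg.one y hxy hya hh hnp, (hinner i a x hi ha hx hax).2 y hxy hya⟩
  · refine ⟨Branch T u x₁, Branch T u x₂, x₁, x₂, fun e => hx (branch_injective hT.2 hux₁ hux₂ e),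
      (isSimpleGraphAt_iff hT.2 hc.1).2 ⟨u, hu, hux₁, hx₁, rfl⟩,
      (isSimpleGraphAt_iff hT.2 hc.1).2 ⟨u, hu, hux₂, hx₂, rfl⟩, ?_,
      hands_subsingleton hG hT hux₁ dx₁, encard_hands_le_two hG hT hux₂, ?_, ?_, ?_, ?_⟩
    · intro S x hS
      obtain ⟨a, ha, hax, hx, rfl⟩ := (isSimpleGraphAt_iff hT.2 hc.1).1 hS
      obtain rfl : a = u := by rw [hu] at ha; exact (Option.some.inj ha).symm
      rcases hxall x hx hax with rfl | rfl
      exacts [Or.inl rfl, Or.inr rfl]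
    · rw [hf_x₁.1, hk]; congr 1; ring
    · rw [hands_branch hT hux₁, hk]
      rintro _ ⟨y, hy, hyu, rfl⟩
      rw [show (c.length : ℤ) - 1 + 1 + 1 = c.length + 1 by ring]
      exact hf_x₁.2 y hy hyu
    · rw [hf_x₂.1, hk]; congr 1; ring
    · rw [hands_branch hT hux₂, hk]
      rintro _ ⟨y, hy, hyu, rfl⟩
      rw [show (c.length : ℤ) - 1 + 1 = c.length by ring]
      exact hf_x₂.2 y hy hyu
  · refine ⟨Branch T w z₁, Branch T w z₂, z₁, z₂, fun e => hz (branch_injective hT.2 hwz₁ hwz₂ e),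
      (isSimpleGraphAt_iff hT.2 hc.1).2 ⟨w, hw, hwz₁, hz₁, rfl⟩,
      (isSimpleGraphAt_iff hT.2 hc.1).2 ⟨w, hw, hwz₂, hz₂, rfl⟩, ?_,
      hands_subsingleton hG hT hwz₁ dz₁, encard_hands_le_two hG hT hwz₂, ?_, ?_, ?_, ?_⟩
    · intro S x hS
      obtain ⟨a, ha, hax, hx, rfl⟩ := (isSimpleGraphAt_iff hT.2 hc.1).1 hS
      obtain rfl : a = w := by rw [hw] at ha; exact (Option.some.inj ha).symm
      rcases hzall x hx hax with rfl | rfl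
      exacts [Or.inl rfl, Or.inr rfl]
    · rw [hf_z₁.1]; rfl
    · rw [hands_branch hT hwz₁]
      rintro _ ⟨y, hy, hyu, rfl⟩
      simpa using hf_z₁.2 y hy hyu
    · rw [hf_z₂.1]; rfl
    · rw [hands_branch hT hwz₂]
      rintro _ ⟨y, hy, hyu, rfl⟩
      simpa using hf_z₂.2 y hy hyu

end Existence

section Small

variable {V : Type*} {T : SimpleGraph V} {X R : V → ℤ} {f : V → ℤ × Fin 2}

/-! ### Trunk cores with at most one node -/

theorem encard_level_le_one {l : Set V} {m : ℤ}
    (h : ∀ u ∈ l, ∀ v ∈ l, (f u).1 = (f v).1 → u = v) : {v | v ∈ l ∧ (f v).1 = m}.encard ≤ 1 := by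
  rw [Set.encard_le_one_iff]
  rintro a b ⟨ha, ha'⟩ ⟨hb, hb'⟩
  exact h a ha b hb (ha'.trans hb'.symm)

/-- Two sets covering `V`, on each of which the level is injective, leave at most two vertices
on each level. -/
theorem encard_level_le_three (A B : Set V) (hc : ∀ v, v ∈ A ∨ v ∈ B)
    (hA : ∀ u ∈ A, ∀ v ∈ A, (f u).1 = (f v).1 → u = v)
    (hB : ∀ u ∈ B, ∀ v ∈ B, (f u).1 = (f v).1 → u = v) (m : ℤ) :
    {v | (f v).1 = m}.encard ≤ 3 := by
  have : {v | (f v).1 = m} ⊆ {v | v ∈ A ∧ (f v).1 = m} ∪ {v | v ∈ B ∧ (f v).1 = m} := by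
    intro v hv
    exact (hc v).imp (fun h => ⟨h, hv⟩) (fun h => ⟨h, hv⟩)
  refine (Set.encard_le_encard this).trans ((Set.encard_union_le _ _).trans
    ((add_le_add (encard_level_le_one hA) (encard_level_le_one hB)).trans ?_))
  norm_num

theorem SmallZero.isQuasiCorrect (hT : T.IsTree) (hf : SmallZero T f) : IsQuasiCorrect T f := by
  obtain ⟨l, hl, hall, hp⟩ := hf
  obtain ⟨r⟩ := hT.1.nonempty
  have hinj := fun u (_ : u ∈ {v | v ∈ l}) v (_ : v ∈ {v | v ∈ l}) =>
    hp.injOn (Or.inl rfl) (hall u) (hall v)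
  exact ⟨adj_map_of_reachable hT r fun v => hp.reachable hl (Or.inl rfl) (hall r) (hall v),
    encard_level_le_three _ _ (fun v => Or.inl (hall v)) hinj hinj⟩

theorem IsTwoLines.isQuasiCorrect (hT : T.IsTree) {l₁ l₂ : List V} {i j : ℕ} {b : ℤ}
    (h : IsTwoLines T l₁ l₂ i j) (h₁ : PlacedAlong f l₁ 1 1 0) (h₂ : PlacedAlong f l₂ b 1 1)
    (hb : b + j = i + 1) : IsQuasiCorrect T f := by
  obtain ⟨hl₁, hl₂, -, hall, u, w, hu, hw, huw⟩ := h
  have hu' := List.mem_of_getElem? hu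
  have hw' := List.mem_of_getElem? hw
  refine ⟨adj_map_of_reachable hT u fun v => ?_, encard_level_le_three {v | v ∈ l₁} {v | v ∈ l₂}
    (fun v => List.mem_append.1 (hall v)) (fun u hu v hv => h₁.injOn (Or.inl rfl) hu hv)
    (fun u hu v hv => h₂.injOn (Or.inl rfl) hu hv)⟩
  rcases List.mem_append.1 (hall v) with hv | hv
  · exact h₁.reachable hl₁ (Or.inl rfl) hu' hv
  · refine SimpleGraph.Reachable.trans (SimpleGraph.Adj.reachable ⟨huw, ?_⟩)
      (h₂.reachable hl₂ (Or.inl rfl) hw' hv)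
    rw [ladder_int_adj, h₁ i u hu, h₂ j w hw]
    refine Or.inr ⟨?_, by simp⟩
    dsimp only
    omega

theorem PlacedAlong.exists_pos {l : List V} {a s : ℤ} {r : Fin 2} (h : PlacedAlong f l a s r) {v : V}
    (hv : v ∈ l) : ∃ j : ℕ, f v = (a + s * j, r) := by
  obtain ⟨j, hj⟩ := List.getElem?_of_mem hv
  exact ⟨j, h j v hj⟩

theorem SmallThree.isQuasiCorrect (hT : T.IsTree) (hf : SmallThree T f) : IsQuasiCorrect T f := by
  obtain ⟨a, b, c, d, la₁, la₂, lc₁, lc₂, -, -, -, hab, hbc, hbd, -, hall, la1, la2, lc1, lc2,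
    fb, fd, fa, fc, pa₁, pa₂, pc₁, pc₂⟩ := hf
  have pa₁' : PlacedAlong f (a :: la₁) 1 (-1) 0 := PlacedAlong.cons (by simpa using pa₁) fa
  have pc₁' : PlacedAlong f (c :: lc₁) 3 1 0 := PlacedAlong.cons (by simpa using pc₁) fc
  have hall' : ∀ v, (v ∈ a :: la₁ ∨ v = b ∨ v ∈ c :: lc₁) ∨ (v ∈ la₂ ∨ v = d ∨ v ∈ lc₂) := by
    intro v
    have := hall v
    simp only [List.mem_append, List.mem_cons, List.not_mem_nil, or_false] at this
    simp only [List.mem_cons]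
    tauto
  have hba : (respected T f).Reachable b a := SimpleGraph.Adj.reachable
    ⟨hab.symm, by rw [ladder_int_adj, fb, fa]; simp⟩
  have hbc' : (respected T f).Reachable b c := SimpleGraph.Adj.reachable
    ⟨hbc, by rw [ladder_int_adj, fb, fc]; simp⟩
  have hbd' : (respected T f).Reachable b d := SimpleGraph.Adj.reachable
    ⟨hbd, by rw [ladder_int_adj, fb, fd]; simp⟩
  have hside : ∀ {x : V} {l : List V} {m s : ℤ}, IsLine T (x :: l) → f x = (m, 0) →
      (s = 1 ∨ s = -1) → PlacedAlong f l m s 1 → ∀ v ∈ l, (respected T f).Reachable x v := by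
    intro x l m s hl hx hs hp v hv
    cases l with
    | nil => simp at hv
    | cons y l =>
      refine SimpleGraph.Reachable.trans (SimpleGraph.Adj.reachable
        ⟨hl.adj_succ (i := 0) (by simp), ?_⟩) (hp.reachable hl.of_cons hs List.mem_cons_self hv)
      have := hp 0 y rfl
      rw [ladder_int_adj]
      simp only [List.getElem_cons_zero, List.getElem_cons_succ, Nat.zero_add]
      rw [hx, this]
      simp
  refine ⟨adj_map_of_reachable hT b fun v => ?_, encard_level_le_three
    {v | v ∈ a :: la₁ ∨ v = b ∨ v ∈ c :: lc₁} {v | v ∈ la₂ ∨ v = d ∨ v ∈ lc₂} hall' ?_ ?_⟩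
  · rcases hall' v with (h | rfl | h) | (h | rfl | h)
    · exact hba.trans (pa₁'.reachable la1 (Or.inr rfl) List.mem_cons_self h)
    · rfl
    · exact hbc'.trans (pc₁'.reachable lc1 (Or.inl rfl) List.mem_cons_self h)
    · exact hba.trans (hside la2 fa (Or.inr rfl) pa₂ v h)
    · exact hbd'
    · exact hbc'.trans (hside lc2 fc (Or.inl rfl) pc₂ v h)
  · have hneg : ∀ v ∈ a :: la₁, (f v).1 ≤ 1 := fun v hv => by
      obtain ⟨j, hj⟩ := pa₁'.exists_pos hv
      rw [hj]; dsimp only; omega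
    have hpos : ∀ v ∈ c :: lc₁, 3 ≤ (f v).1 := fun v hv => by
      obtain ⟨j, hj⟩ := pc₁'.exists_pos hv
      rw [hj]; dsimp only; omega
    have hb1 : (f b).1 = 2 := by rw [fb]
    rintro u (hu | rfl | hu) v (hv | rfl | hv) e
    · exact pa₁'.injOn (Or.inr rfl) hu hv e
    · have := hneg u hu; omega
    · have := hneg u hu; have := hpos v hv; omega
    · have := hneg v hv; omega
    · rfl
    · have := hpos v hv; omega
    · have := hneg v hv; have := hpos u hu; omega
    · have := hpos u hu; omega
    · exact pc₁'.injOn (Or.inl rfl) hu hv e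
  · have hneg : ∀ v ∈ la₂, (f v).1 ≤ 1 := fun v hv => by
      obtain ⟨j, hj⟩ := pa₂.exists_pos hv
      rw [hj]; dsimp only; omega
    have hpos : ∀ v ∈ lc₂, 3 ≤ (f v).1 := fun v hv => by
      obtain ⟨j, hj⟩ := pc₂.exists_pos hv
      rw [hj]; dsimp only; omega
    have hd1 : (f d).1 = 2 := by rw [fd]
    rintro u (hu | rfl | hu) v (hv | rfl | hv) e
    · exact pa₂.injOn (Or.inr rfl) hu hv e
    · have := hneg u hu; omega
    · have := hneg u hu; have := hpos v hv; omega
    · have := hneg v hv; omega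
    · rfl
    · have := hpos v hv; omega
    · have := hneg v hv; have := hpos u hu; omega
    · have := hpos u hu; omega
    · exact pc₂.injOn (Or.inl rfl) hu hv e

theorem SmallStrategy.isQuasiCorrect (hT : T.IsTree) (hf : SmallStrategy T f) :
    IsQuasiCorrect T f := by
  rcases hf with ⟨-, h⟩ | ⟨-, l₁, l₂, i, h, h₁, h₂⟩ | ⟨-, l₁, l₂, i, j, h, h₁, h₂⟩ | ⟨-, h⟩
  · exact h.isQuasiCorrect hT
  · exact h.isQuasiCorrect hT h₁ h₂ (by simp)
  · exact h.isQuasiCorrect hT h₁ h₂ (by ring)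
  · exact h.isQuasiCorrect hT

/-- Disjoint lists can be placed independently; an entry consists of a list, the level of its first
vertex, the direction and the row. -/
theorem exists_placedAlong : ∀ D : List (List V × ℤ × ℤ × Fin 2), (D.map Prod.fst).flatten.Nodup →
    ∃ f : V → ℤ × Fin 2, ∀ p ∈ D, PlacedAlong f p.1 p.2.1 p.2.2.1 p.2.2.2 := by
  classical
  intro D
  induction D with
  | nil => intro _; exact ⟨fun _ => (0, 0), by simp⟩
  | cons p D ih =>
    intro hD
    rw [List.map_cons, List.flatten_cons, List.nodup_append] at hD
    obtain ⟨f, hf⟩ := ih hD.2.1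
    refine ⟨fun v => if v ∈ p.1 then (p.2.1 + p.2.2.1 * p.1.idxOf v, p.2.2.2) else f v, ?_⟩
    intro q hq j v hv
    have hvq := List.mem_of_getElem? hv
    rcases List.mem_cons.1 hq with rfl | hq
    · obtain ⟨hj, rfl⟩ := List.getElem?_eq_some_iff.1 hv
      simp [hD.1.idxOf_getElem]
    · have hvp : v ∉ p.1 := fun hvp => hD.2.2 v hvp v
        (List.mem_flatten.2 ⟨q.1, List.mem_map_of_mem hq, hvq⟩) rfl
      simp only [hvp, if_false]
      exact hf q hq j v hv

/-- A branch without vertices of degree three is a line. -/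
theorem GridCoords.exists_arm [Finite V] (hG : GridCoords T X R) (hT : T.IsTree) {u x : V}
    (h : T.Adj u x) (hd : ∀ v ∈ Branch T u x, ¬ Deg3 T v) :
    ∃ l : List V, IsLine T (u :: l) ∧ ∀ v, v ∈ l ↔ v ∈ Branch T u x := by
  obtain ⟨l, hl, hm⟩ := exists_line_of_branch hT h fun v hv a b c ha hb hc hab hac hbc =>
    hd v hv (hG.deg3_of_adj ha hb hc hab hac hbc)
  exact ⟨x :: l, hl, hm⟩

/-- Two linear branches at `u` and `u` itself form a line. -/
theorem isLine_of_arms (hT : T.IsAcyclic) {u a b : V} (ha : T.Adj u a) (hb : T.Adj u b)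
    (hab : a ≠ b) {la lb : List V} (hla : IsLine T (u :: la)) (hlb : IsLine T (u :: lb))
    (ma : ∀ v, v ∈ la ↔ v ∈ Branch T u a) (mb : ∀ v, v ∈ lb ↔ v ∈ Branch T u b) :
    IsLine T (la.reverse ++ u :: lb) := by
  refine isLine_append hla.of_cons.reverse hlb ?_ ?_
  · intro v hv hv'
    rw [List.mem_reverse] at hv
    rcases List.mem_cons.1 hv' with rfl | hv'
    · exact (List.nodup_cons.1 hla.2).1 hv
    · exact hab (Branch.head_unique hT ha hb ((ma v).1 hv) ((mb v).1 hv'))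
  · cases la with
    | nil => simp
    | cons a' la =>
      have : T.Adj u a' := hla.adj_succ (i := 0) (by simp)
      simp [this.symm]

theorem exists_smallZero [Finite V] (hG : GridCoords T X R) (hT : T.IsTree)
    (hd : ∀ v, ¬ Deg3 T v) : ∃ f, SmallZero T f := by
  classical
  obtain ⟨l, hl, hall⟩ : ∃ l : List V, IsLine T l ∧ ∀ v, v ∈ l := by
    rcases subsingleton_or_nontrivial V with hV | hV
    · obtain ⟨r⟩ := hT.1.nonempty
      exact ⟨[r], ⟨by simp, by simp⟩, fun v => by simp [Subsingleton.elim v r]⟩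
    · have := Fintype.ofFinite V
      obtain ⟨u, hu⟩ := hT.exists_vert_degree_one_of_nontrivial
      obtain ⟨x, hux, hx⟩ := SimpleGraph.degree_eq_one_iff_existsUnique_adj.1 hu
      obtain ⟨l, hl, hm⟩ := hG.exists_arm hT hux fun v _ => hd v
      refine ⟨u :: l, hl, fun v => ?_⟩
      rw [List.mem_cons, hm]
      by_cases h : v = u
      · exact Or.inl h
      · obtain ⟨y, huy, hv⟩ := exists_mem_branch hT.1 h
        obtain rfl := hx y huy
        exact Or.inr hv
  obtain ⟨f, hf⟩ := exists_placedAlong [(l, 1, 1, 0)] (by simpa using hl.2)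
  exact ⟨f, l, hl, hall, hf (l, 1, 1, 0) (by simp)⟩

theorem exists_placed_of_isTwoLines {l₁ l₂ : List V} {i j : ℕ} (h : IsTwoLines T l₁ l₂ i j) (b : ℤ) :
    ∃ f, PlacedAlong f l₁ 1 1 0 ∧ PlacedAlong f l₂ b 1 1 := by
  obtain ⟨f, hf⟩ := exists_placedAlong [(l₁, 1, 1, 0), (l₂, b, 1, 1)] (by simpa using h.2.2.1)
  exact ⟨f, hf (l₁, 1, 1, 0) (by simp), hf (l₂, b, 1, 1) (by simp)⟩

theorem exists_smallOne [Finite V] (hG : GridCoords T X R) (hT : T.IsTree) {u : V}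
    (du : Deg3 T u) (hd : ∀ v, Deg3 T v → v = u) : ∃ f, SmallOne T f := by
  obtain ⟨a, b, d, hab, had, hbd, hN⟩ := du.exists_neighbors
  have ha := (hN a).2 (by simp)
  have hb := (hN b).2 (by simp)
  have hdd := (hN d).2 (by simp)
  have hfree : ∀ x, ∀ v ∈ Branch T u x, ¬ Deg3 T v := by
    intro x v hv dv
    rw [hd v dv] at hv
    exact not_mem_branch hv
  obtain ⟨la, hla, ma⟩ := hG.exists_arm hT ha (hfree a)
  obtain ⟨lb, hlb, mb⟩ := hG.exists_arm hT hb (hfree b)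
  obtain ⟨ld, hld, md⟩ := hG.exists_arm hT hdd (hfree d)
  have h2 : IsTwoLines T (la.reverse ++ u :: lb) ld la.length 0 := by
    have hl := isLine_of_arms hT.2 ha hb hab hla hlb ma mb
    refine ⟨hl, hld.of_cons, List.nodup_append.2 ⟨hl.2, hld.of_cons.2, ?_⟩, ?_, u, d, ?_, ?_, hdd⟩
    · rintro v hv w hw rfl
      rw [md] at hw
      simp only [List.mem_append, List.mem_reverse, List.mem_cons, ma, mb] at hv
      rcases hv with hv | rfl | hv
      · exact had (Branch.head_unique hT.2 ha hdd hv hw)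
      · exact not_mem_branch hw
      · exact hbd (Branch.head_unique hT.2 hb hdd hv hw)
    · intro v
      simp only [List.mem_append, List.mem_reverse, List.mem_cons, ma, mb, md]
      by_cases h : v = u
      · tauto
      · obtain ⟨y, huy, hv⟩ := exists_mem_branch hT.1 h
        rcases (hN y).1 huy with rfl | rfl | rfl <;> tauto
    · rw [List.getElem?_append_right (by simp)]; simp
    · cases ld with
      | nil => exact absurd ((md d).2 (head_mem_branch hdd)) (by simp)
      | cons d' ld =>
        have h1 : T.Adj u d' := hld.adj_succ (i := 0) (by simp)
        have := Branch.head_unique hT.2 h1 hdd (head_mem_branch h1) ((md d').1 (by simp))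
        simp [this]
  obtain ⟨f, h3, h4⟩ := exists_placed_of_isTwoLines h2 (la.length + 1)
  exact ⟨f, _, _, _, h2, h3, h4⟩

theorem exists_smallTwo [Finite V] (hG : GridCoords T X R) (hT : T.IsTree) {u w : V}
    (huw : T.Adj u w) (du : Deg3 T u) (dw : Deg3 T w) (hd : ∀ v, Deg3 T v → v = u ∨ v = w) :
    ∃ f, SmallTwo T f := by
  have hthird : ∀ {u w : V}, T.Adj u w → Deg3 T u →
      ∃ a b, T.Adj u a ∧ T.Adj u b ∧ a ≠ b ∧ a ≠ w ∧ b ≠ w ∧ ∀ y, T.Adj u y → y = a ∨ y = b ∨ y = w := by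
    intro u w huw du
    obtain ⟨a, b, d, hab, had, hbd, hN⟩ := du.exists_neighbors
    have ha := (hN a).2 (by simp)
    have hb := (hN b).2 (by simp)
    have hdd := (hN d).2 (by simp)
    rcases (hN w).1 huw with rfl | rfl | rfl
    · exact ⟨b, d, hb, hdd, hbd, hab.symm, had.symm, fun y hy => by have := (hN y).1 hy; tauto⟩
    · exact ⟨a, d, ha, hdd, had, hab, hbd.symm, fun y hy => by have := (hN y).1 hy; tauto⟩
    · exact ⟨a, b, ha, hb, hab, had, hbd, fun y hy => by have := (hN y).1 hy; tauto⟩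
  -- each of the two parts left after deleting the edge `u w` is a line
  have hline : ∀ {u w : V}, T.Adj u w → Deg3 T u → (∀ v, Deg3 T v → v = u ∨ v = w) →
      ∃ la lb : List V, IsLine T (la.reverse ++ u :: lb) ∧
        ∀ v, v ∈ la.reverse ++ u :: lb ↔ v ∈ Branch T w u := by
    intro u w huw du hd
    obtain ⟨a, b, ha, hb, hab, haw, hbw, hN⟩ := hthird huw du
    have hfree : ∀ x, T.Adj u x → x ≠ w → ∀ v ∈ Branch T u x, ¬ Deg3 T v := by
      intro x hx hxw v hv dv
      rcases hd v dv with rfl | rfl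
      · exact not_mem_branch hv
      · exact hxw (Branch.head_unique hT.2 hx huw hv (head_mem_branch huw))
    obtain ⟨la, hla, ma⟩ := hG.exists_arm hT ha (hfree a ha haw)
    obtain ⟨lb, hlb, mb⟩ := hG.exists_arm hT hb (hfree b hb hbw)
    refine ⟨la, lb, isLine_of_arms hT.2 ha hb hab hla hlb ma mb, fun v => ?_⟩
    simp only [List.mem_append, List.mem_reverse, List.mem_cons, ma, mb]
    constructor
    · rintro (hv | rfl | hv)
      · exact branch_subset hT.2 huw.symm ha haw hv
      · exact head_mem_branch huw.symm
      · exact branch_subset hT.2 huw.symm hb hbw hv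
    · intro hv
      by_cases h : v = u
      · exact Or.inr (Or.inl h)
      · obtain ⟨y, huy, hyw, hvy⟩ := Branch.exists_sub hT huw.symm hv h
        rcases hN y huy with rfl | rfl | rfl
        · exact Or.inl hvy
        · exact Or.inr (Or.inr hvy)
        · exact absurd rfl hyw
  obtain ⟨la, lb, h1, m1⟩ := hline huw du hd
  obtain ⟨lc, ld, h2, m2⟩ := hline huw.symm dw (fun v hv => (hd v hv).symm)
  have h3 : IsTwoLines T (la.reverse ++ u :: lb) (lc.reverse ++ w :: ld) la.length lc.length := by
    refine ⟨h1, h2, List.nodup_append.2 ⟨h1.2, h2.2, ?_⟩, ?_, u, w, ?_, ?_, huw⟩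
    · rintro v hv v' hv' rfl
      exact Branch.not_mem_swap hT.2 huw.symm ((m1 v).1 hv) ((m2 v).1 hv')
    · intro v
      rw [List.mem_append, m1, m2]
      by_cases h : v = u
      · subst h; exact Or.inl (head_mem_branch huw.symm)
      · obtain ⟨y, huy, hv⟩ := exists_mem_branch hT.1 h
        by_cases hyw : y = w
        · subst hyw; exact Or.inr hv
        · exact Or.inl (branch_subset hT.2 huw.symm huy hyw hv)
    · rw [List.getElem?_append_right (by simp)]; simp
    · rw [List.getElem?_append_right (by simp)]; simp
  obtain ⟨f, h4, h5⟩ := exists_placed_of_isTwoLines h3 (la.length - lc.length + 1)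
  exact ⟨f, _, _, _, _, h3, h4, h5⟩

theorem exists_smallThree [Finite V] (hG : GridCoords T X R) (hT : T.IsTree) {a b c d : V}
    (da : Deg3 T a) (db : Deg3 T b) (dc : Deg3 T c) (hba : T.Adj b a) (hbc : T.Adj b c)
    (hbd : T.Adj b d) (hac : a ≠ c) (had : a ≠ d) (hcd : c ≠ d) (hleaf : ∀ z, T.Adj d z → z = b)
    (hd : ∀ v, Deg3 T v → v = a ∨ v = b ∨ v = c) : ∃ f, SmallThree T f := by
  -- the branch at `b` through `a` (and likewise through `c`) is `a` with two lines attached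
  have harms : ∀ {x : V}, T.Adj b x → Deg3 T x → (∀ v ∈ Branch T b x, Deg3 T v → v = x) →
      ∃ l₁ l₂ : List V, IsLine T (x :: l₁) ∧ IsLine T (x :: l₂) ∧ (∀ v ∈ l₁, v ∉ l₂) ∧
        (∀ v, v ∈ Branch T b x ↔ v = x ∨ v ∈ l₁ ∨ v ∈ l₂) := by
    intro x hbx dx hx
    obtain ⟨p, q, r, hpq, hpr, hqr, hN⟩ := dx.exists_neighbors
    have key : ∀ {p q r : V}, p ≠ q → p ≠ b → q ≠ b → T.Adj x p → T.Adj x q →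
        (∀ y, T.Adj x y → y = p ∨ y = q ∨ y = b) →
        ∃ l₁ l₂ : List V, IsLine T (x :: l₁) ∧ IsLine T (x :: l₂) ∧ (∀ v ∈ l₁, v ∉ l₂) ∧
        (∀ v, v ∈ Branch T b x ↔ v = x ∨ v ∈ l₁ ∨ v ∈ l₂) := by
      intro p q r hpq hpb hqb hxp hxq hN
      have hfree : ∀ y, T.Adj x y → y ≠ b → ∀ v ∈ Branch T x y, ¬ Deg3 T v := by
        intro y hy hyb v hv dv
        rw [hx v (branch_subset hT.2 hbx hy hyb hv) dv] at hv
        exact not_mem_branch hv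
      obtain ⟨l₁, hl₁, m₁⟩ := hG.exists_arm hT hxp (hfree p hxp hpb)
      obtain ⟨l₂, hl₂, m₂⟩ := hG.exists_arm hT hxq (hfree q hxq hqb)
      refine ⟨l₁, l₂, hl₁, hl₂, fun v h1 h2 =>
        hpq (Branch.head_unique hT.2 hxp hxq ((m₁ v).1 h1) ((m₂ v).1 h2)), fun v => ?_⟩
      rw [m₁, m₂]
      constructor
      · intro hv
        by_cases h : v = x
        · exact Or.inl h
        · obtain ⟨y, hxy, hyb, hvy⟩ := Branch.exists_sub hT hbx hv h
          rcases hN y hxy with rfl | rfl | rfl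
          · exact Or.inr (Or.inl hvy)
          · exact Or.inr (Or.inr hvy)
          · exact absurd rfl hyb
      · rintro (rfl | hv | hv)
        · exact head_mem_branch hbx
        · exact branch_subset hT.2 hbx hxp hpb hv
        · exact branch_subset hT.2 hbx hxq hqb hv
    have hp := (hN p).2 (by simp)
    have hq := (hN q).2 (by simp)
    have hr := (hN r).2 (by simp)
    rcases (hN b).1 hbx.symm with rfl | rfl | rfl
    · exact key (r := b) hqr hpq.symm hpr.symm hq hr fun y hy => by have := (hN y).1 hy; tauto
    · exact key (r := b) hpr hpq hqr.symm hp hr fun y hy => by have := (hN y).1 hy; tauto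
    · exact key (r := b) hpq hpr hqr hp hq fun y hy => by have := (hN y).1 hy; tauto
  have hdis : ∀ {x y v : V}, T.Adj b x → T.Adj b y → x ≠ y → v ∈ Branch T b x →
      v ∉ Branch T b y := fun hx hy hxy h1 h2 => hxy (Branch.head_unique hT.2 hx hy h1 h2)
  obtain ⟨la₁, la₂, ha1, ha2, ha3, ha4⟩ := harms hba da (by
    intro v hv dv
    rcases hd v dv with h | rfl | rfl
    · exact h
    · exact absurd hv not_mem_branch
    · exact absurd hv (hdis hbc hba hac.symm (head_mem_branch hbc)))
  obtain ⟨lc₁, lc₂, hc1, hc2, hc3, hc4⟩ := harms hbc dc (by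
    intro v hv dv
    rcases hd v dv with rfl | rfl | h
    · exact absurd hv (hdis hba hbc hac (head_mem_branch hba))
    · exact absurd hv not_mem_branch
    · exact h)
  have hac' : ∀ v, v ∈ Branch T b a → v ∉ Branch T b c := fun v => hdis hba hbc hac
  have hbda := hdis hbd hba had.symm (head_mem_branch hbd)
  have hbdc := hdis hbd hbc hcd.symm (head_mem_branch hbd)
  have hba' : b ∉ Branch T b a := not_mem_branch
  have hbc' : b ∉ Branch T b c := not_mem_branch
  have na1 := List.nodup_cons.1 ha1.2
  have na2 := List.nodup_cons.1 ha2.2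
  have nc1 := List.nodup_cons.1 hc1.2
  have nc2 := List.nodup_cons.1 hc2.2
  have hnab := hba.ne
  have hnbc := hbc.ne
  have hnbd := hbd.ne
  simp only [ha4, hc4] at hac' hbda hbdc hba' hbc'
  have hnod : ([a, b, c, d] ++ la₁ ++ la₂ ++ lc₁ ++ lc₂).Nodup := by
    simp only [List.nodup_append, List.mem_append, List.mem_cons, List.not_mem_nil, or_false,
      List.nodup_cons, List.nodup_nil, and_true]
    grind
  have hall : ∀ v, v ∈ [a, b, c, d] ++ la₁ ++ la₂ ++ lc₁ ++ lc₂ := by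
    intro v
    simp only [List.mem_append, List.mem_cons, List.not_mem_nil, or_false]
    by_cases h : v = b
    · tauto
    · obtain ⟨y, hby, hv⟩ := exists_mem_branch hT.1 h
      rcases hG.adj_of_mem hba hbc hbd hac had hcd hby with rfl | rfl | rfl
      · have := (ha4 v).1 hv; tauto
      · have := (hc4 v).1 hv; tauto
      · by_cases h' : v = y
        · tauto
        · obtain ⟨z, hyz, hzb, -⟩ := Branch.exists_sub hT hbd hv h'
          exact absurd (hleaf z hyz) hzb
  obtain ⟨f, hf⟩ := exists_placedAlong [([a, b, c], 1, 1, 0), ([d], 2, 1, 1), (la₁, 0, -1, 0),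
    (la₂, 1, -1, 1), (lc₁, 4, 1, 0), (lc₂, 3, 1, 1)] (by simpa using hnod)
  have p0 := hf ([a, b, c], 1, 1, 0) (by simp)
  have p1 := hf ([d], 2, 1, 1) (by simp)
  refine ⟨f, a, b, c, d, la₁, la₂, lc₁, lc₂, da, db, dc, hba.symm, hbc, hbd, hnod, hall,
    ha1, ha2, hc1, hc2, ?_, ?_, ?_, ?_, hf (la₁, 0, -1, 0) (by simp), hf (la₂, 1, -1, 1) (by simp),
    hf (lc₁, 4, 1, 0) (by simp), hf (lc₂, 3, 1, 1) (by simp)⟩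
  · simpa using p0 1 b rfl
  · simpa using p1 0 d rfl
  · simpa using p0 0 a rfl
  · simpa using p0 2 c rfl

theorem Deg3.exists_ne {v u : V} (h : Deg3 T v) : ∃ z, T.Adj v z ∧ z ≠ u := by
  obtain ⟨a, b, c, hab, -, -, hN⟩ := h.exists_neighbors
  by_cases hu : a = u
  · exact ⟨b, (hN b).2 (by simp), fun e => hab (hu.trans e.symm)⟩
  · exact ⟨a, (hN a).2 (by simp), hu⟩

/-- Without support nodes there are no vertices of degree three or two adjacent ones. -/
theorem exists_smallStrategy_of_nil [Finite V] (hG : GridCoords T X R) (hT : T.IsTree)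
    (hc : IsTrunkCore T []) : ∃ f, SmallStrategy T f := by
  have hns : ∀ v, ¬ IsSupportNode T v := fun v hv => by simpa using hc.2.1 v hv
  by_cases hD : ∃ u, Deg3 T u
  · obtain ⟨u, du⟩ := hD
    obtain ⟨w, huw, dw⟩ : ∃ w, T.Adj u w ∧ Deg3 T w := by
      by_contra h
      push Not at h
      exact hns u (Or.inl ⟨du, h⟩)
    have hd : ∀ v, Deg3 T v → v = u ∨ v = w := by
      intro v dv
      by_contra h
      push Not at h
      obtain ⟨x, hux, hv⟩ := exists_mem_branch hT.1 h.1
      by_cases hxw : x = w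
      · subst hxw
        exact hns x (isSupportNode_of_separates hT.1 dv du h.2 huw.ne fun p =>
          (Branch.mem_support_of_exit hT.2 hux hv not_mem_branch p).1)
      · exact hns u (isSupportNode_of_separates hT.1 dv dw h.1 huw.ne' fun p =>
          (Branch.mem_support_of_exit hT.2 hux hv (fun hw => hxw
            (Branch.head_unique hT.2 hux huw hw (head_mem_branch huw))) p).2)
    obtain ⟨f, hf⟩ := exists_smallTwo hG hT huw du dw hd
    refine ⟨f, Or.inr (Or.inr (Or.inl ⟨?_, hf⟩))⟩
    rw [← Set.encard_pair huw.ne]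
    congr 1
    ext v
    simp only [Set.mem_ofPred_eq, Set.mem_insert_iff, Set.mem_singleton_iff]
    exact ⟨hd v, by rintro (rfl | rfl) <;> assumption⟩
  · push Not at hD
    obtain ⟨f, hf⟩ := exists_smallZero hG hT hD
    refine ⟨f, Or.inl ⟨?_, hf⟩⟩
    rw [Set.encard_eq_zero]
    ext v
    simpa using hD v

/-- A single support node is the only vertex of degree three, or it lies between the only two other
ones, which are adjacent to it. -/
theorem exists_smallStrategy_of_singleton [Finite V] (hG : GridCoords T X R) (hT : T.IsTree)
    {b : V} (hc : IsTrunkCore T [b]) : ∃ f, SmallStrategy T f := by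
  have hns : ∀ v, IsSupportNode T v → v = b := fun v hv => by simpa using hc.2.1 v hv
  have hb : IsSupportNode T b := hc.2.2.1 b rfl
  -- a vertex of degree three off `b` is a neighbour of `b` if one lies in another branch at `b`
  have hnear : ∀ {x y v w : V}, T.Adj b x → v ∈ Branch T b x → Deg3 T v → T.Adj b y → x ≠ y →
      w ∈ Branch T b y → Deg3 T w → v = x := by
    intro x y v w hbx hv dv hby hxy hw dw
    by_contra h
    have hwx : w ∉ Branch T b x := fun h => hxy (Branch.head_unique hT.2 hbx hby h hw)
    refine hbx.ne' (hns x (isSupportNode_of_separates hT.1 dv dw h ?_ fun p =>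
      (Branch.mem_support_of_exit hT.2 hbx hv hwx p).1))
    rintro rfl
    exact hwx (head_mem_branch hbx)
  by_cases hs : IsSingle T b
  · have hd : ∀ v, Deg3 T v → v = b := by
      intro v dv
      by_contra h
      obtain ⟨x, hbx, hv⟩ := exists_mem_branch hT.1 h
      refine hbx.ne' (hns x (isSupportNode_of_separates hT.1 dv hs.1 ?_ hbx.ne fun p =>
        (Branch.mem_support_of_exit hT.2 hbx hv not_mem_branch p).1))
      rintro rfl
      exact hs.2 v hbx dv
    obtain ⟨f, hf⟩ := exists_smallOne hG hT hs.1 hd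
    refine ⟨f, Or.inr (Or.inl ⟨?_, hf⟩)⟩
    rw [Set.encard_eq_one]
    refine ⟨b, ?_⟩
    ext v
    simp only [Set.mem_ofPred_eq, Set.mem_singleton_iff]
    exact ⟨hd v, by rintro rfl; exact hs.1⟩
  -- otherwise `b` separates two vertices of degree three
  · obtain ⟨a', da', -, hab'⟩ := hb.exists_deg3_behind hT.2 b
    replace hab' := hab'.resolve_right hs
    obtain ⟨a, hba, ha'⟩ := exists_mem_branch hT.1 hab'
    obtain ⟨c', dc', hsep, hcb'⟩ := hb.exists_deg3_behind hT.2 a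
    replace hcb' := hcb'.resolve_right hs
    obtain ⟨c, hbc, hc'⟩ := exists_mem_branch hT.1 hcb'
    have hac : a ≠ c := by
      rintro rfl
      obtain ⟨p, hp⟩ := hc'
      exact hp (hsep p)
    obtain rfl := hnear hba ha' da' hbc hac hc' dc'
    obtain rfl := hnear hbc hc' dc' hba hac.symm ha' da'
    -- `a'` is not single, as it is no support node, and its neighbour of degree three can only be
    -- `b`
    have db : Deg3 T b := by
      have h1 : ¬ IsSingle T a' := fun h => hba.ne' (hns a' (Or.inl h))
      obtain ⟨z, haz, dz⟩ : ∃ z, T.Adj a' z ∧ Deg3 T z := by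
        by_contra h
        push Not at h
        exact h1 ⟨da', h⟩
      rcases Branch.adj hT.2 hba (head_mem_branch hba) haz with h | h
      · exact absurd (hnear hba h dz hbc hac hc' dc') haz.ne'
      · exact h.1 ▸ dz
    obtain ⟨d, hbd, had, hcd⟩ : ∃ d, T.Adj b d ∧ a' ≠ d ∧ c' ≠ d := by
      obtain ⟨p, q, r, hpq, hpr, hqr, hN⟩ := db.exists_neighbors
      have hp := (hN p).2 (by simp)
      have hq := (hN q).2 (by simp)
      have hr := (hN r).2 (by simp)
      rcases (hN a').1 hba with rfl | rfl | rfl <;> rcases (hN c').1 hbc with rfl | rfl | rfl <;>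
        first
        | exact absurd rfl hac
        | exact ⟨r, hr, by assumption, by assumption⟩
        | exact ⟨p, hp, Ne.symm (by assumption), Ne.symm (by assumption)⟩
        | exact ⟨q, hq, by assumption, Ne.symm (by assumption)⟩
        | exact ⟨q, hq, Ne.symm (by assumption), by assumption⟩
    -- the third neighbour `d` of `b` is a leaf, because the embedding puts `a'` and `c'` on both
    -- sides of `b` and leaves no room for neighbours of `d`
    have hleaf : ∀ z, T.Adj d z → z = b := fun z hz =>
      hG.leaf_of_deg3 hT.2 hba hbc hbd hac had hcd da' dc' hz
    have hd : ∀ v, Deg3 T v → v = a' ∨ v = b ∨ v = c' := by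
      intro v dv
      by_cases h : v = b
      · exact Or.inr (Or.inl h)
      obtain ⟨y, hby, hv⟩ := exists_mem_branch hT.1 h
      obtain rfl : v = y := by
        by_cases hya : y = a'
        · subst hya; exact hnear hby hv dv hbc hac hc' dc'
        · exact hnear hby hv dv hba hya ha' da'
      rcases hG.adj_of_mem hba hbc hbd hac had hcd hby with rfl | rfl | rfl
      · exact Or.inl rfl
      · exact Or.inr (Or.inr rfl)
      · obtain ⟨z, hz, hzb⟩ := dv.exists_ne (u := b)
        exact absurd (hleaf z hz) hzb
    obtain ⟨f, hf⟩ := exists_smallThree hG hT da' db dc' hba hbc hbd hac had hcd hleaf hd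
    refine ⟨f, Or.inr (Or.inr (Or.inr ⟨?_, hf⟩))⟩
    rw [Set.encard_eq_three]
    refine ⟨a', b, c', hba.ne', hac, hbc.ne, ?_⟩
    ext v
    simp only [Set.mem_ofPred_eq, Set.mem_insert_iff, Set.mem_singleton_iff]
    exact ⟨hd v, by rintro (rfl | rfl | rfl) <;> assumption⟩

end Small

/-! ### Existence of the trunk core -/

section Existence

variable {V : Type*} {T : SimpleGraph V} {X R : V → ℤ}

/-- If `u` has degree three, then every branch at `u` with a support node contains a vertex of degree
three other than its head: a head is not single, being adjacent to `u`. -/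
theorem IsSupportNode.exists_deg3_mem_branch (hT : T.IsTree) {s u y : V} (hs : IsSupportNode T s)
    (hu : Deg3 T u) (h : T.Adj u y) (hsB : s ∈ Branch T u y) :
    ∃ d ∈ Branch T u y, d ≠ y ∧ Deg3 T d := by
  obtain ⟨d, hd, hsep, hds⟩ := hs.exists_deg3_behind hT.2 u
  have hsu : s ≠ u := by rintro rfl; exact not_mem_branch hsB
  refine ⟨d, ?_, ?_, hd⟩
  · have hdu : d ≠ u := by
      rintro rfl
      simpa [hsu] using hsep .nil
    obtain ⟨z, hz, p, hp⟩ := exists_mem_branch hT.1 hdu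
    have h1 := hsep (.cons hz p)
    rw [SimpleGraph.Walk.support_cons, List.mem_cons] at h1
    obtain rfl := Branch.head_unique hT.2 hz h
      (Branch.of_mem_support hp (h1.resolve_left hsu)) hsB
    exact ⟨p, hp⟩
  · rintro rfl
    have h1 : s = d := by simpa [hsu] using hsep h.toWalk
    exact (hds.resolve_left (fun h2 => h2 h1.symm)).2 u (h1 ▸ h.symm) hu

/-- The nonempty lines between support nodes. -/
def IsSupportLine (T : SimpleGraph V) (c : List V) : Prop :=
  IsLine T c ∧ c ≠ [] ∧ (∀ v, c.head? = some v → IsSupportNode T v) ∧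
    (∀ v, c.getLast? = some v → IsSupportNode T v)

theorem IsSupportLine.reverse {c : List V} (hc : IsSupportLine T c) :
    IsSupportLine T c.reverse := by
  refine ⟨hc.1.reverse, by simpa using hc.2.1, fun v hv => ?_, fun v hv => ?_⟩
  · rw [List.head?_reverse] at hv; exact hc.2.2.2 v hv
  · rw [List.getLast?_reverse] at hv; exact hc.2.2.1 v hv

/-- A support node in a branch at the first node of a line between support nodes prolongs the line.
-/
theorem IsSupportLine.exists_longer (hT : T.IsAcyclic) {u x s : V} {t : List V}
    (hc : IsSupportLine T (u :: t)) (hx : x ∉ u :: t) (h : T.Adj u x) (hs : IsSupportNode T s)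
    (hsB : s ∈ Branch T u x) : ∃ l, IsSupportLine T l ∧ (u :: t).length < l.length := by
  obtain ⟨k, hk, hlast, hkB⟩ := Branch.exists_isLine h hsB
  refine ⟨(x :: k).reverse ++ u :: t, ⟨?_, by simp, fun v hv => ?_, fun v hv => ?_⟩, by simp; omega⟩
  · refine isLine_append hk.of_cons.reverse hc.1 (fun v hv hvc => ?_) ?_
    · exact hc.1.not_mem_branch hT List.mem_cons_self hx h hvc (hkB v (List.mem_reverse.1 hv))
    · intro a ha b hb
      simp only [List.getLast?_reverse, List.head?_cons, Option.mem_def, Option.some.injEq] at ha hb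
      subst ha hb
      exact h.symm
  · rw [List.head?_append, List.head?_reverse, hlast] at hv
    simp only [Option.some_or, Option.some.injEq] at hv
    exact hv ▸ hs
  · rw [List.getLast?_append_of_ne_nil _ (by simp)] at hv
    exact hc.2.2.2 v hv

/-- Behind each inner node of a line between support nodes there is a support node. -/
theorem IsSupportLine.exists_right {u p : V} {A P : List V}
    (hc : IsSupportLine T (A ++ u :: p :: P)) :
    T.Adj u p ∧ ∃ s, IsSupportNode T s ∧ s ∈ Branch T u p := by
  have hl := hc.1.right
  refine ⟨hl.adj_succ (i := 0) (by simp), (p :: P).getLast (by simp), ?_,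
    hl.mem_branch (List.getLast_mem _)⟩
  refine hc.2.2.2 _ ?_
  rw [List.getLast?_append_of_ne_nil _ (by simp), List.getLast?_cons_cons,
    List.getLast?_eq_some_getLast]

/-- A line between support nodes that is as long as possible contains all support nodes: a support
node next to an end would prolong it, and one next to an inner node would give three branches with
vertices of degree three behind their heads. -/
theorem exists_isTrunkCore [Finite V] (hG : GridCoords T X R) (hT : T.IsTree) :
    ∃ c, IsTrunkCore T c := by
  classical
  have := Fintype.ofFinite V
  by_cases h0 : ∃ s, IsSupportNode T s
  swap
  · push Not at h0
    exact ⟨[], ⟨by simp, by simp⟩, fun v hv => absurd hv (h0 v), by simp, by simp⟩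
  obtain ⟨s₀, hs₀⟩ := h0
  -- lengths of lines are bounded by the number of vertices, so there is a longest one
  obtain ⟨c, hc, hmin⟩ := (measure fun l : List V => Fintype.card V - l.length).wf.has_min
    {l | IsSupportLine T l} ⟨[s₀], ⟨by simp, by simp⟩, by simp, by simpa using hs₀, by simpa using hs₀⟩
  have hmax : ∀ l, IsSupportLine T l → ¬ c.length < l.length := by
    intro l hl hlt
    have := hmin l hl
    have := hl.1.2.length_le_card
    simp only [WellFoundedRelation.rel, InvImage] at *
    simp at *
    omega
  replace hc : IsSupportLine T c := hc
  refine ⟨c, hc.1, fun s hs => ?_, hc.2.2⟩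
  by_contra hsc
  obtain ⟨u, hu, x, hx, hux, hsB⟩ := exists_branch_of_not_mem hT.1 hc.2.1 hsc
  obtain ⟨A, B, rfl⟩ := List.append_of_mem hu
  have hc' := hc.reverse
  rcases B with _ | ⟨p, P⟩
  · rw [List.reverse_append] at hc'
    obtain ⟨l, hl, hlt⟩ := hc'.exists_longer hT.2 (by simpa [or_comm] using hx) hux hs hsB
    exact hmax l hl (by simp at *; omega)
  rcases List.eq_nil_or_concat A with rfl | ⟨Q, q, rfl⟩
  · obtain ⟨l, hl, hlt⟩ := hc.exists_longer hT.2 hx hux hs hsB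
    exact hmax l hl hlt
  have he : (Q.concat q ++ u :: p :: P).reverse = (p :: P).reverse ++ u :: q :: Q.reverse := by simp
  rw [he] at hc'
  obtain ⟨hup, s₁, hs₁, hsp⟩ := hc.exists_right
  obtain ⟨huq, s₂, hs₂, hsq⟩ := hc'.exists_right
  have hpq : p ≠ q := by
    rintro rfl
    simpa using (List.nodup_append.1 hc.1.2).2.2 p (by simp) p (by simp)
  have hpx : p ≠ x := by rintro rfl; simp at hx
  have hqx : q ≠ x := by rintro rfl; simp at hx
  have du := hG.deg3_of_adj hup huq hux hpq hpx hqx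
  obtain ⟨d, hd, hdp, dd⟩ := hs₁.exists_deg3_mem_branch hT du hup hsp
  obtain ⟨e, he, heq, de⟩ := hs₂.exists_deg3_mem_branch hT du huq hsq
  obtain ⟨f, hf, hfx, df⟩ := hs.exists_deg3_mem_branch hT du hux hsB
  exact hG.false_of_three_branches hT.2 hup huq hux hpq hpx hqx hd he hf hdp heq hfx dd de df

end Existence

/-! ### The image in a finite ladder -/

section Finite

variable {V : Type*} {T : SimpleGraph V} {f : V → ℤ × Fin 2}

theorem IsQuasiCorrect.level_sub_le (hf : IsQuasiCorrect T f) {u v : V} (p : T.Walk u v) :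
    (f v).1 - (f u).1 ≤ p.length := by
  induction p with
  | nil => simp
  | cons h p ih =>
    have := ladder_int_adj.1 (hf.1 _ _ h)
    rw [SimpleGraph.Walk.length_cons]
    push_cast
    omega

/-- A connected graph occupies an interval of levels, hence at most as many levels as it has
vertices. -/
theorem IsQuasiCorrect.exists_fin [Finite V] (hT : T.Connected) (hf : IsQuasiCorrect T f) {n : ℕ}
    (hn : Nat.card V ≤ n) : ∃ (t : ℤ) (g : V → Fin n × Fin 2),
      (∀ v, (((g v).1 : ℕ) : ℤ) = (f v).1 + t ∧ (g v).2 = (f v).2) ∧ IsQuasiCorrect T g := by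
  classical
  have := Fintype.ofFinite V
  have := hT.nonempty
  obtain ⟨v₀, hv₀⟩ := Finite.exists_min fun v => (f v).1
  have hlt : ∀ v, (f v).1 - (f v₀).1 < n := by
    intro v
    obtain ⟨p, hp⟩ := hT.exists_isPath v₀ v
    have h1 := hf.level_sub_le p
    have h2 := hp.length_lt
    rw [Nat.card_eq_fintype_card] at hn
    omega
  have hg : ∀ v, (((f v).1 - (f v₀).1).toNat : ℤ) = (f v).1 - (f v₀).1 := fun v =>
    Int.toNat_of_nonneg (sub_nonneg.2 (hv₀ v))
  let g : V → Fin n × Fin 2 := fun v =>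
    (⟨((f v).1 - (f v₀).1).toNat, by have := hlt v; have := hg v; omega⟩, (f v).2)
  have hg1 : ∀ v, (((g v).1 : ℕ) : ℤ) = (f v).1 - (f v₀).1 := hg
  refine ⟨-(f v₀).1, g, fun v => ⟨by rw [hg1]; ring, rfl⟩, fun u v h => ?_, fun i => ?_⟩
  · have h1 := ladder_int_adj.1 (hf.1 u v h)
    have h2 := hg1 u
    have h3 := hg1 v
    refine ladder_fin_adj.2 ?_
    rcases h1 with ⟨h1, h4⟩ | ⟨h1, h4⟩
    · exact Or.inl ⟨h1, by omega⟩
    · exact Or.inr ⟨Fin.ext (by omega), h4⟩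
  · refine le_trans (Set.encard_le_encard fun v hv => ?_) (hf.2 (((i : ℕ) : ℤ) + (f v₀).1))
    have h1 : (g v).1 = i := hv
    have h2 := hg1 v
    rw [h1] at h2
    change (f v).1 = _
    omega

end Finite

end LadderTree

theorem mainTheorem1 {V : Type*} [Finite V] (T : SimpleGraph V) (hT : T.IsTree) (n : ℕ)
    (hφ : ∃ φ : V → Fin n × Fin 2,
      LadderTree.IsCorrectEmbedding T (LadderTree.ladder (Fin n)) φ) :
    (∃ c : List V, LadderTree.IsTrunkCore T c) ∧
    ∀ c : List V, LadderTree.IsTrunkCore T c →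
      (∃ f : V → ℤ × Fin 2, LadderTree.IsStrategyEmbedding T c f) ∧
      ∀ f : V → ℤ × Fin 2, LadderTree.IsStrategyEmbedding T c f →
        LadderTree.IsQuasiCorrect T f ∧
        ∃ (t : ℤ) (g : V → Fin (2 * n) × Fin 2),
          (∀ v, (((g v).1 : ℕ) : ℤ) = (f v).1 + t ∧ (g v).2 = (f v).2) ∧
          LadderTree.IsQuasiCorrect T g := by
  obtain ⟨φ, hφ⟩ := hφ
  have hG := LadderTree.gridCoords_of_embedding hφ
  refine ⟨LadderTree.exists_isTrunkCore hG hT, fun c hc => ⟨?_, fun f hf => ?_⟩⟩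
  · rcases lt_or_ge c.length 2 with h | h
    · have hs : ∃ f, LadderTree.SmallStrategy T f := by
        match c, h with
        | [], _ => exact LadderTree.exists_smallStrategy_of_nil hG hT hc
        | [b], _ => exact LadderTree.exists_smallStrategy_of_singleton hG hT hc
      exact hs.imp fun f hf => Or.inl ⟨by omega, hf⟩
    · exact (hc.exists_largeStrategy hG hT h).imp fun f hf => Or.inr ⟨h, hf⟩
  · have hq : LadderTree.IsQuasiCorrect T f := by
      rcases hf with ⟨-, hf⟩ | ⟨h, hf⟩
      · exact hf.isQuasiCorrect hT
      · exact hf.isQuasiCorrect hG hT hc h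
    refine ⟨hq, hq.exists_fin hT.1 ?_⟩
    have h1 := Nat.card_le_card_of_injective φ hφ.1
    rw [Nat.card_prod, Nat.card_fin, Nat.card_fin] at h1
    omega
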